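/- Theorem 2.2 (Canonical Gauge). Let $d\ge 1$, let $\Omega\subset\mathbb{R}^d$ be a bounded Lipschitz domain (a non-empty, bounded, connected open set which near each of its boundary points is, in suitable orthonormal coordinates, the set of points lying above the graph of a Lipschitz function), with outward unit normal $\mathbf{n}$ on $\partial\Omega$, and let $\mathbf{A}\in[C^1(\overline\Omega;\mathbb{R})]^d$. Then the problem of minimizing $\|\mathbf{A}-\nabla v\|_{L^2(\Omega)}$ over $v\in H^1(\Omega;\mathbb{R})$ has a solution $a$, unique up to an additive constant: if $a$ is a minimizer, then the minimizers are exactly the functions $a+c$ with $c\in\mathbb{R}$. Every minimizer $a$ has the following properties. 1. $a$ is a weak solution of the Neumann problem $\Delta a=\nabla\cdot\mathbf{A}$ in $\Omega$, $\nabla a\cdot\mathbf{n}=\mathbf{A}\cdot\mathbf{n}$ on $\partial\Omega$; that is, for all $v\in H^1(\Omega;\mathbb{R})$, $$\int_\Omega\nabla a\cdot\nabla v\,dx=\int_{\partial\Omega}(\mathbf{A}\cdot\mathbf{n})\,v\,ds-\int_\Omega(\nabla\cdot\mathbf{A})\,v\,dx ,$$ where $v$ in the integral over $\partial\Omega$ denotes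 the trace of $v$; moreover $\int_\Omega\nabla a\cdot\nabla v\,dx=\int_\Omega\mathbf{A}\cdot\nabla v\,dx$ for all $v\in H^1(\Omega;\mathbb{R})$. 2. The field $\mathbf{F}=\mathbf{A}-\nabla a$ satisfies $\nabla\cdot\mathbf{F}=0$ in $\Omega$ in the sense of distributions. 3. Call a vector field $\mathbf{G}$ on $\Omega$ equivalent to $\mathbf{A}$ if $\mathbf{A}-\mathbf{G}$ is the weak gradient in $\Omega$ of a real function such that both this function and its weak gradient are locally integrable in $\Omega$. Then $\mathbf{F}$ is equivalent to $\mathbf{A}$, and every $\mathbf{G}$ equivalent to $\mathbf{A}$ satisfies $\|\mathbf{F}\|_{L^2(\Omega)}\le\|\mathbf{G}\|_{L^2(\Omega)}$ (the right-hand side may be $+\infty$), with equality only if $\mathbf{G}=\mathbf{F}$ almost everywhere in $\Omega$. -/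

import Mathlib

open MeasureTheory Set Filter Topology
open scoped ContDiff Gradient InnerProductSpace

noncomputable section

/-- Euclidean space `ℝ^d` with its Euclidean norm and inner product. -/
abbrev Eucl (d : ℕ) : Type := EuclideanSpace ℝ (Fin d)

/-- A bounded Lipschitz domain: a bounded, open, connected, non-empty set such that near every
boundary point `x`, in suitable orthonormal coordinates with `ν` as the last basis vector, `Ω` is
the set of points lying above the graph of a Lipschitz function.  The point
`y - ⟪ν, y⟫ ν` is the orthogonal projection of `y` to the hyperplane orthogonal to `ν`, so only the
values of `γ` on this hyperplane matter (and every Lipschitz function on the hyperplane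
is the restriction of a Lipschitz function `γ` on the whole space). -/
structure IsBoundedLipschitzDomain {d : ℕ} (Ω : Set (Eucl d)) : Prop where
  isOpen : IsOpen Ω
  isBounded : Bornology.IsBounded Ω
  isConnected : IsConnected Ω
  locally_epigraph : ∀ x ∈ frontier Ω, ∃ (ν : Eucl d) (γ : Eucl d → ℝ) (K : NNReal) (r : ℝ),
    ‖ν‖ = 1 ∧ LipschitzWith K γ ∧ 0 < r ∧
      ∀ y ∈ Metric.ball x r, (y ∈ Ω ↔ γ (y - ⟪ν, y⟫_ℝ • ν) < ⟪ν, y⟫_ℝ)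

/-- Vector fields of class `C¹(Ω̄)`: continuous on the closure, continuously differentiable in `Ω`,
and all first derivatives extend continuously to the closure. -/
def IsC1UpToBoundary {d : ℕ} (Ω : Set (Eucl d)) (A : Eucl d → Eucl d) : Prop :=
  ContinuousOn A (closure Ω) ∧ DifferentiableOn ℝ A Ω ∧
    ∃ A' : Eucl d → (Eucl d →L[ℝ] Eucl d), ContinuousOn A' (closure Ω) ∧ EqOn (fderiv ℝ A) A' Ω

/-- The classical (pointwise) divergence `∑ i, ∂ᵢ Aᵢ`. -/
def divergence {d : ℕ} (A : Eucl d → Eucl d) (x : Eucl d) : ℝ :=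
  ∑ i : Fin d, (fderiv ℝ A x (EuclideanSpace.single i (1 : ℝ))) i

/-- Test functions, the space `C_c^∞(Ω)`. -/
def IsTestFunction {d : ℕ} (Ω : Set (Eucl d)) (φ : Eucl d → ℝ) : Prop :=
  ContDiff ℝ ∞ φ ∧ HasCompactSupport φ ∧ tsupport φ ⊆ Ω

/-- `G` is the weak (distributional) gradient of `v` in `Ω`; both are locally integrable in `Ω`. -/
def IsWeakGradient {d : ℕ} (Ω : Set (Eucl d)) (v : Eucl d → ℝ) (G : Eucl d → Eucl d) : Prop :=
  LocallyIntegrableOn v Ω ∧ LocallyIntegrableOn G Ω ∧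
    ∀ φ, IsTestFunction Ω φ → ∫ x in Ω, v x • ∇ φ x = -∫ x in Ω, φ x • G x

/-- The real Sobolev space `H¹(Ω; ℝ)`. -/
def MemH1 {d : ℕ} (Ω : Set (Eucl d)) (v : Eucl d → ℝ) : Prop :=
  MemLp v 2 (volume.restrict Ω) ∧
    ∃ G, IsWeakGradient Ω v G ∧ MemLp G 2 (volume.restrict Ω)

open Classical in
/-- The weak gradient `∇v`, which is unique up to equality almost everywhere in `Ω`
(the junk value `0` is taken when there is no weak gradient). -/
def weakGrad {d : ℕ} (Ω : Set (Eucl d)) (v : Eucl d → ℝ) : Eucl d → Eucl d :=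
  if h : ∃ G, IsWeakGradient Ω v G then h.choose else 0

/-- The vector field `F` has the distributional divergence `f` in `Ω`. -/
def HasWeakDivergence {d : ℕ} (Ω : Set (Eucl d)) (F : Eucl d → Eucl d) (f : Eucl d → ℝ) : Prop :=
  LocallyIntegrableOn F Ω ∧ LocallyIntegrableOn f Ω ∧
    ∀ φ, IsTestFunction Ω φ → ∫ x in Ω, ⟪F x, ∇ φ x⟫_ℝ = -∫ x in Ω, f x * φ x

/-- Surface measure on `∂Ω`: the `(d-1)`-dimensional Hausdorff measure, normalized so as to agree
with Lebesgue measure on `(d-1)`-dimensional Euclidean spaces, restricted to `∂Ω`. -/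
def surfaceMeasure {d : ℕ} (Ω : Set (Eucl d)) : Measure (Eucl d) :=
  (Measure.euclideanHausdorffMeasure (d - 1)).restrict (frontier Ω)

/-- `n` is the outward unit normal of `Ω` at `x`: to first order at `x`, the set `Ω` lies in the
half-space `⟪n, y - x⟫ ≤ 0` and its complement in the half-space `0 ≤ ⟪n, y - x⟫`.
There is at most one such `n`. -/
def IsOutwardUnitNormal {d : ℕ} (Ω : Set (Eucl d)) (x n : Eucl d) : Prop :=
  ‖n‖ = 1 ∧ ∀ ε > 0, ∀ᶠ y in 𝓝 x,
    (y ∈ Ω → ⟪n, y - x⟫_ℝ ≤ ε * ‖y - x‖) ∧ (y ∉ Ω → -(ε * ‖y - x‖) ≤ ⟪n, y - x⟫_ℝ)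

open Classical in
/-- The outward unit normal field on `∂Ω`; on a Lipschitz boundary it exists at almost every point
with respect to surface measure (elsewhere it is given the value `0`). -/
def outwardNormal {d : ℕ} (Ω : Set (Eucl d)) (x : Eucl d) : Eucl d :=
  if h : ∃ n, IsOutwardUnitNormal Ω x n then h.choose else 0

/-- `w ∈ L²(∂Ω)` is the boundary trace of `v ∈ H¹(Ω)`: there are functions `φ k ∈ C^∞(ℝ^d)` which
converge to `v` in `H¹(Ω)` and whose restrictions to `∂Ω` converge to `w` in `L²(∂Ω)`. -/
def IsTrace {d : ℕ} (Ω : Set (Eucl d)) (v w : Eucl d → ℝ) : Prop :=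
  MemH1 Ω v ∧ MemLp w 2 (surfaceMeasure Ω) ∧
    ∃ φ : ℕ → Eucl d → ℝ, (∀ k, ContDiff ℝ ∞ (φ k)) ∧
      Tendsto (fun k => eLpNorm (φ k - v) 2 (volume.restrict Ω)) atTop (𝓝 0) ∧
      Tendsto (fun k => eLpNorm (∇ (φ k) - weakGrad Ω v) 2 (volume.restrict Ω)) atTop (𝓝 0) ∧
      Tendsto (fun k => eLpNorm (φ k - w) 2 (surfaceMeasure Ω)) atTop (𝓝 0)

/-- `a ∈ H¹(Ω)` is a weak solution of the Neumann problem
`Δa = f` in `Ω`, `∇a · n = g` on `∂Ω`, that is,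
`∫_Ω ∇a · ∇v dx = ∫_{∂Ω} g v ds - ∫_Ω f v dx` for all `v ∈ H¹(Ω)`,
where `v` in the boundary integral is the trace `w` of `v`. -/
def IsWeakNeumannSolution {d : ℕ} (Ω : Set (Eucl d)) (f g a : Eucl d → ℝ) : Prop :=
  MemH1 Ω a ∧ ∀ v w, MemH1 Ω v → IsTrace Ω v w →
    ∫ x in Ω, ⟪weakGrad Ω a x, weakGrad Ω v x⟫_ℝ =
      ∫ x, g x * w x ∂(surfaceMeasure Ω) - ∫ x in Ω, f x * v x

/-- `a` minimizes `‖A - ∇v‖_{L²(Ω)}` over `v ∈ H¹(Ω; ℝ)`. -/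
def IsGaugeMinimizer {d : ℕ} (Ω : Set (Eucl d)) (A : Eucl d → Eucl d) (a : Eucl d → ℝ) : Prop :=
  MemH1 Ω a ∧ ∀ v, MemH1 Ω v →
    eLpNorm (A - weakGrad Ω a) 2 (volume.restrict Ω) ≤
      eLpNorm (A - weakGrad Ω v) 2 (volume.restrict Ω)

/-- Two vector fields on `Ω` are equivalent gauges if they differ by a gradient (of any locally
integrable, weakly differentiable scalar field; square integrability is not required). -/
def IsGaugeEquivalent {d : ℕ} (Ω : Set (Eucl d)) (A G : Eucl d → Eucl d) : Prop :=
  ∃ v, IsWeakGradient Ω v (A - G)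

end

/-! ### Weak gradients -/

section WeakGradient

variable {d : ℕ} {Ω : Set (Eucl d)}

/-! The minimization is an orthogonal projection in `L²(Ω)`: `∇a` is the point of the space of weak
gradients nearest to `A`. Existence therefore amounts to this space being closed, and orthogonality
of `A - ∇a` to all gradients is the weak equation. Testing it with `C_c^∞` functions gives the
vanishing divergence; two minimizers have the same gradient, since the difference of their gradients
is a gradient orthogonal to itself.

The analytic core is the Poincaré inequality `HasPoincareOn Ω Ω`, for functions that are only
assumed locally integrable with a weak gradient. It does three jobs. It makes `∇v ↦ v` bounded on
functions of mean zero, so the gradient space is closed (`HasPoincareOn.isClosed_gradientSpace`). It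
makes functions with zero gradient constant, which gives uniqueness. It places every potential with
an `L²` gradient in `H¹`, so that a gauge-equivalent field of finite norm comes from an admissible
competitor, which gives the third property. The inequality is proved on sets star-shaped with
respect to a ball by integrating `∇v` along segments (`hasPoincareOn_of_starShaped`). Truncated
local epigraphs are such sets, and finitely many pieces are glued along overlaps using connectedness
(`hasPoincareOn_of_finite_cover`).

The boundary term needs Gauss–Green for the Hausdorff surface measure and the geometric normal. Over
a Lipschitz graph the surface measure has density `√(1 + |∇g|²)`
(`comap_graphMap_euclideanHausdorffMeasure`, by piecewise linear approximation). Shearing the graph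
to a hyperplane reduces the divergence theorem to the fundamental theorem of calculus in the
vertical variable (`setIntegral_fderiv_openEpigraph`), and a partition of unity globalizes it. Since
traces are defined by smooth approximation, the Neumann identity follows from the smooth case by
passing to the limit. -/

theorem LocallyIntegrableOn.integrable_smul_of_tsupport_subset {E : Type*} [NormedAddCommGroup E]
    [NormedSpace ℝ E] {f : Eucl d → E} (hf : LocallyIntegrableOn f Ω) {g : Eucl d → ℝ}
    (hg : Continuous g) (hc : HasCompactSupport g) (hs : tsupport g ⊆ Ω) :
    Integrable (fun x => g x • f x) := by
  have h1 : IntegrableOn (fun x => g x • f x) (tsupport g) :=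
    (hf.integrableOn_compact_subset hs hc).continuousOn_smul hg.continuousOn hc
  refine (integrableOn_iff_integrable_of_support_subset ?_).1 h1
  exact (Function.support_smul_subset_left _ _).trans (subset_tsupport g)

theorem LocallyIntegrableOn.integrable_smul_vec_of_tsupport_subset {E : Type*}
    [NormedAddCommGroup E] [NormedSpace ℝ E] {f : Eucl d → ℝ} (hf : LocallyIntegrableOn f Ω)
    {g : Eucl d → E} (hg : Continuous g) (hc : HasCompactSupport g) (hs : tsupport g ⊆ Ω) :
    Integrable (fun x => f x • g x) := by
  have h1 : IntegrableOn (fun x => f x • g x) (tsupport g) :=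
    (hf.integrableOn_compact_subset hs hc).smul_continuousOn hg.continuousOn hc
  refine (integrableOn_iff_integrable_of_support_subset ?_).1 h1
  exact (Function.support_smul_subset_right _ _).trans (subset_tsupport g)

theorem ContDiff.continuous_gradient {φ : Eucl d → ℝ} {n : WithTop ℕ∞} (h : ContDiff ℝ n φ)
    (hn : n ≠ 0) : Continuous (∇ φ) :=
  (InnerProductSpace.toDual ℝ (Eucl d)).symm.continuous.comp (h.continuous_fderiv hn)

theorem tsupport_gradient_subset (φ : Eucl d → ℝ) : tsupport (∇ φ) ⊆ tsupport φ := by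
  refine (closure_mono ?_).trans (tsupport_fderiv_subset ℝ (f := φ))
  intro x hx
  simpa [gradient] using hx

theorem HasCompactSupport.gradient {φ : Eucl d → ℝ} (h : HasCompactSupport φ) :
    HasCompactSupport (∇ φ) :=
  h.of_isClosed_subset (isClosed_tsupport _) (tsupport_gradient_subset φ)

namespace IsTestFunction

variable {φ : Eucl d → ℝ}

theorem continuous (h : IsTestFunction Ω φ) : Continuous φ := h.1.continuous

theorem continuous_gradient (h : IsTestFunction Ω φ) : Continuous (∇ φ) :=
  h.1.continuous_gradient (by simp)

theorem mono {S : Set (Eucl d)} (h : IsTestFunction S φ) (hS : S ⊆ Ω) : IsTestFunction Ω φ :=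
  ⟨h.1, h.2.1, h.2.2.trans hS⟩

theorem gradient_eq_zero (h : IsTestFunction Ω φ) {x : Eucl d} (hx : x ∉ Ω) : ∇ φ x = 0 :=
  image_eq_zero_of_notMem_tsupport fun h' => hx (h.2.2 (tsupport_gradient_subset φ h'))

theorem eq_zero (h : IsTestFunction Ω φ) {x : Eucl d} (hx : x ∉ Ω) : φ x = 0 :=
  image_eq_zero_of_notMem_tsupport fun h' => hx (h.2.2 h')

theorem integrable_smul (h : IsTestFunction Ω φ) {E : Type*} [NormedAddCommGroup E]
    [NormedSpace ℝ E] {f : Eucl d → E} (hf : LocallyIntegrableOn f Ω) :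
    Integrable (fun x => φ x • f x) :=
  LocallyIntegrableOn.integrable_smul_of_tsupport_subset hf h.continuous h.2.1 h.2.2

theorem integrable_smul_gradient (h : IsTestFunction Ω φ) {f : Eucl d → ℝ}
    (hf : LocallyIntegrableOn f Ω) : Integrable (fun x => f x • ∇ φ x) :=
  LocallyIntegrableOn.integrable_smul_vec_of_tsupport_subset hf h.continuous_gradient h.2.1.gradient
    ((tsupport_gradient_subset φ).trans h.2.2)

theorem setIntegral_smul (h : IsTestFunction Ω φ) {E : Type*} [NormedAddCommGroup E]
    [NormedSpace ℝ E] (f : Eucl d → E) : ∫ x in Ω, φ x • f x = ∫ x, φ x • f x :=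
  setIntegral_eq_integral_of_forall_compl_eq_zero fun x hx => by simp [h.eq_zero hx]

theorem setIntegral_smul_gradient (h : IsTestFunction Ω φ) (f : Eucl d → ℝ) :
    ∫ x in Ω, f x • ∇ φ x = ∫ x, f x • ∇ φ x :=
  setIntegral_eq_integral_of_forall_compl_eq_zero fun x hx => by simp [h.gradient_eq_zero hx]

end IsTestFunction

theorem LocallyIntegrableOn.congr_ae_restrict {E : Type*} [NormedAddCommGroup E]
    {f g : Eucl d → E} (hΩ : IsOpen Ω) (hf : LocallyIntegrableOn f Ω)
    (h : f =ᵐ[volume.restrict Ω] g) : LocallyIntegrableOn g Ω := by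
  rw [locallyIntegrableOn_iff hΩ.isLocallyClosed] at hf ⊢
  intro k hk hkc
  exact (hf k hk hkc).congr_fun_ae (ae_restrict_of_ae_restrict_of_subset hk h)

theorem MeasureTheory.MemLp.locallyIntegrableOn {E : Type*} [NormedAddCommGroup E]
    {f : Eucl d → E} {p : ENNReal} (hp : 1 ≤ p) (hf : MemLp f p (volume.restrict Ω)) :
    LocallyIntegrableOn f Ω :=
  locallyIntegrableOn_of_locallyIntegrable_restrict (hf.locallyIntegrable hp)

namespace IsWeakGradient

variable {v w : Eucl d → ℝ} {G H : Eucl d → Eucl d}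

theorem congr (hΩ : IsOpen Ω) (h : IsWeakGradient Ω v G) (hv : v =ᵐ[volume.restrict Ω] w)
    (hG : G =ᵐ[volume.restrict Ω] H) : IsWeakGradient Ω w H := by
  refine ⟨LocallyIntegrableOn.congr_ae_restrict hΩ h.1 hv,
    LocallyIntegrableOn.congr_ae_restrict hΩ h.2.1 hG, fun φ hφ => ?_⟩
  have h1 : ∫ x in Ω, w x • ∇ φ x = ∫ x in Ω, v x • ∇ φ x :=
    integral_congr_ae (hv.mono fun x hx => by simp only [hx])
  have h2 : ∫ x in Ω, φ x • H x = ∫ x in Ω, φ x • G x :=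
    integral_congr_ae (hG.mono fun x hx => by simp only [hx])
  rw [h1, h2, h.2.2 φ hφ]

/-- The fundamental lemma of the calculus of variations applied to `G - H`. It makes the arbitrary
choice in `weakGrad` harmless. -/
theorem unique (hΩ : IsOpen Ω) (h : IsWeakGradient Ω v G) (h' : IsWeakGradient Ω v H) :
    G =ᵐ[volume.restrict Ω] H := by
  have h0 : ∀ᵐ x, x ∈ Ω → (G - H) x = 0 := by
    refine hΩ.ae_eq_zero_of_integral_contDiff_smul_eq_zero (h.2.1.sub h'.2.1) ?_
    intro φ h1 h2 h3
    have hφ : IsTestFunction Ω φ := ⟨h1, h2, h3⟩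
    have e1 := h.2.2 φ hφ
    have e2 := h'.2.2 φ hφ
    rw [e1, neg_inj, hφ.setIntegral_smul, hφ.setIntegral_smul] at e2
    simp only [Pi.sub_apply, smul_sub]
    rw [integral_sub (hφ.integrable_smul h.2.1) (hφ.integrable_smul h'.2.1), e2, sub_self]
  filter_upwards [ae_restrict_of_ae h0, ae_restrict_mem hΩ.measurableSet] with x hx hm
  exact sub_eq_zero.1 (hx hm)

theorem mono {S : Set (Eucl d)} (h : IsWeakGradient Ω v G) (hS : S ⊆ Ω) :
    IsWeakGradient S v G := by
  refine ⟨h.1.mono_set hS, h.2.1.mono_set hS, fun φ hφ => ?_⟩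
  have := h.2.2 φ (hφ.mono hS)
  rwa [(hφ.mono hS).setIntegral_smul, (hφ.mono hS).setIntegral_smul_gradient,
    ← hφ.setIntegral_smul, ← hφ.setIntegral_smul_gradient] at this

theorem add (h : IsWeakGradient Ω v G) (h' : IsWeakGradient Ω w H) :
    IsWeakGradient Ω (v + w) (G + H) := by
  refine ⟨h.1.add h'.1, h.2.1.add h'.2.1, fun φ hφ => ?_⟩
  simp only [Pi.add_apply, add_smul, smul_add]
  rw [integral_add (hφ.integrable_smul_gradient h.1).integrableOn
    (hφ.integrable_smul_gradient h'.1).integrableOn,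
    integral_add (hφ.integrable_smul h.2.1).integrableOn
    (hφ.integrable_smul h'.2.1).integrableOn, h.2.2 φ hφ, h'.2.2 φ hφ, neg_add]

theorem const_smul (h : IsWeakGradient Ω v G) (c : ℝ) : IsWeakGradient Ω (c • v) (c • G) := by
  refine ⟨h.1.smul c, h.2.1.smul c, fun φ hφ => ?_⟩
  have e1 : ∀ x, (c • v) x • ∇ φ x = c • (v x • ∇ φ x) := fun x => by
    simp [smul_smul]
  have e2 : ∀ x, φ x • (c • G) x = c • (φ x • G x) := fun x => by
    simp only [Pi.smul_apply]; rw [smul_comm]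
  simp only [e1, e2, integral_smul]
  rw [h.2.2 φ hφ, smul_neg]

theorem neg (h : IsWeakGradient Ω v G) : IsWeakGradient Ω (-v) (-G) := by
  simpa using h.const_smul (-1)

theorem sub (h : IsWeakGradient Ω v G) (h' : IsWeakGradient Ω w H) :
    IsWeakGradient Ω (v - w) (G - H) := by
  simpa [sub_eq_add_neg] using h.add h'.neg

end IsWeakGradient

/-- Pairing with a fixed vector `e` reduces this to scalar integration by parts; compact support of
`φ` alone removes boundary terms, so `v` may grow at infinity. -/
theorem integral_smul_gradient_eq_neg {v φ : Eucl d → ℝ} (hv : ContDiff ℝ 1 v)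
    (hφ : ContDiff ℝ ∞ φ) (hc : HasCompactSupport φ) :
    ∫ x, v x • ∇ φ x = -∫ x, φ x • ∇ v x := by
  have hφg := hφ.continuous_gradient (by simp)
  have hvg := hv.continuous_gradient (by simp)
  have i1 : Integrable fun x => v x • ∇ φ x :=
    (hv.continuous.smul hφg).integrable_of_hasCompactSupport (hc.gradient.smul_left)
  have i2 : Integrable fun x => φ x • ∇ v x :=
    (hφ.continuous.smul hvg).integrable_of_hasCompactSupport (hc.smul_right)
  refine ext_inner_right ℝ fun e => ?_
  rw [inner_neg_left, real_inner_comm, real_inner_comm _ (∫ x, φ x • ∇ v x), ← integral_inner i1,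
    ← integral_inner i2]
  simp only [inner_smul_right, inner_gradient_right, conj_trivial]
  have hφ1 := hφ.continuous_fderiv (by simp)
  have hv1 := hv.continuous_fderiv (by simp)
  rw [integral_mul_fderiv_eq_neg_fderiv_mul_of_integrable (μ := volume)]
  · simp only [mul_comm]
  · exact ((hv1.clm_apply continuous_const).mul hφ.continuous).integrable_of_hasCompactSupport
      hc.mul_left
  · exact (hv.continuous.mul (hφ1.clm_apply continuous_const)).integrable_of_hasCompactSupport
      ((hc.fderiv_apply ℝ e).mul_left)
  · exact (hv.continuous.mul hφ.continuous).integrable_of_hasCompactSupport hc.mul_left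
  · exact fun x _ => hv.differentiable (by simp) x
  · exact fun x _ => hφ.differentiable (by simp) x

theorem ContDiff.isWeakGradient {v : Eucl d → ℝ} (hv : ContDiff ℝ 1 v) :
    IsWeakGradient Ω v (∇ v) := by
  refine ⟨hv.continuous.locallyIntegrable.locallyIntegrableOn _,
    (hv.continuous_gradient (by simp)).locallyIntegrable.locallyIntegrableOn _, fun φ hφ => ?_⟩
  rw [hφ.setIntegral_smul, hφ.setIntegral_smul_gradient]
  exact integral_smul_gradient_eq_neg hv hφ.1 hφ.2.1

theorem isWeakGradient_const (c : ℝ) : IsWeakGradient Ω (fun _ => c) 0 := by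
  have h := ContDiff.isWeakGradient (Ω := Ω) (contDiff_const (c := c) (E := Eucl d) (𝕜 := ℝ) (n := 1))
  rwa [gradient_fun_const'] at h

theorem isWeakGradient_weakGrad {v : Eucl d → ℝ} (h : ∃ G, IsWeakGradient Ω v G) :
    IsWeakGradient Ω v (weakGrad Ω v) := by
  rw [weakGrad, dif_pos h]
  exact h.choose_spec

theorem IsWeakGradient.weakGrad_ae_eq {v : Eucl d → ℝ} {G : Eucl d → Eucl d} (hΩ : IsOpen Ω)
    (h : IsWeakGradient Ω v G) : weakGrad Ω v =ᵐ[volume.restrict Ω] G :=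
  (isWeakGradient_weakGrad ⟨G, h⟩).unique hΩ h

namespace MemH1

variable {v w : Eucl d → ℝ}

theorem isWeakGradient (h : MemH1 Ω v) : IsWeakGradient Ω v (weakGrad Ω v) :=
  isWeakGradient_weakGrad (h.2.imp fun _ h' => h'.1)

theorem memLp_weakGrad (hΩ : IsOpen Ω) (h : MemH1 Ω v) :
    MemLp (weakGrad Ω v) 2 (volume.restrict Ω) := by
  obtain ⟨_, G, hG, hG2⟩ := h
  exact (memLp_congr_ae (hG.weakGrad_ae_eq hΩ)).2 hG2

end MemH1

end WeakGradient

/-! ### Translates of weakly differentiable functions -/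

section Translation

variable {d : ℕ}

/-- The shear `(t, x) ↦ (t, x + t h)` preserves the product measure, because each slice is a
translation. -/
theorem integrable_comp_add_smul {g : Eucl d → ℝ} (hg : Integrable g) (h : Eucl d) :
    Integrable (fun p : Eucl d × ℝ => g (p.1 + p.2 • h))
      (volume.prod (volume.restrict (Ioc (0 : ℝ) 1))) := by
  have hp : MeasurePreserving (fun p : ℝ × Eucl d => (p.1, p.2 + p.1 • h))
      ((volume.restrict (Ioc (0 : ℝ) 1)).prod volume)
      ((volume.restrict (Ioc (0 : ℝ) 1)).prod volume) := by
    refine (MeasurePreserving.id _).skew_product (g := fun t x => x + t • h) ?_ ?_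
    · unfold Function.uncurry; fun_prop
    · exact ae_of_all _ fun t => (measurePreserving_add_right volume (t • h)).map_eq
  have h1 : Integrable (fun p : ℝ × Eucl d => g p.2)
      ((volume.restrict (Ioc (0 : ℝ) 1)).prod volume) := hg.comp_snd _
  exact (hp.integrable_comp_of_integrable h1).swap

/-- The fundamental theorem of calculus along `h`, in weak form. Fubini and a translation move the
shift by `t h` from `g` to `φ`; `H`, the weak derivative tested against the translates of `φ`, then
moves the derivative there as well, and the classical theorem for `t ↦ -φ (x - t h)` finishes. -/
theorem integral_mul_translate_sub_eq_zero {v g φ : Eucl d → ℝ} {h : Eucl d} (hv : Integrable v)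
    (hg : Integrable g) (hφ : ContDiff ℝ 1 φ) (hc : HasCompactSupport φ)
    (H : ∀ t ∈ Ioc (0 : ℝ) 1, ∫ x, v x * fderiv ℝ φ (x - t • h) h = -∫ x, φ (x - t • h) * g x) :
    ∫ x, φ x * (v (x + h) - v x - ∫ t in Ioc (0 : ℝ) 1, g (x + t • h)) = 0 := by
  obtain ⟨C, hC⟩ := hφ.continuous.bounded_above_of_compact_support hc
  have hφ' : Continuous (fderiv ℝ φ) := hφ.continuous_fderiv (by simp)
  obtain ⟨C', hC'⟩ := hφ'.bounded_above_of_compact_support (hc.fderiv ℝ)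
  have hG := integrable_comp_add_smul hg h
  have i1 : Integrable fun x => φ x * v (x + h) :=
    (hv.comp_add_right h).bdd_mul hφ.continuous.aestronglyMeasurable (ae_of_all _ hC)
  have i2 : Integrable fun x => φ x * v x :=
    hv.bdd_mul hφ.continuous.aestronglyMeasurable (ae_of_all _ hC)
  have i3 : Integrable fun x => φ x * ∫ t in Ioc (0 : ℝ) 1, g (x + t • h) :=
    hG.integral_prod_left.bdd_mul hφ.continuous.aestronglyMeasurable (ae_of_all _ hC)
  have i4 : Integrable (fun p : Eucl d × ℝ => φ p.1 * g (p.1 + p.2 • h))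
      (volume.prod (volume.restrict (Ioc (0 : ℝ) 1))) :=
    hG.bdd_mul (c := C) (by fun_prop) (ae_of_all _ fun p => hC p.1)
  have i5 : Integrable (fun p : Eucl d × ℝ => v p.1 * fderiv ℝ φ (p.1 - p.2 • h) h)
      (volume.prod (volume.restrict (Ioc (0 : ℝ) 1))) := by
    refine (hv.comp_fst _).mul_bdd (c := C' * ‖h‖) ?_ (ae_of_all _ fun p => ?_)
    · refine Continuous.aestronglyMeasurable ?_
      exact (hφ'.comp (by fun_prop)).clm_apply continuous_const
    · exact (ContinuousLinearMap.le_opNorm _ _).trans (by gcongr; exact hC' _)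
  have e3 : ∫ x, φ x * ∫ t in Ioc (0 : ℝ) 1, g (x + t • h) =
      -∫ x, v x * (φ x - φ (x - h)) := by
    calc ∫ x, φ x * ∫ t in Ioc (0 : ℝ) 1, g (x + t • h)
        = ∫ x, ∫ t in Ioc (0 : ℝ) 1, φ x * g (x + t • h) := by
          simp_rw [integral_const_mul]
      _ = ∫ t in Ioc (0 : ℝ) 1, ∫ x, φ x * g (x + t • h) := integral_integral_swap i4
      _ = ∫ t in Ioc (0 : ℝ) 1, -∫ x, v x * fderiv ℝ φ (x - t • h) h := by
          refine setIntegral_congr_fun measurableSet_Ioc fun t ht => ?_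
          rw [H t ht, neg_neg,
            ← integral_add_right_eq_self (fun x => φ (x - t • h) * g x) (t • h)]
          simp
      _ = -∫ x, ∫ t in Ioc (0 : ℝ) 1, v x * fderiv ℝ φ (x - t • h) h := by
          rw [integral_neg, ← integral_integral_swap i5]
      _ = -∫ x, v x * (φ x - φ (x - h)) := by
          congr 2 with x
          rw [integral_const_mul, ← intervalIntegral.integral_of_le zero_le_one]
          congr 1
          have hd : ∀ t ∈ uIcc (0 : ℝ) 1, HasDerivAt (fun t : ℝ => -φ (x - t • h))
              (fderiv ℝ φ (x - t • h) h) t := by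
            intro t _
            have h1 : HasDerivAt (fun t : ℝ => x - t • h) (-h) t := by
              simpa using ((hasDerivAt_id t).smul_const h).const_sub x
            have h2 := ((hφ.differentiable (by simp)) (x - t • h)).hasFDerivAt.comp_hasDerivAt t h1
            exact h2.neg.congr_deriv (by simp)
          rw [intervalIntegral.integral_eq_sub_of_hasDerivAt hd]
          · simp; ring
          · exact ((hφ'.comp (by fun_prop)).clm_apply continuous_const).intervalIntegrable _ _
  have i6 : Integrable fun x => v x * φ x := by simpa only [mul_comm] using i2
  have i7 : Integrable fun x => v x * φ (x - h) := by
    have := i1.comp_sub_right h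
    simpa only [sub_add_cancel, mul_comm] using this
  simp only [mul_sub] at e3 ⊢
  have i12 : Integrable fun x => φ x * v (x + h) - φ x * v x := i1.sub i2
  rw [integral_sub i12 i3, integral_sub i1 i2, e3, integral_sub i6 i7,
    ← integral_add_right_eq_self (fun x => v x * φ (x - h)) h]
  simp only [add_sub_cancel_right, mul_comm (φ _)]
  ring

/-- Compactness of `[0, 1]`, as in the tube lemma. -/
theorem isOpen_setOf_forall_add_smul_mem {S : Set (Eucl d)} (hS : IsOpen S) :
    IsOpen {p : Eucl d × Eucl d | ∀ t ∈ Icc (0 : ℝ) 1, p.1 + t • p.2 ∈ S} := by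
  rw [isOpen_iff_eventually]
  intro p hp
  refine isCompact_Icc.eventually_forall_of_forall_eventually fun t ht => ?_
  have hc : Continuous fun z : (Eucl d × Eucl d) × ℝ => z.1.1 + z.2 • z.1.2 := by fun_prop
  exact hc.continuousAt.eventually (hS.mem_nhds (hp t ht))

/-- Tested against functions supported in the open set `T` of admissible starting points, this is
the preceding weak identity; the fundamental lemma of the calculus of variations makes it pointwise
almost everywhere. -/
theorem IsWeakGradient.translate_sub_ae_eq {S : Set (Eucl d)} (hS : IsOpen S) {v : Eucl d → ℝ}
    {G : Eucl d → Eucl d} (hG : IsWeakGradient S v G) (h : Eucl d) :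
    ∀ᵐ x, (∀ t ∈ Icc (0 : ℝ) 1, x + t • h ∈ S) →
      v (x + h) - v x - ∫ t in Ioc (0 : ℝ) 1, ⟪G (x + t • h), h⟫_ℝ = 0 := by
  set T : Set (Eucl d) := {x | ∀ t ∈ Icc (0 : ℝ) 1, x + t • h ∈ S} with hTdef
  have hT : IsOpen T :=
    (isOpen_setOf_forall_add_smul_mem hS).preimage (Continuous.prodMk_left h)
  -- `v` and `G` are only locally integrable in `S`. Cutting them off outside the compact set swept
  -- out by the segments that start in `K` gives globally integrable functions with the same values
  -- on these segments.
  have key : ∀ K ⊆ T, IsCompact K → ∃ v₁ g₁ : Eucl d → ℝ, Integrable v₁ ∧ Integrable g₁ ∧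
      (∀ x ∈ K, ∀ t ∈ Icc (0 : ℝ) 1, v₁ (x + t • h) = v (x + t • h) ∧
        g₁ (x + t • h) = ⟪G (x + t • h), h⟫_ℝ) := by
    intro K hK hKc
    set K' := (fun p : Eucl d × ℝ => p.1 + p.2 • h) '' (K ×ˢ Icc (0 : ℝ) 1) with hK'
    have hK'c : IsCompact K' := (hKc.prod isCompact_Icc).image (by fun_prop)
    have hK'S : K' ⊆ S := by
      rintro _ ⟨p, hp, rfl⟩
      exact hK hp.1 p.2 hp.2
    refine ⟨K'.indicator v, K'.indicator fun x => ⟪G x, h⟫_ℝ, ?_, ?_, fun x hx t ht => ?_⟩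
    · exact (integrable_indicator_iff hK'c.measurableSet).2
        (hG.1.integrableOn_compact_subset hK'S hK'c)
    · refine (integrable_indicator_iff hK'c.measurableSet).2 ?_
      exact (hG.2.1.integrableOn_compact_subset hK'S hK'c).inner_const h
    · have : x + t • h ∈ K' := ⟨(x, t), ⟨hx, ht⟩, rfl⟩
      simp [this]
  refine hT.ae_eq_zero_of_integral_contDiff_smul_eq_zero ?_ ?_
  · rw [locallyIntegrableOn_iff hT.isLocallyClosed]
    intro K hK hKc
    obtain ⟨v₁, g₁, hv₁, hg₁, he⟩ := key K hK hKc
    have hi : Integrable fun x => v₁ (x + h) - v₁ x - ∫ t in Ioc (0 : ℝ) 1, g₁ (x + t • h) :=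
      ((hv₁.comp_add_right h).sub hv₁).sub (integrable_comp_add_smul hg₁ h).integral_prod_left
    refine hi.integrableOn.congr_fun (fun x hx => ?_) hKc.measurableSet
    have e1 := (he x hx 1 (by simp)).1
    have e0 := (he x hx 0 (by simp)).1
    simp only [one_smul, zero_smul, add_zero] at e1 e0
    simp only [e1, e0]
    congr 1
    exact setIntegral_congr_fun measurableSet_Ioc fun t ht => (he x hx t ⟨ht.1.le, ht.2⟩).2
  · intro φ h1 h2 h3
    obtain ⟨v₁, g₁, hv₁, hg₁, he⟩ := key _ h3 h2
    have := integral_mul_translate_sub_eq_zero (h := h) hv₁ hg₁ (h1.of_le (by simp)) h2 ?_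
    · refine Eq.trans ?_ this
      congr 1 with x
      by_cases hx : x ∈ tsupport φ
      · rw [smul_eq_mul]
        congr 1
        have e1 := (he x hx 1 (by simp)).1
        have e0 := (he x hx 0 (by simp)).1
        simp only [one_smul, zero_smul, add_zero] at e1 e0
        simp only [e1, e0]
        congr 1
        exact (setIntegral_congr_fun measurableSet_Ioc fun t ht =>
          (he x hx t ⟨ht.1.le, ht.2⟩).2).symm
      · simp [image_eq_zero_of_notMem_tsupport hx]
    · intro t ht
      have ht' : t ∈ Icc (0 : ℝ) 1 := ⟨ht.1.le, ht.2⟩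
      -- A translate of `φ` by `t h` is still a test function in `S`, because the segments starting
      -- in `tsupport φ ⊆ T` stay in `S`.
      set ψ : Eucl d → ℝ := fun x => φ (x - t • h) with hψ
      have hψs : ∀ x, x - t • h ∉ tsupport φ → ψ x = 0 := fun x hx =>
        image_eq_zero_of_notMem_tsupport (f := φ) hx
      have hts : tsupport ψ ⊆ (fun x => x - t • h) ⁻¹' tsupport φ := by
        refine closure_minimal (fun x hx => ?_) ((isClosed_tsupport φ).preimage (by fun_prop))
        by_contra hx'
        exact hx (hψs x hx')
      have hψT : IsTestFunction S ψ := by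
        refine ⟨h1.comp (contDiff_id.sub contDiff_const), ?_, fun x hx => ?_⟩
        · exact h2.comp_homeomorph (Homeomorph.subRight (t • h))
        · have := h3 (hts hx) t ht'
          simpa using this
      have hgr : ∀ x, ⟪∇ ψ x, h⟫_ℝ = fderiv ℝ φ (x - t • h) h := by
        intro x
        rw [inner_gradient_left, hψ, fderiv_comp_sub]
      have e := congrArg (fun z => ⟪z, h⟫_ℝ) (hG.2.2 ψ hψT)
      simp only [hψT.setIntegral_smul, hψT.setIntegral_smul_gradient, inner_neg_left] at e
      rw [real_inner_comm, real_inner_comm _ (∫ x, ψ x • G x),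
        ← integral_inner (hψT.integrable_smul_gradient hG.1),
        ← integral_inner (hψT.integrable_smul hG.2.1)] at e
      have ev : ∀ x, v₁ x * fderiv ℝ φ (x - t • h) h = ⟪h, v x • ∇ ψ x⟫_ℝ := by
        intro x
        rw [inner_smul_right, real_inner_comm, hgr]
        by_cases hx : x - t • h ∈ tsupport φ
        · have := (he _ hx t ht').1
          rw [sub_add_cancel] at this
          rw [this]
        · rw [image_eq_zero_of_notMem_tsupport (f := fderiv ℝ φ)
            (fun h' => hx (tsupport_fderiv_subset ℝ h'))]
          simp
      have eg : ∀ x, φ (x - t • h) * g₁ x = ⟪h, ψ x • G x⟫_ℝ := by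
        intro x
        rw [inner_smul_right, real_inner_comm]
        by_cases hx : x - t • h ∈ tsupport φ
        · have := (he _ hx t ht').2
          rw [sub_add_cancel] at this
          rw [this]
        · rw [hψs x hx, image_eq_zero_of_notMem_tsupport hx]
          simp
      simp only [ev, eg]
      exact e

end Translation

/-! ### The Poincaré inequality on domains that are star-shaped with respect to a ball -/

section Poincare

variable {d : ℕ}

theorem sq_lintegral_le_lintegral_sq {α : Type*} [MeasurableSpace α] {μ : Measure α}
    [IsProbabilityMeasure μ] {f : α → ENNReal} (hf : AEMeasurable f μ) :
    (∫⁻ a, f a ∂μ) ^ 2 ≤ ∫⁻ a, f a ^ 2 ∂μ := by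
  have h := ENNReal.lintegral_mul_le_Lp_mul_Lq μ Real.HolderConjugate.two_two hf
    (aemeasurable_const (b := (1 : ENNReal)))
  simp only [Pi.mul_apply, mul_one, ENNReal.rpow_two, one_pow, lintegral_const, measure_univ,
    ENNReal.one_rpow] at h
  calc (∫⁻ a, f a ∂μ) ^ 2 ≤ ((∫⁻ a, f a ^ 2 ∂μ) ^ (1 / 2 : ℝ)) ^ 2 := by gcongr
    _ = ∫⁻ a, f a ^ 2 ∂μ := by
      rw [← ENNReal.rpow_two, ← ENNReal.rpow_mul]; norm_num

/-- The change of variables costs the factor `t⁻ᵈ`, and `t ≥ 1/2` bounds it by `2ᵈ`. -/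
theorem lintegral_comp_add_smul_le (g : Eucl d → ENNReal) (hg : Measurable g) (c : Eucl d) {t : ℝ}
    (ht : 1 / 2 ≤ t) : ∫⁻ z, g (c + t • z) ≤ 2 ^ d * ∫⁻ z, g z := by
  have ht0 : t ≠ 0 := by linarith
  have h1 : ∫⁻ z, g (c + t • z) = ∫⁻ z, g (c + z) ∂(Measure.map (t • ·) volume) := by
    rw [lintegral_map (by fun_prop) (by fun_prop)]
  rw [h1, Measure.map_addHaar_smul _ ht0, lintegral_smul_measure, lintegral_add_left_eq_self,
    smul_eq_mul]
  gcongr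
  rw [finrank_euclideanSpace_fin, abs_of_nonneg (by positivity), ENNReal.ofReal_le_iff_le_toReal
    (by simp)]
  simp only [ENNReal.toReal_pow, ENNReal.toReal_ofNat, ← inv_pow]
  gcongr
  rw [inv_le_comm₀ (by linarith) (by norm_num)]
  linarith

/-- The translation identity holds for almost every base point, for each `h`. Fubini turns this into
almost every pair (the measurability assumptions make the exceptional set measurable), and `(z, b) ↦
(z - b, b)` preserves measure. -/
theorem IsWeakGradient.ae_enorm_sub_le {S : Set (Eucl d)} (hS : IsOpen S) {v : Eucl d → ℝ}
    {G : Eucl d → Eucl d} (hG : IsWeakGradient S v G) (hvm : Measurable v) (hGm : Measurable G) :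
    ∀ᵐ p : Eucl d × Eucl d ∂(volume.prod volume), (∀ t ∈ Icc (0 : ℝ) 1, p.2 + t • (p.1 - p.2) ∈ S) →
      ‖v p.1 - v p.2‖ₑ ≤ ‖p.1 - p.2‖ₑ * ∫⁻ t in Ioc (0 : ℝ) 1, ‖G (p.2 + t • (p.1 - p.2))‖ₑ := by
  have h1 : ∀ᵐ q : Eucl d × Eucl d ∂(volume.prod volume), (∀ t ∈ Icc (0 : ℝ) 1, q.2 + t • q.1 ∈ S) →
      ‖v (q.2 + q.1) - v q.2‖ₑ ≤ ‖q.1‖ₑ * ∫⁻ t in Ioc (0 : ℝ) 1, ‖G (q.2 + t • q.1)‖ₑ := by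
    refine (Measure.ae_prod_iff_ae_ae ?_).2 (ae_of_all _ fun h => ?_)
    · have hm1 : MeasurableSet {q : Eucl d × Eucl d | ∀ t ∈ Icc (0 : ℝ) 1, q.2 + t • q.1 ∈ S} :=
        ((isOpen_setOf_forall_add_smul_mem hS).preimage continuous_swap).measurableSet
      have hm2 : Measurable fun q : Eucl d × Eucl d =>
          ∫⁻ t in Ioc (0 : ℝ) 1, ‖G (q.2 + t • q.1)‖ₑ := by
        refine Measurable.lintegral_prod_right'
          (f := fun q : (Eucl d × Eucl d) × ℝ => ‖G (q.1.2 + q.2 • q.1.1)‖ₑ) ?_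
        fun_prop
      exact hm1.imp (measurableSet_le (by fun_prop) (by fun_prop))
    · filter_upwards [hG.translate_sub_ae_eq hS h] with x hx hseg
      rw [sub_eq_zero.1 (hx hseg)]
      refine (enorm_integral_le_lintegral_enorm _).trans ?_
      rw [← lintegral_const_mul' _ _ (by simp)]
      refine lintegral_mono fun t => ?_
      rw [mul_comm]
      simp only [enorm_eq_nnnorm]
      exact_mod_cast nnnorm_inner_le_nnnorm _ _
  have hmp := measurePreserving_sub_prod (volume : Measure (Eucl d)) (volume : Measure (Eucl d))
  filter_upwards [hmp.quasiMeasurePreserving.ae h1] with p hp hseg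
  simpa using hp hseg

/-- Cauchy–Schwarz in `t` bounds `|v z - v b|²` by `R²` times the integral of `|G|²` over the
segment parameter. For fixed `t` the point `(1 - t) b + t z` is then integrated over both `z` and
`b`. Since one of the weights `t`, `1 - t` is at least `1/2`, one of the two variables can be
substituted with Jacobian at most `2ᵈ`. -/
theorem IsWeakGradient.lintegral_lintegral_enorm_sub_sq_le {S B : Set (Eucl d)} (hS : IsOpen S)
    (hB : MeasurableSet B) (hBS : B ⊆ S)
    (hstar : ∀ b ∈ B, ∀ z ∈ S, ∀ t ∈ Icc (0 : ℝ) 1, b + t • (z - b) ∈ S) {R : ENNReal}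
    (hR : ∀ b ∈ B, ∀ z ∈ S, ‖z - b‖ₑ ≤ R) {v : Eucl d → ℝ} {G : Eucl d → Eucl d}
    (hG : IsWeakGradient S v G) :
    ∫⁻ b in B, ∫⁻ z in S, ‖v z - v b‖ₑ ^ 2 ≤
      R ^ 2 * (2 ^ d * (volume S + volume B)) * ∫⁻ z in S, ‖G z‖ₑ ^ 2 := by
  -- Changing `v` and `G` on null sets affects neither side.
  wlog hm : Measurable v ∧ Measurable G generalizing v G
  · have hv1 := hG.1.aestronglyMeasurable
    have hG1 := hG.2.1.aestronglyMeasurable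
    have := this (hG.congr hS hv1.ae_eq_mk hG1.ae_eq_mk)
      ⟨hv1.stronglyMeasurable_mk.measurable, hG1.stronglyMeasurable_mk.measurable⟩
    refine le_trans (le_of_eq ?_) (this.trans (le_of_eq ?_))
    · refine lintegral_congr_ae ?_
      filter_upwards [ae_restrict_of_ae_restrict_of_subset hBS hv1.ae_eq_mk] with b hb
      refine lintegral_congr_ae ?_
      filter_upwards [hv1.ae_eq_mk] with z hz
      rw [hb, hz]
    · congr 1
      refine lintegral_congr_ae ?_
      filter_upwards [hG1.ae_eq_mk] with z hz
      rw [hz]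
  obtain ⟨hvm, hGm⟩ := hm
  have hSm := hS.measurableSet
  set g : Eucl d → ENNReal := S.indicator fun x => ‖G x‖ₑ ^ 2 with hg
  have hgm : Measurable g := (by fun_prop : Measurable fun x => ‖G x‖ₑ ^ 2).indicator hSm
  have hgi : ∫⁻ z, g z = ∫⁻ z in S, ‖G z‖ₑ ^ 2 := lintegral_indicator hSm _
  set I := ∫⁻ z in S, ‖G z‖ₑ ^ 2 with hI
  have : IsProbabilityMeasure (volume.restrict (Ioc (0 : ℝ) 1)) := ⟨by simp⟩
  have hcomb : ∀ b z : Eucl d, ∀ t : ℝ, b + t • (z - b) = (1 - t) • b + t • z := by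
    intro b z t; module
  calc ∫⁻ b in B, ∫⁻ z in S, ‖v z - v b‖ₑ ^ 2
      = ∫⁻ z in S, ∫⁻ b in B, ‖v z - v b‖ₑ ^ 2 := by
        refine lintegral_lintegral_swap ?_
        unfold Function.uncurry
        fun_prop
    _ = ∫⁻ p, ‖v p.1 - v p.2‖ₑ ^ 2 ∂((volume.restrict S).prod (volume.restrict B)) := by
        refine lintegral_lintegral ?_
        unfold Function.uncurry
        fun_prop
    _ ≤ ∫⁻ p, (R ^ 2 * ∫⁻ t in Ioc (0 : ℝ) 1, g (p.2 + t • (p.1 - p.2)))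
          ∂((volume.restrict S).prod (volume.restrict B)) := by
        refine lintegral_mono_ae ?_
        rw [Measure.prod_restrict]
        filter_upwards [ae_restrict_of_ae (hG.ae_enorm_sub_le hS hvm hGm),
          ae_restrict_mem (hSm.prod hB)] with p hp hm
        have hseg := hstar p.2 hm.2 p.1 hm.1
        calc ‖v p.1 - v p.2‖ₑ ^ 2
            ≤ (R * ∫⁻ t in Ioc (0 : ℝ) 1, ‖G (p.2 + t • (p.1 - p.2))‖ₑ) ^ 2 := by
              gcongr
              refine (hp hseg).trans ?_
              gcongr
              exact hR _ hm.2 _ hm.1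
          _ ≤ R ^ 2 * ∫⁻ t in Ioc (0 : ℝ) 1, ‖G (p.2 + t • (p.1 - p.2))‖ₑ ^ 2 := by
              rw [mul_pow]
              gcongr
              exact sq_lintegral_le_lintegral_sq (by fun_prop)
          _ = _ := by
              congr 1
              refine setLIntegral_congr_fun measurableSet_Ioc fun t ht => ?_
              simp only [hg]
              rw [indicator_of_mem (hseg t ⟨ht.1.le, ht.2⟩)]
    _ = R ^ 2 * ∫⁻ t in Ioc (0 : ℝ) 1, ∫⁻ p, g (p.2 + t • (p.1 - p.2))
          ∂((volume.restrict S).prod (volume.restrict B)) := by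
        rw [lintegral_const_mul, lintegral_lintegral_swap]
        · exact Measurable.aemeasurable (by unfold Function.uncurry; fun_prop)
        · refine Measurable.lintegral_prod_right'
            (f := fun q : (Eucl d × Eucl d) × ℝ => g (q.1.2 + q.2 • (q.1.1 - q.1.2))) ?_
          fun_prop
    _ ≤ R ^ 2 * ∫⁻ t in Ioc (0 : ℝ) 1, 2 ^ d * (volume S + volume B) * I := by
        gcongr with t
        simp only [hcomb]
        -- Substitute in `z` when `t ≥ 1/2`, and in `b` otherwise; the remaining variable
        -- contributes only the volume of its set.
        rcases le_total (1 / 2) t with ht | ht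
        · rw [lintegral_prod_symm _ (by fun_prop)]
          calc ∫⁻ b in B, ∫⁻ z in S, g ((1 - t) • b + t • z)
              ≤ ∫⁻ b in B, 2 ^ d * ∫⁻ z, g z := by
                refine lintegral_mono fun b => ?_
                exact (setLIntegral_le_lintegral _ _).trans
                  (lintegral_comp_add_smul_le g hgm _ ht)
            _ = 2 ^ d * volume B * I := by
                rw [setLIntegral_const, hgi]; ring
            _ ≤ _ := by gcongr; exact le_add_self
        · rw [lintegral_prod _ (by fun_prop)]
          calc ∫⁻ z in S, ∫⁻ b in B, g ((1 - t) • b + t • z)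
              ≤ ∫⁻ z in S, 2 ^ d * ∫⁻ z, g z := by
                refine lintegral_mono fun z => ?_
                refine (setLIntegral_le_lintegral _ _).trans ?_
                simp only [add_comm _ (t • z)]
                exact lintegral_comp_add_smul_le g hgm _ (by linarith)
            _ = 2 ^ d * volume S * I := by
                rw [setLIntegral_const, hgi]; ring
            _ ≤ _ := by gcongr; exact le_self_add
    _ = R ^ 2 * (2 ^ d * (volume S + volume B)) * I := by
        rw [lintegral_const, measure_univ, mul_one]; ring

/-- The Poincaré inequality holds on `U` for weakly differentiable functions on `Ω`. -/
def HasPoincareOn (Ω U : Set (Eucl d)) : Prop :=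
  ∃ C : ENNReal, C ≠ ⊤ ∧ ∀ v G, IsWeakGradient Ω v G →
    ∃ c : ℝ, ∫⁻ z in U, ‖v z - c‖ₑ ^ 2 ≤ C * ∫⁻ z in Ω, ‖G z‖ₑ ^ 2

/-- The constant is `v b` for a point `b ∈ B` at which `∫ |v z - v b|² dz` does not exceed its
average over `B`. No mean value of `v` is used, so `v` need not be known to be integrable on `S`. -/
theorem hasPoincareOn_of_starShaped {Ω S B : Set (Eucl d)} (hSΩ : S ⊆ Ω) (hS : IsOpen S)
    (hSb : Bornology.IsBounded S) (hB : IsOpen B) (hBn : B.Nonempty) (hBS : B ⊆ S)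
    (hstar : ∀ b ∈ B, ∀ z ∈ S, ∀ t ∈ Icc (0 : ℝ) 1, b + t • (z - b) ∈ S) :
    HasPoincareOn Ω S := by
  obtain ⟨R, hR⟩ := hSb.exists_norm_le
  have hB0 : volume B ≠ 0 := (hB.measure_pos volume hBn).ne'
  have hBt : volume B ≠ ⊤ := (hSb.subset hBS).measure_lt_top.ne
  have hR' : ∀ b ∈ B, ∀ z ∈ S, ‖z - b‖ₑ ≤ ENNReal.ofReal (R + R) := by
    intro b hb z hz
    rw [← ofReal_norm]
    exact ENNReal.ofReal_le_ofReal
      ((norm_sub_le _ _).trans (add_le_add (hR z hz) (hR b (hBS hb))))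
  refine ⟨(volume B)⁻¹ * (ENNReal.ofReal (R + R) ^ 2 * (2 ^ d * (volume S + volume B))),
    ?_, fun v G hG => ?_⟩
  · have := hSb.measure_lt_top (μ := volume)
    finiteness
  · have hG' := hG.mono hSΩ
    have h := hG'.lintegral_lintegral_enorm_sub_sq_le hS hB.measurableSet hBS hstar hR'
    have hm : AEMeasurable (fun b => ∫⁻ z in S, ‖v z - v b‖ₑ ^ 2) (volume.restrict B) := by
      have hv1 := hG'.1.aestronglyMeasurable
      have hv2 := hv1.mono_set hBS
      refine AEMeasurable.lintegral_prod_right'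
        (f := fun p : Eucl d × Eucl d => ‖v p.2 - v p.1‖ₑ ^ 2) ?_
      exact ((hv1.comp_snd.sub hv2.comp_fst).enorm).pow_const 2
    obtain ⟨b, hb, hle⟩ := exists_le_setLAverage hB0 hBt hm
    refine ⟨v b, hle.trans ?_⟩
    rw [setLAverage_eq, ENNReal.div_eq_inv_mul, mul_assoc]
    gcongr
    exact h.trans (by gcongr)

end Poincare

/-! ### The Poincaré inequality on bounded Lipschitz domains -/

section PoincareLipschitz

variable {d : ℕ} {Ω : Set (Eucl d)}

theorem enorm_sub_sq_le (a b : ℝ) : ‖a - b‖ₑ ^ 2 ≤ 4 * (‖a‖ₑ ^ 2 + ‖b‖ₑ ^ 2) := by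
  have key : ∀ x y : ENNReal, x ≤ y → (x + y) ^ 2 ≤ 4 * (x ^ 2 + y ^ 2) := by
    intro x y h
    calc (x + y) ^ 2 ≤ (y + y) ^ 2 := by gcongr
      _ = 4 * y ^ 2 := by ring
      _ ≤ 4 * (x ^ 2 + y ^ 2) := by gcongr; exact le_add_self
  have h1 : ‖a - b‖ₑ ^ 2 ≤ (‖a‖ₑ + ‖b‖ₑ) ^ 2 := by
    gcongr
    exact enorm_sub_le
  refine h1.trans ?_
  rcases le_total ‖a‖ₑ ‖b‖ₑ with h | h
  · exact key _ _ h
  · rw [add_comm, add_comm (‖a‖ₑ ^ 2)]; exact key _ _ h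

/-- On the overlap both `c₁` and `c₂` approximate `v`, so `|c₂ - c₁|²` is controlled because the
overlap has positive measure. Hence `c₁` also serves on `V`. -/
theorem HasPoincareOn.union {U V : Set (Eucl d)} (hUΩ : U ⊆ Ω)
    (hV : volume V ≠ ⊤) (hUV : volume (U ∩ V) ≠ 0)
    (h1 : HasPoincareOn Ω U) (h2 : HasPoincareOn Ω V) : HasPoincareOn Ω (U ∪ V) := by
  obtain ⟨C₁, hC₁, h1⟩ := h1
  obtain ⟨C₂, hC₂, h2⟩ := h2
  have hUVt : volume (U ∩ V) ≠ ⊤ := measure_ne_top_of_subset inter_subset_right hV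
  refine ⟨C₁ + 4 * (C₂ + (volume (U ∩ V))⁻¹ * (4 * (C₁ + C₂)) * volume V), by finiteness,
    fun v G hG => ?_⟩
  obtain ⟨c₁, hc₁⟩ := h1 v G hG
  obtain ⟨c₂, hc₂⟩ := h2 v G hG
  set I := ∫⁻ z in Ω, ‖G z‖ₑ ^ 2
  have hvm : AEStronglyMeasurable v (volume.restrict U) := (hG.1.mono_set hUΩ).aestronglyMeasurable
  have hc : ‖c₂ - c₁‖ₑ ^ 2 ≤ (volume (U ∩ V))⁻¹ * (4 * (C₁ + C₂)) * I := by
    have hle : ‖c₂ - c₁‖ₑ ^ 2 * volume (U ∩ V) ≤ 4 * (C₁ + C₂) * I := by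
      rw [← setLIntegral_const]
      calc ∫⁻ _ in U ∩ V, ‖c₂ - c₁‖ₑ ^ 2
          ≤ ∫⁻ z in U ∩ V, 4 * (‖v z - c₁‖ₑ ^ 2 + ‖v z - c₂‖ₑ ^ 2) := by
            refine lintegral_mono fun z => ?_
            have := enorm_sub_sq_le (v z - c₁) (v z - c₂)
            rwa [sub_sub_sub_cancel_left] at this
        _ = 4 * ((∫⁻ z in U ∩ V, ‖v z - c₁‖ₑ ^ 2) + ∫⁻ z in U ∩ V, ‖v z - c₂‖ₑ ^ 2) := by
            rw [lintegral_const_mul' _ _ (by simp), lintegral_add_left']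
            exact ((hvm.mono_set inter_subset_left).sub aestronglyMeasurable_const).enorm.pow_const 2
        _ ≤ 4 * (C₁ * I + C₂ * I) := by
            gcongr
            · exact (lintegral_mono_set inter_subset_left).trans hc₁
            · exact (lintegral_mono_set inter_subset_right).trans hc₂
        _ = _ := by ring
    rw [mul_assoc, ← ENNReal.div_eq_inv_mul, ENNReal.le_div_iff_mul_le (.inl hUV) (.inl hUVt)]
    exact hle
  refine ⟨c₁, (lintegral_union_le _ _ _).trans ?_⟩
  calc (∫⁻ z in U, ‖v z - c₁‖ₑ ^ 2) + ∫⁻ z in V, ‖v z - c₁‖ₑ ^ 2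
      ≤ C₁ * I + ∫⁻ z in V, 4 * (‖v z - c₂‖ₑ ^ 2 + ‖c₂ - c₁‖ₑ ^ 2) := by
        gcongr with z
        have := enorm_sub_sq_le (v z - c₂) (c₁ - c₂)
        rwa [sub_sub_sub_cancel_right, ← neg_sub c₂ c₁, enorm_neg] at this
    _ = C₁ * I + 4 * ((∫⁻ z in V, ‖v z - c₂‖ₑ ^ 2) + ‖c₂ - c₁‖ₑ ^ 2 * volume V) := by
        rw [lintegral_const_mul' _ _ (by simp), lintegral_add_right _ measurable_const,
          setLIntegral_const]
    _ ≤ C₁ * I + 4 * (C₂ * I + (volume (U ∩ V))⁻¹ * (4 * (C₁ + C₂)) * I * volume V) := by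
        gcongr
    _ = _ := by ring

/-- Take a maximal family of pieces whose union is nonempty and satisfies the inequality. If the
remaining pieces cover anything, connectedness forces one of them to meet this union in a nonempty
open set, and gluing it on contradicts maximality. -/
theorem hasPoincareOn_of_finite_cover {ι : Type*} [Finite ι] (hΩ : IsConnected Ω)
    (hv : volume Ω ≠ ⊤) {S : ι → Set (Eucl d)} (hS : ∀ i, IsOpen (S i)) (hU : ⋃ i, S i = Ω)
    (hP : ∀ i, HasPoincareOn Ω (S i)) : HasPoincareOn Ω Ω := by
  classical
  set F : Set (Set ι) := {I | (⋃ i ∈ I, S i).Nonempty ∧ HasPoincareOn Ω (⋃ i ∈ I, S i)} with hF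
  have hFn : F.Nonempty := by
    obtain ⟨x, hx⟩ := hΩ.nonempty
    rw [← hU] at hx
    obtain ⟨i, hi⟩ := mem_iUnion.1 hx
    exact ⟨{i}, by simpa using ⟨x, hi⟩, by simpa using hP i⟩
  obtain ⟨I, hI⟩ := (Set.toFinite F).exists_maximal hFn
  have hsub : ∀ i, S i ⊆ Ω := fun i => hU ▸ subset_iUnion S i
  set U := ⋃ i ∈ I, S i with hUdef
  set V := ⋃ i ∈ Iᶜ, S i with hVdef
  have hUo : IsOpen U := isOpen_biUnion fun i _ => hS i
  have hVo : IsOpen V := isOpen_biUnion fun i _ => hS i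
  have hcov : Ω ⊆ U ∪ V := by
    rw [← hU]
    refine iUnion_subset fun i => ?_
    by_cases hi : i ∈ I
    · exact (subset_biUnion_of_mem (u := S) hi).trans subset_union_left
    · exact (subset_biUnion_of_mem (u := S) (show i ∈ Iᶜ from hi)).trans subset_union_right
  have hUΩ : U ⊆ Ω := iUnion₂_subset fun i _ => hsub i
  rcases (Ω ∩ V).eq_empty_or_nonempty with hE | hE
  · have : U = Ω := by
      refine hUΩ.antisymm fun x hx => (hcov hx).resolve_right fun hxV => ?_
      exact (hE ▸ (⟨hx, hxV⟩ : x ∈ Ω ∩ V) : x ∈ (∅ : Set (Eucl d)))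
    exact this ▸ hI.prop.2
  · have hUne : (Ω ∩ U).Nonempty := by
      obtain ⟨x, hx⟩ := hI.prop.1
      exact ⟨x, hUΩ hx, hx⟩
    obtain ⟨x, -, hxU, hxV⟩ := hΩ.isPreconnected U V hUo hVo hcov hUne hE
    obtain ⟨j, hj, hxj⟩ := mem_iUnion₂.1 hxV
    have hpos : volume (U ∩ S j) ≠ 0 := ((hUo.inter (hS j)).measure_pos volume ⟨x, hxU, hxj⟩).ne'
    have hPU := HasPoincareOn.union hUΩ
      (measure_ne_top_of_subset (hsub j) hv) hpos hI.prop.2 (hP j)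
    have hmem : insert j I ∈ F := by
      have e : (⋃ i ∈ insert j I, S i) = U ∪ S j := by
        rw [biUnion_insert, union_comm]
      refine ⟨?_, ?_⟩
      · rw [e]; exact ⟨x, Or.inl hxU⟩
      · rw [e]; exact hPU
    exact absurd (hI.le_of_ge hmem (subset_insert j I) (mem_insert j I)) hj

theorem le_inner_of_mem_closure_epigraph {ν x : Eucl d} {γ : Eucl d → ℝ} {r : ℝ}
    (hγ : Continuous γ)
    (h : ∀ y ∈ Metric.ball x r, (y ∈ Ω ↔ γ (y - ⟪ν, y⟫_ℝ • ν) < ⟪ν, y⟫_ℝ)) {y : Eucl d}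
    (hy : y ∈ Metric.ball x r) (hyc : y ∈ closure Ω) : γ (y - ⟪ν, y⟫_ℝ • ν) ≤ ⟪ν, y⟫_ℝ := by
  by_contra! hlt
  have h1 : ∀ᶠ z in 𝓝 y, ⟪ν, z⟫_ℝ < γ (z - ⟪ν, z⟫_ℝ • ν) :=
    (isOpen_lt (by fun_prop) (by fun_prop)).mem_nhds hlt
  have h2 := Metric.isOpen_ball.mem_nhds hy
  obtain ⟨z, ⟨hz1, hz2⟩, hz3⟩ := mem_closure_iff_nhds.1 hyc _ (h1.and h2)
  exact lt_asymm hz1 ((h z hz2).1 hz3)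

/-- At a boundary point `S` is a cylinder of radius `ρ` around the axis `ν`, cut off below by the
graph and above by a hyperplane. It is star-shaped with respect to a ball placed so high above the
graph that segments descending from it are either steeper than the Lipschitz constant allows the
graph to be, or never come down to the graph's top level in the cylinder. -/
theorem IsBoundedLipschitzDomain.exists_hasPoincareOn (hΩ : IsBoundedLipschitzDomain Ω)
    {x : Eucl d} (hx : x ∈ closure Ω) :
    ∃ W ∈ 𝓝 x, ∃ S, IsOpen S ∧ S ⊆ Ω ∧ W ∩ Ω ⊆ S ∧ HasPoincareOn Ω S := by
  by_cases hxΩ : x ∈ Ω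
  · obtain ⟨ε, hε, hb⟩ := Metric.isOpen_iff.1 hΩ.isOpen x hxΩ
    refine ⟨_, Metric.ball_mem_nhds x hε, Metric.ball x ε, Metric.isOpen_ball, hb,
      inter_subset_left, hasPoincareOn_of_starShaped hb Metric.isOpen_ball Metric.isBounded_ball
        Metric.isOpen_ball ⟨x, Metric.mem_ball_self hε⟩ subset_rfl fun b hb z hz t ht => ?_⟩
    exact (convex_ball x ε).add_smul_sub_mem hb hz ht
  obtain ⟨ν, γ, K, r, hν, hγ, hr, h⟩ := hΩ.locally_epigraph x
    ⟨hx, fun h' => hxΩ (interior_subset h')⟩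
  have hγc := hγ.continuous
  have hx0 : γ (x - ⟪ν, x⟫_ℝ • ν) = ⟪ν, x⟫_ℝ := by
    refine le_antisymm (le_inner_of_mem_closure_epigraph hγc h (Metric.mem_ball_self hr) hx) ?_
    exact not_lt.1 fun h' => hxΩ ((h x (Metric.mem_ball_self hr)).2 h')
  set P : Eucl d → Eucl d := fun y => y - ⟪ν, y⟫_ℝ • ν with hP
  have hνν : ⟪ν, ν⟫_ℝ = 1 := by rw [real_inner_self_eq_norm_sq, hν, one_pow]
  have hPlin : ∀ y z : Eucl d, ∀ t : ℝ, P (y + t • z) = P y + t • P z := by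
    intro y z t
    simp only [hP, inner_add_right, inner_smul_right]
    module
  have hPsub : ∀ y z : Eucl d, P (y - z) = P y - P z := by
    intro y z
    have := hPlin y z (-1)
    simpa [← sub_eq_add_neg] using this
  have hPle : ∀ y, ‖P y‖ ≤ ‖y‖ := by
    intro y
    refine (sq_le_sq₀ (norm_nonneg _) (norm_nonneg _)).1 ?_
    rw [hP, norm_sub_sq_real, norm_smul, hν, inner_smul_right, real_inner_comm]
    simp
    nlinarith [sq_nonneg ⟪ν, y⟫_ℝ]
  have hPν : P ν = 0 := by rw [hP]; simp only; rw [hνν, one_smul, sub_self]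
  have hdec : ∀ y, ‖y‖ ≤ ‖P y‖ + |⟪ν, y⟫_ℝ| := by
    intro y
    have : y = P y + ⟪ν, y⟫_ℝ • ν := by simp [hP]
    conv_lhs => rw [this]
    refine (norm_add_le _ _).trans ?_
    rw [norm_smul, hν, mul_one, Real.norm_eq_abs]
  have hinner : ∀ y, |⟪ν, y⟫_ℝ| ≤ ‖y‖ := fun y => by
    simpa [hν] using abs_real_inner_le_norm ν y
  have hγK : ∀ y z, γ y ≤ γ z + K * ‖y - z‖ := fun y z => by
    have := hγ.dist_le_mul y z
    rw [Real.dist_eq, dist_eq_norm] at this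
    linarith [le_abs_self (γ y - γ z)]
  have hγK' : ∀ y z, γ z - K * ‖y - z‖ ≤ γ y := fun y z => by
    have := hγK z y
    rw [norm_sub_rev] at this
    linarith
  have hK0 : (0 : ℝ) ≤ K := K.2
  -- Points of `S` are less than `ρ` away from `x` horizontally and at most `2 (3K + 1) ρ`
  -- vertically; the sum is below `(6K + 3) ρ = r`, so `S` stays in the ball where the epigraph
  -- description is valid.
  set ρ : ℝ := r / (6 * K + 3) with hρ
  have hρ0 : 0 < ρ := by positivity
  have hρr : (6 * K + 3) * ρ = r := by rw [hρ]; field_simp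
  set t₀ := ⟪ν, x⟫_ℝ with ht₀
  set S : Set (Eucl d) := {z | ‖P z - P x‖ < ρ ∧ γ (P z) < ⟪ν, z⟫_ℝ ∧
    ⟪ν, z⟫_ℝ < t₀ + 2 * (3 * K + 1) * ρ} with hS
  have hPc : Continuous P := by rw [hP]; fun_prop
  have hSo : IsOpen S := by
    have h1 : IsOpen {z | ‖P z - P x‖ < ρ} := isOpen_lt (by fun_prop) (by fun_prop)
    have h2 : IsOpen {z | γ (P z) < ⟪ν, z⟫_ℝ} := isOpen_lt (by fun_prop) (by fun_prop)
    have h3 : IsOpen {z | ⟪ν, z⟫_ℝ < t₀ + 2 * (3 * K + 1) * ρ} :=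
      isOpen_lt (by fun_prop) (by fun_prop)
    exact h1.inter (h2.inter h3)
  have hSball : S ⊆ Metric.ball x r := by
    rintro z ⟨h1, h2, h3⟩
    rw [mem_ball_iff_norm]
    refine (hdec (z - x)).trans_lt ?_
    rw [hPsub, inner_sub_right, ← ht₀]
    have hKρ : K * ‖P z - P x‖ ≤ K * ρ := by gcongr
    have h4 := hγK' (P z) (P x)
    have h5 : γ (P x) = t₀ := hx0
    have hKρ0 : 0 ≤ K * ρ := by positivity
    have h6 : |⟪ν, z⟫_ℝ - t₀| ≤ 2 * (3 * K + 1) * ρ := by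
      rw [abs_le]; constructor <;> nlinarith
    nlinarith
  have hSΩ : S ⊆ Ω := fun z hz => (h z (hSball hz)).2 hz.2.1
  -- In the ball of radius `ρ` about this centre all heights exceed `t₀ + 3Kρ`, whereas the graph
  -- stays below `t₀ + Kρ` over the cylinder. The surplus `2Kρ` is the bound for the variation of
  -- `γ` over horizontal distances up to `2ρ`.
  set b₀ := x + ((3 * K + 1) * ρ) • ν with hb₀
  have hBprop : ∀ b ∈ Metric.ball b₀ ρ, ‖P b - P x‖ < ρ ∧ t₀ + 3 * K * ρ < ⟪ν, b⟫_ℝ ∧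
      ⟪ν, b⟫_ℝ < t₀ + 2 * (3 * K + 1) * ρ := by
    intro b hb
    rw [mem_ball_iff_norm] at hb
    have hPb : P b₀ = P x := by rw [hb₀, hPlin, hPν]; simp
    have h1 := (hinner (b - b₀)).trans_lt hb
    rw [inner_sub_right, hb₀, inner_add_right, inner_smul_right, hνν, abs_lt] at h1
    have hKρ0 : 0 ≤ K * ρ := by positivity
    refine ⟨?_, by nlinarith [h1.1], by nlinarith [h1.2]⟩
    rw [← hPb, ← hPsub]
    exact (hPle _).trans_lt hb
  have hγtop : ∀ y, ‖y - P x‖ < ρ → γ y ≤ t₀ + K * ρ := by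
    intro y hy
    refine (hγK y (P x)).trans ?_
    have h5 : γ (P x) = t₀ := hx0
    rw [h5]
    gcongr
  have hBS : Metric.ball b₀ ρ ⊆ S := by
    intro b hb
    obtain ⟨h1, h2, h3⟩ := hBprop b hb
    refine ⟨h1, (hγtop _ h1).trans_lt ?_, h3⟩
    have hKρ0 : 0 ≤ K * ρ := by positivity
    nlinarith
  refine ⟨_, Metric.ball_mem_nhds x hρ0, S, hSo, hSΩ, ?_,
    hasPoincareOn_of_starShaped hSΩ hSo (Metric.isBounded_ball.subset hSball) Metric.isOpen_ball
      ⟨b₀, Metric.mem_ball_self hρ0⟩ hBS ?_⟩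
  · rintro z ⟨hz, hzΩ⟩
    rw [mem_ball_iff_norm] at hz
    have hKρ0 : 0 ≤ K * ρ := by positivity
    have hzr : z ∈ Metric.ball x r := by
      rw [mem_ball_iff_norm]; nlinarith
    refine ⟨?_, (h z hzr).1 hzΩ, ?_⟩
    · rw [← hPsub]; exact (hPle _).trans_lt hz
    · have := (hinner (z - x)).trans_lt hz
      rw [inner_sub_right, abs_lt] at this
      nlinarith [this.2]
  · intro b hb z hz t ht
    obtain ⟨hb1, hb2, hb3⟩ := hBprop b hb
    obtain ⟨hz1, hz2, hz3⟩ := hz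
    have ht1 : 0 ≤ 1 - t := by linarith [ht.2]
    have hKρ0 : 0 ≤ K * ρ := by positivity
    have hin : ⟪ν, b + t • (z - b)⟫_ℝ = ⟪ν, b⟫_ℝ + t • (⟪ν, z⟫_ℝ - ⟪ν, b⟫_ℝ) := by
      rw [inner_add_right, inner_smul_right, inner_sub_right, smul_eq_mul]
    have hPt : P (b + t • (z - b)) = P b + t • (P z - P b) := by rw [hPlin, hPsub]
    have h1 : ‖P (b + t • (z - b)) - P x‖ < ρ := by
      rw [← mem_ball_iff_norm, hPt]
      exact (convex_ball (P x) ρ).add_smul_sub_mem (mem_ball_iff_norm.2 hb1)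
        (mem_ball_iff_norm.2 hz1) ht
    refine ⟨h1, ?_, ?_⟩
    · rw [hin]
      -- If `z` lies at least `2Kρ` below `b`, the segment rises from `z` at least as fast as the
      -- graph can. Otherwise both endpoints, hence the whole segment, lie above the level `t₀ +
      -- Kρ`.
      rcases le_or_gt (⟪ν, z⟫_ℝ + 2 * K * ρ) ⟪ν, b⟫_ℝ with hc | hc
      · have h2 := hγK (P (b + t • (z - b))) (P z)
        have e : P (b + t • (z - b)) - P z = (1 - t) • ((P b - P x) - (P z - P x)) := by
          rw [hPt]; module
        have h3 : ‖P (b + t • (z - b)) - P z‖ ≤ (1 - t) * (ρ + ρ) := by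
          rw [e, norm_smul, Real.norm_of_nonneg ht1]
          gcongr
          exact (norm_sub_le _ _).trans (add_le_add hb1.le hz1.le)
        have h4 : K * ‖P (b + t • (z - b)) - P z‖ ≤ K * ((1 - t) * (ρ + ρ)) := by gcongr
        have h5 := mul_le_mul_of_nonneg_left hc ht1
        rw [smul_eq_mul]
        linarith
      · refine (hγtop _ h1).trans_lt ?_
        exact (convex_Ioi (t₀ + K * ρ)).add_smul_sub_mem (x := ⟪ν, b⟫_ℝ) (y := ⟪ν, z⟫_ℝ)
          (mem_Ioi.2 (by linarith)) (mem_Ioi.2 (by linarith)) ht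
    · rw [hin]
      exact (convex_Iio _).add_smul_sub_mem (mem_Iio.2 hb3) (mem_Iio.2 hz3) ht

theorem IsBoundedLipschitzDomain.hasPoincareOn (hΩ : IsBoundedLipschitzDomain Ω) :
    HasPoincareOn Ω Ω := by
  choose! W hW S hSo hSΩ hWS hP using fun x (hx : x ∈ closure Ω) => hΩ.exists_hasPoincareOn hx
  have hc : IsCompact (closure Ω) := hΩ.isBounded.isCompact_closure
  obtain ⟨T, hT, hcov⟩ := hc.elim_nhds_subcover W hW
  refine hasPoincareOn_of_finite_cover (ι := {i // i ∈ T}) hΩ.isConnected hΩ.isBounded.measure_lt_top.ne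
    (S := fun i : {i // i ∈ T} => S i) (fun i => hSo i (hT i i.2)) ?_ fun i => hP i (hT i i.2)
  refine (iUnion_subset fun i : {i // i ∈ T} => hSΩ i (hT i i.2)).antisymm fun x hx => ?_
  obtain ⟨i, hi, hxi⟩ := mem_iUnion₂.1 (hcov (subset_closure hx))
  exact mem_iUnion.2 ⟨⟨i, hi⟩, hWS i (hT i hi) ⟨hxi, hx⟩⟩

end PoincareLipschitz

/-! ### The closed space of gradients and the orthogonal projection -/

section Projection

variable {d : ℕ} {Ω : Set (Eucl d)}

theorem eLpNorm_two_sq {α E : Type*} [MeasurableSpace α] [NormedAddCommGroup E] (f : α → E)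
    (μ : Measure α) : eLpNorm f 2 μ ^ 2 = ∫⁻ x, ‖f x‖ₑ ^ 2 ∂μ := by
  rw [eLpNorm_eq_lintegral_rpow_enorm_toReal (by simp) (by simp), ← ENNReal.rpow_two,
    ← ENNReal.rpow_mul]
  simp

theorem memLp_two_iff {α E : Type*} [MeasurableSpace α] [NormedAddCommGroup E] {f : α → E}
    {μ : Measure α} (hf : AEStronglyMeasurable f μ) :
    MemLp f 2 μ ↔ ∫⁻ x, ‖f x‖ₑ ^ 2 ∂μ ≠ ⊤ := by
  rw [← eLpNorm_two_sq, MemLp, and_iff_right hf, lt_top_iff_ne_top, Ne, Ne, ENNReal.pow_eq_top_iff]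
  simp

/-- The inequality puts `v - c` in `L²`, and constants are in `L²` on a set of finite volume. Hence
square integrability of a potential never has to be assumed separately. -/
theorem HasPoincareOn.memLp (hP : HasPoincareOn Ω Ω) (hΩ : volume Ω ≠ ⊤) {v : Eucl d → ℝ}
    {G : Eucl d → Eucl d} (hG : IsWeakGradient Ω v G) (hG2 : MemLp G 2 (volume.restrict Ω)) :
    MemLp v 2 (volume.restrict Ω) := by
  have : IsFiniteMeasure (volume.restrict Ω) := ⟨by simpa using hΩ.lt_top⟩
  obtain ⟨C, hC, h⟩ := hP
  obtain ⟨c, hc⟩ := h v G hG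
  have h1 : MemLp (fun x => v x - c) 2 (volume.restrict Ω) := by
    refine (memLp_two_iff (hG.1.aestronglyMeasurable.sub aestronglyMeasurable_const)).2 ?_
    refine ne_top_of_le_ne_top ?_ hc
    exact ENNReal.mul_ne_top hC ((memLp_two_iff hG2.1).1 hG2)
  exact (h1.add (memLp_const c)).ae_eq (ae_of_all _ fun x => by simp)

theorem HasPoincareOn.memH1 (hP : HasPoincareOn Ω Ω) (hΩ : volume Ω ≠ ⊤) {v : Eucl d → ℝ}
    {G : Eucl d → Eucl d} (hG : IsWeakGradient Ω v G) (hG2 : MemLp G 2 (volume.restrict Ω)) :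
    MemH1 Ω v :=
  ⟨hP.memLp hΩ hG hG2, G, hG, hG2⟩

theorem HasPoincareOn.ae_eq_const (hP : HasPoincareOn Ω Ω) {v : Eucl d → ℝ}
    (hG : IsWeakGradient Ω v 0) : ∃ c : ℝ, v =ᵐ[volume.restrict Ω] fun _ => c := by
  obtain ⟨C, hC, h⟩ := hP
  obtain ⟨c, hc⟩ := h v 0 hG
  refine ⟨c, ?_⟩
  have h0 : ∫⁻ z in Ω, ‖v z - c‖ₑ ^ 2 = 0 := by simpa using hc
  have hm : AEMeasurable (fun z => ‖v z - c‖ₑ ^ 2) (volume.restrict Ω) :=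
    (hG.1.aestronglyMeasurable.sub aestronglyMeasurable_const).enorm.pow_const 2
  rw [lintegral_eq_zero_iff' hm] at h0
  filter_upwards [h0] with x hx
  exact sub_eq_zero.1 (by simpa using hx)

/-- The subspace of `L²(Ω)` of all weak gradients. -/
def gradientSpace (Ω : Set (Eucl d)) : Submodule ℝ (Lp (Eucl d) 2 (volume.restrict Ω)) where
  carrier := {g | ∃ v G, IsWeakGradient Ω v G ∧ g =ᵐ[volume.restrict Ω] G}
  add_mem' := by
    rintro f g ⟨v, F, hF, hf⟩ ⟨w, G, hG, hg⟩
    exact ⟨v + w, F + G, hF.add hG, (Lp.coeFn_add f g).trans (hf.add hg)⟩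
  zero_mem' := ⟨_, 0, isWeakGradient_const 0, Lp.coeFn_zero _ _ _⟩
  smul_mem' := by
    rintro c f ⟨v, F, hF, hf⟩
    exact ⟨c • v, c • F, hF.const_smul c, (Lp.coeFn_smul c f).trans (hf.const_smul c)⟩

/-- Pairs `(v, ∇v)` with `v` of mean value zero. -/
def meanZeroGraph (Ω : Set (Eucl d)) (one : Lp ℝ 2 (volume.restrict Ω)) (hΩ : IsOpen Ω) :
    Submodule ℝ (Lp ℝ 2 (volume.restrict Ω) × Lp (Eucl d) 2 (volume.restrict Ω)) where
  carrier := {p | IsWeakGradient Ω p.1 p.2 ∧ ⟪one, p.1⟫_ℝ = 0}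
  add_mem' := by
    rintro p q ⟨hp, hp'⟩ ⟨hq, hq'⟩
    refine ⟨(hp.add hq).congr hΩ (Lp.coeFn_add _ _).symm (Lp.coeFn_add _ _).symm, ?_⟩
    rw [Prod.fst_add, inner_add_right, hp', hq', add_zero]
  zero_mem' := by
    refine ⟨(isWeakGradient_const 0).congr hΩ (Lp.coeFn_zero _ _ _).symm
      (Lp.coeFn_zero _ _ _).symm, ?_⟩
    simp
  smul_mem' := by
    rintro c p ⟨hp, hp'⟩
    refine ⟨(hp.const_smul c).congr hΩ (Lp.coeFn_smul _ _).symm (Lp.coeFn_smul _ _).symm, ?_⟩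
    rw [Prod.smul_fst, inner_smul_right, hp', mul_zero]

/-- For a fixed test function both sides of the weak gradient identity are continuous on `L² × L²`,
so the graph is an intersection of closed conditions; local integrability is automatic in `L²`. -/
theorem isClosed_meanZeroGraph (one : Lp ℝ 2 (volume.restrict Ω)) (hΩ : IsOpen Ω) :
    IsClosed (meanZeroGraph Ω one hΩ : Set
      (Lp ℝ 2 (volume.restrict Ω) × Lp (Eucl d) 2 (volume.restrict Ω))) := by
  have e : (meanZeroGraph Ω one hΩ : Set (Lp ℝ 2 (volume.restrict Ω) × Lp (Eucl d) 2 (volume.restrict Ω))) =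
      (⋂ φ : {φ // IsTestFunction Ω φ}, {p | ∫ x, p.1 x • ∇ φ.1 x ∂(volume.restrict Ω) = -∫ x, φ.1 x • p.2 x ∂(volume.restrict Ω)}) ∩
        {p | ⟪one, p.1⟫_ℝ = 0} := by
    ext p
    simp only [meanZeroGraph, Submodule.coe_set_mk, AddSubmonoid.coe_set_mk,
      AddSubsemigroup.coe_set_mk, mem_ofPred_eq, mem_inter_iff, mem_iInter, Subtype.forall]
    refine and_congr_left fun _ => ⟨fun h => h.2.2, fun h => ⟨?_, ?_, h⟩⟩
    · exact (Lp.memLp p.1).locallyIntegrableOn (by norm_num)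
    · exact (Lp.memLp p.2).locallyIntegrableOn (by norm_num)
  rw [e]
  refine (isClosed_iInter fun φ => ?_).inter
    (isClosed_eq (by fun_prop) continuous_const)
  obtain ⟨φ, hφ⟩ := φ
  have h1 : MemLp φ 2 (volume.restrict Ω) := (hφ.continuous.memLp_of_hasCompactSupport hφ.2.1).restrict _
  have h2 : MemLp (∇ φ) 2 (volume.restrict Ω) :=
    (hφ.continuous_gradient.memLp_of_hasCompactSupport hφ.2.1.gradient).restrict _
  set B := ContinuousLinearMap.lsmul ℝ ℝ (E := Eucl d)
  have e1 : ∀ p : Lp ℝ 2 (volume.restrict Ω) × Lp (Eucl d) 2 (volume.restrict Ω),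
      ∫ x, p.1 x • ∇ φ x ∂(volume.restrict Ω) = B.lpPairing (volume.restrict Ω) 2 2 p.1 (h2.toLp _) := fun p => by
    rw [ContinuousLinearMap.lpPairing_eq_integral]
    refine integral_congr_ae ?_
    filter_upwards [h2.coeFn_toLp] with x hx
    rw [hx]; rfl
  have e2 : ∀ p : Lp ℝ 2 (volume.restrict Ω) × Lp (Eucl d) 2 (volume.restrict Ω),
      ∫ x, φ x • p.2 x ∂(volume.restrict Ω) = B.lpPairing (volume.restrict Ω) 2 2 (h1.toLp _) p.2 := fun p => by
    rw [ContinuousLinearMap.lpPairing_eq_integral]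
    refine integral_congr_ae ?_
    filter_upwards [h1.coeFn_toLp] with x hx
    rw [hx]; rfl
  simp only [e1, e2]
  refine isClosed_eq ?_ ?_
  · exact ((B.lpPairing (volume.restrict Ω) 2 2).continuous.comp continuous_fst).clm_apply continuous_const
  · exact ((B.lpPairing (volume.restrict Ω) 2 2 (h1.toLp _)).continuous.comp continuous_snd).neg

theorem Lp.enorm_sq_eq_lintegral {α E : Type*} [MeasurableSpace α] [NormedAddCommGroup E]
    {μ : Measure α} (f : Lp E 2 μ) : ‖f‖ₑ ^ 2 = ∫⁻ x, ‖f x‖ₑ ^ 2 ∂μ := by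
  rw [Lp.enorm_def, eLpNorm_two_sq]

/-- A function of mean zero is orthogonal to constants, so subtracting the unknown constant `c` can
only increase its norm. -/
theorem norm_le_of_inner_eq_zero {one v : Lp ℝ 2 (volume.restrict Ω)}
    {G : Lp (Eucl d) 2 (volume.restrict Ω)} (hone : one =ᵐ[volume.restrict Ω] fun _ => 1)
    (hmean : ⟪one, v⟫_ℝ = 0) {C : ENNReal} (hC : C ≠ ⊤) {c : ℝ}
    (hc : ∫⁻ z in Ω, ‖v z - c‖ₑ ^ 2 ≤ C * ∫⁻ z in Ω, ‖G z‖ₑ ^ 2) :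
    ‖v‖ ≤ Real.sqrt C.toReal * ‖G‖ := by
  have h1 : ‖v‖ ^ 2 ≤ ‖v - c • one‖ ^ 2 := by
    rw [norm_sub_sq_real, inner_smul_right, real_inner_comm, hmean]
    nlinarith [sq_nonneg ‖c • one‖]
  have h2 : ‖v - c • one‖ₑ ^ 2 ≤ C * ‖G‖ₑ ^ 2 := by
    rw [Lp.enorm_sq_eq_lintegral, Lp.enorm_sq_eq_lintegral]
    refine le_trans (le_of_eq (lintegral_congr_ae ?_)) hc
    filter_upwards [hone, Lp.coeFn_sub v (c • one), Lp.coeFn_smul c one] with x h2 h3 h4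
    rw [h3, Pi.sub_apply, h4, Pi.smul_apply, h2]
    simp
  have h3 : ‖v - c • one‖ ^ 2 ≤ C.toReal * ‖G‖ ^ 2 := by
    have := ENNReal.toReal_mono (by finiteness) h2
    simpa using this
  have h4 : ‖v‖ ≤ Real.sqrt (C.toReal * ‖G‖ ^ 2) := Real.le_sqrt_of_sq_le (h1.trans h3)
  rwa [Real.sqrt_mul ENNReal.toReal_nonneg, Real.sqrt_sq (norm_nonneg _)] at h4

theorem HasPoincareOn.exists_mem_meanZeroGraph (hP : HasPoincareOn Ω Ω) (hΩ : IsOpen Ω)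
    (hv : volume Ω ≠ ⊤) (hv0 : volume Ω ≠ 0) {one : Lp ℝ 2 (volume.restrict Ω)}
    (hone : one =ᵐ[volume.restrict Ω] fun _ => 1) {g : Lp (Eucl d) 2 (volume.restrict Ω)}
    (hg : g ∈ gradientSpace Ω) : ∃ v, (v, g) ∈ meanZeroGraph Ω one hΩ := by
  obtain ⟨v, G, hG, hg⟩ := hg
  have hone_pos : ⟪one, one⟫_ℝ ≠ 0 := by
    rw [L2.inner_def, integral_congr_ae (g := fun _ => (1 : ℝ))]
    · simp [Measure.real, ENNReal.toReal_eq_zero_iff, hv, hv0]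
    · filter_upwards [hone] with x hx
      rw [hx]; simp
  have hG2 : MemLp G 2 (volume.restrict Ω) := (memLp_congr_ae hg).1 (Lp.memLp g)
  have hv2 : MemLp v 2 (volume.restrict Ω) := hP.memLp hv hG hG2
  -- The mean value of `v` over `Ω`.
  set c : ℝ := ⟪one, hv2.toLp v⟫_ℝ / ⟪one, one⟫_ℝ with hc
  refine ⟨hv2.toLp v - c • one, ?_, ?_⟩
  · have h0 : IsWeakGradient Ω (v - fun _ => c) (G - 0) := hG.sub (isWeakGradient_const c)
    refine h0.congr hΩ ?_ (by simpa using hg.symm)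
    filter_upwards [hv2.coeFn_toLp, hone, Lp.coeFn_sub (hv2.toLp v) (c • one),
      Lp.coeFn_smul c one] with x h1 h2 h3 h4
    rw [h3, Pi.sub_apply, Pi.sub_apply, h4, Pi.smul_apply, h1, h2]
    simp
  · rw [inner_sub_right, inner_smul_right, hc, div_mul_cancel₀ _ hone_pos, sub_self]

/-- The gradient space is the image of the complete space of mean-zero pairs under `(v, ∇v) ↦ ∇v`.
By the Poincaré inequality this map is bounded below, and such maps have closed range. -/
theorem HasPoincareOn.isClosed_gradientSpace (hP : HasPoincareOn Ω Ω) (hΩ : IsOpen Ω)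
    (hv : volume Ω ≠ ⊤) (hv0 : volume Ω ≠ 0) :
    IsClosed (gradientSpace Ω : Set (Lp (Eucl d) 2 (volume.restrict Ω))) := by
  have : IsFiniteMeasure (volume.restrict Ω) := ⟨by simpa using hv.lt_top⟩
  have hone : MemLp (fun _ : Eucl d => (1 : ℝ)) 2 (volume.restrict Ω) := memLp_const 1
  obtain ⟨one, hone⟩ : ∃ one : Lp ℝ 2 (volume.restrict Ω),
    one =ᵐ[volume.restrict Ω] fun _ => 1 := ⟨hone.toLp _, hone.coeFn_toLp⟩
  have : CompleteSpace (meanZeroGraph Ω one hΩ) := (isClosed_meanZeroGraph one hΩ).completeSpace_coe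
  set f : meanZeroGraph Ω one hΩ →L[ℝ] Lp (Eucl d) 2 (volume.restrict Ω) :=
    (ContinuousLinearMap.snd ℝ _ _).comp (meanZeroGraph Ω one hΩ).subtypeL with hf
  have hrange : range f = (gradientSpace Ω : Set (Lp (Eucl d) 2 (volume.restrict Ω))) := by
    ext g
    constructor
    · rintro ⟨⟨p, hp⟩, rfl⟩
      exact ⟨p.1, p.2, hp.1, EventuallyEq.rfl⟩
    · intro hg
      obtain ⟨v, hvg⟩ := hP.exists_mem_meanZeroGraph hΩ hv hv0 hone hg
      exact ⟨⟨(v, g), hvg⟩, rfl⟩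
  rw [← hrange]
  obtain ⟨C, hC, hpoin⟩ := hP
  -- The norm on the product is a maximum: `√C` handles the component `v`, and `1` the component
  -- `G`.
  refine (AddMonoidHomClass.antilipschitz_of_bound f
    (K := (max (Real.sqrt C.toReal) 1).toNNReal) ?_).isClosed_range f.uniformContinuous
  rintro ⟨⟨v, G⟩, hG, hmean⟩
  rw [Real.coe_toNNReal _ (by positivity)]
  change ‖(v, G)‖ ≤ max (Real.sqrt C.toReal) 1 * ‖G‖
  obtain ⟨c, hc⟩ := hpoin v G hG
  rw [Prod.norm_mk]
  refine max_le ((norm_le_of_inner_eq_zero hone hmean hC hc).trans ?_)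
    (le_mul_of_one_le_left (norm_nonneg _) (le_max_right _ _))
  exact mul_le_mul_of_nonneg_right (le_max_left _ 1) (norm_nonneg _)

end Projection

/-! ### The canonical gauge as an orthogonal projection -/

section Gauge

variable {d : ℕ} {Ω : Set (Eucl d)} {A : Eucl d → Eucl d}

theorem enorm_toLp_sub_eq_eLpNorm {E : Type*} [NormedAddCommGroup E] {α : Type*}
    [MeasurableSpace α] {μ : Measure α} {f g : α → E} (hf : MemLp f 2 μ) (hg : MemLp g 2 μ) :
    ‖hf.toLp f - hg.toLp g‖ₑ = eLpNorm (f - g) 2 μ := by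
  rw [← MemLp.toLp_sub, Lp.enorm_toLp]

theorem norm_toLp_sub_le_iff {E : Type*} [NormedAddCommGroup E] {α : Type*}
    [MeasurableSpace α] {μ : Measure α} {f g h : α → E} (hf : MemLp f 2 μ) (hg : MemLp g 2 μ)
    (hh : MemLp h 2 μ) : ‖hf.toLp f - hg.toLp g‖ ≤ ‖hf.toLp f - hh.toLp h‖ ↔
      eLpNorm (f - g) 2 μ ≤ eLpNorm (f - h) 2 μ := by
  rw [← enorm_toLp_sub_eq_eLpNorm hf hg, ← enorm_toLp_sub_eq_eLpNorm hf hh, enorm_le_iff_norm_le]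

theorem inner_toLp_sub {α E : Type*} [MeasurableSpace α] [NormedAddCommGroup E]
    [InnerProductSpace ℝ E] {μ : Measure α} {f g h : α → E} (hf : MemLp f 2 μ)
    (hg : MemLp g 2 μ) (hh : MemLp h 2 μ) :
    ⟪hf.toLp f - hg.toLp g, hh.toLp h⟫_ℝ = ∫ x, ⟪f x - g x, h x⟫_ℝ ∂μ := by
  rw [← MemLp.toLp_sub, L2.inner_def]
  refine integral_congr_ae ?_
  filter_upwards [(hf.sub hg).coeFn_toLp, hh.coeFn_toLp] with x h1 h2
  rw [h1, h2, Pi.sub_apply]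

theorem integrable_inner_of_memLp_two {α E : Type*} [MeasurableSpace α] [NormedAddCommGroup E]
    [InnerProductSpace ℝ E] {μ : Measure α} {f g : α → E} (hf : MemLp f 2 μ) (hg : MemLp g 2 μ) :
    Integrable (fun x => ⟪f x, g x⟫_ℝ) μ := by
  refine (L2.integrable_inner (𝕜 := ℝ) (hf.toLp f) (hg.toLp g)).congr ?_
  filter_upwards [hf.coeFn_toLp, hg.coeFn_toLp] with x h1 h2
  rw [h1, h2]

theorem MemH1.toLp_weakGrad_mem (hΩ : IsOpen Ω) {v : Eucl d → ℝ} (hv : MemH1 Ω v) :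
    (hv.memLp_weakGrad hΩ).toLp _ ∈ gradientSpace Ω :=
  ⟨v, weakGrad Ω v, hv.isWeakGradient, MemLp.coeFn_toLp _⟩

theorem HasPoincareOn.exists_toLp_weakGrad (hP : HasPoincareOn Ω Ω) (hΩ : IsOpen Ω)
    (hvol : volume Ω ≠ ⊤) {g : Lp (Eucl d) 2 (volume.restrict Ω)} (hg : g ∈ gradientSpace Ω) :
    ∃ v, ∃ hv : MemH1 Ω v, (hv.memLp_weakGrad hΩ).toLp _ = g := by
  obtain ⟨v, G, hG, hgG⟩ := hg
  have hv : MemH1 Ω v := hP.memH1 hvol hG ((memLp_congr_ae hgG).1 (Lp.memLp g))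
  refine ⟨v, hv, Lp.ext ?_⟩
  exact (MemLp.coeFn_toLp _).trans ((hG.weakGrad_ae_eq hΩ).trans hgG.symm)

/-- Every element of `gradientSpace Ω` is the gradient of an `H¹` function, by Poincaré, so both
sides minimize over the same set of gradients. -/
theorem HasPoincareOn.isGaugeMinimizer_iff_norm (hP : HasPoincareOn Ω Ω) (hΩ : IsOpen Ω)
    (hvol : volume Ω ≠ ⊤) (hA : MemLp A 2 (volume.restrict Ω)) {a : Eucl d → ℝ}
    (ha : MemH1 Ω a) : IsGaugeMinimizer Ω A a ↔ ∀ g ∈ gradientSpace Ω,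
      ‖hA.toLp A - (ha.memLp_weakGrad hΩ).toLp _‖ ≤ ‖hA.toLp A - g‖ := by
  constructor
  · rintro ⟨_, h⟩ g hg
    obtain ⟨v, hv, rfl⟩ := hP.exists_toLp_weakGrad hΩ hvol hg
    exact (norm_toLp_sub_le_iff _ _ _).2 (h v hv)
  · intro h
    exact ⟨ha, fun v hv => (norm_toLp_sub_le_iff hA _ (hv.memLp_weakGrad hΩ)).1
      (h _ (hv.toLp_weakGrad_mem hΩ))⟩

theorem norm_sub_le_iff_inner_eq_zero {F : Type*} [NormedAddCommGroup F] [InnerProductSpace ℝ F]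
    (K : Submodule ℝ F) {u v : F} (hv : v ∈ K) :
    (∀ w ∈ K, ‖u - v‖ ≤ ‖u - w‖) ↔ ∀ w ∈ K, ⟪u - v, w⟫_ℝ = 0 := by
  constructor
  · intro h
    rw [← K.norm_eq_iInf_iff_real_inner_eq_zero hv]
    refine le_antisymm (le_ciInf fun w => h w w.2) ?_
    exact ciInf_le (f := fun w : (K : Set F) => ‖u - w‖)
      ⟨0, by rintro _ ⟨w, rfl⟩; exact norm_nonneg _⟩ ⟨v, hv⟩
  · intro h w hw
    have h1 := h (v - w) (K.sub_mem hv hw)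
    refine (sq_le_sq₀ (norm_nonneg _) (norm_nonneg _)).1 ?_
    have : u - w = (u - v) + (v - w) := by abel
    rw [this, norm_add_sq_real, h1]
    nlinarith [sq_nonneg ‖v - w‖]

theorem HasPoincareOn.isGaugeMinimizer_iff (hP : HasPoincareOn Ω Ω) (hΩ : IsOpen Ω)
    (hvol : volume Ω ≠ ⊤) (hA : MemLp A 2 (volume.restrict Ω)) {a : Eucl d → ℝ} :
    IsGaugeMinimizer Ω A a ↔ MemH1 Ω a ∧
      ∀ v, MemH1 Ω v → ∫ x in Ω, ⟪A x - weakGrad Ω a x, weakGrad Ω v x⟫_ℝ = 0 := by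
  refine ⟨fun h => ⟨h.1, ?_⟩, fun h => ?_⟩
  · have h' := (norm_sub_le_iff_inner_eq_zero _ (h.1.toLp_weakGrad_mem hΩ)).1
      ((hP.isGaugeMinimizer_iff_norm hΩ hvol hA h.1).1 h)
    intro v hv
    rw [← inner_toLp_sub hA (h.1.memLp_weakGrad hΩ) (hv.memLp_weakGrad hΩ)]
    exact h' _ (hv.toLp_weakGrad_mem hΩ)
  · refine (hP.isGaugeMinimizer_iff_norm hΩ hvol hA h.1).2
      ((norm_sub_le_iff_inner_eq_zero _ (h.1.toLp_weakGrad_mem hΩ)).2 fun g hg => ?_)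
    obtain ⟨v, hv, rfl⟩ := hP.exists_toLp_weakGrad hΩ hvol hg
    rw [inner_toLp_sub]
    exact h.2 v hv

theorem HasPoincareOn.exists_isGaugeMinimizer (hP : HasPoincareOn Ω Ω) (hΩ : IsOpen Ω)
    (hvol : volume Ω ≠ ⊤) (hvol0 : volume Ω ≠ 0) (hA : MemLp A 2 (volume.restrict Ω)) :
    ∃ a, IsGaugeMinimizer Ω A a := by
  have hc := hP.isClosed_gradientSpace hΩ hvol hvol0
  have : CompleteSpace (gradientSpace Ω) := hc.completeSpace_coe
  obtain ⟨a, ha, he⟩ := hP.exists_toLp_weakGrad hΩ hvol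
    ((gradientSpace Ω).starProjection_apply_mem (hA.toLp A))
  refine ⟨a, (hP.isGaugeMinimizer_iff_norm hΩ hvol hA ha).2
    ((norm_sub_le_iff_inner_eq_zero _ (ha.toLp_weakGrad_mem hΩ)).2 fun g hg => ?_)⟩
  rw [he]
  exact (gradientSpace Ω).starProjection_inner_eq_zero _ g hg

theorem HasPoincareOn.weakGrad_ae_eq_of_isGaugeMinimizer (hP : HasPoincareOn Ω Ω) (hΩ : IsOpen Ω)
    (hvol : volume Ω ≠ ⊤) (hA : MemLp A 2 (volume.restrict Ω)) {a b : Eucl d → ℝ}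
    (ha : IsGaugeMinimizer Ω A a) (hb : IsGaugeMinimizer Ω A b) :
    weakGrad Ω a =ᵐ[volume.restrict Ω] weakGrad Ω b := by
  have ha2 := ha.1.memLp_weakGrad hΩ
  have hb2 := hb.1.memLp_weakGrad hΩ
  have h1 := (norm_sub_le_iff_inner_eq_zero _ (ha.1.toLp_weakGrad_mem hΩ)).1
      ((hP.isGaugeMinimizer_iff_norm hΩ hvol hA ha.1).1 ha)
  have h2 := (norm_sub_le_iff_inner_eq_zero _ (hb.1.toLp_weakGrad_mem hΩ)).1
      ((hP.isGaugeMinimizer_iff_norm hΩ hvol hA hb.1).1 hb)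
  have hm := (gradientSpace Ω).sub_mem (ha.1.toLp_weakGrad_mem hΩ) (hb.1.toLp_weakGrad_mem hΩ)
  -- The difference of the two gradients is a gradient and also the difference of two residuals
  -- orthogonal to gradients, so it is orthogonal to itself.
  have e : ha2.toLp _ = hb2.toLp _ := by
    rw [← sub_eq_zero, ← inner_self_eq_zero (𝕜 := ℝ)]
    have e3 : ha2.toLp _ - hb2.toLp _ =
      (hA.toLp A - hb2.toLp _) - (hA.toLp A - ha2.toLp _) := by abel
    conv_lhs => rw [e3, inner_sub_left, ← e3]
    rw [h2 _ hm, h1 _ hm, sub_zero]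
  exact (MemLp.toLp_eq_toLp_iff _ _).1 e

theorem HasPoincareOn.isGaugeMinimizer_iff_add_const (hP : HasPoincareOn Ω Ω) (hΩ : IsOpen Ω)
    (hvol : volume Ω ≠ ⊤) (hA : MemLp A 2 (volume.restrict Ω)) {a : Eucl d → ℝ}
    (ha : IsGaugeMinimizer Ω A a) (b : Eucl d → ℝ) :
    IsGaugeMinimizer Ω A b ↔ ∃ c : ℝ, b =ᵐ[volume.restrict Ω] fun x => a x + c := by
  constructor
  · intro hb
    have he := hP.weakGrad_ae_eq_of_isGaugeMinimizer hΩ hvol hA ha hb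
    have h0 : IsWeakGradient Ω (b - a) 0 := by
      refine (hb.1.isWeakGradient.sub ha.1.isWeakGradient).congr hΩ EventuallyEq.rfl ?_
      filter_upwards [he] with x hx
      simp [hx]
    obtain ⟨c, hc⟩ := hP.ae_eq_const h0
    refine ⟨c, hc.mono fun x hx => ?_⟩
    have hx : b x - a x = c := hx
    change b x = a x + c
    linarith
  · rintro ⟨c, hc⟩
    have hg : IsWeakGradient Ω b (weakGrad Ω a) := by
      refine (ha.1.isWeakGradient.add (isWeakGradient_const c)).congr hΩ ?_ (by simp)
      filter_upwards [hc] with x hx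
      rw [hx]; rfl
    have hb : MemH1 Ω b := hP.memH1 hvol hg (ha.1.memLp_weakGrad hΩ)
    refine ⟨hb, fun v hv => ?_⟩
    have e : eLpNorm (A - weakGrad Ω b) 2 (volume.restrict Ω) =
        eLpNorm (A - weakGrad Ω a) 2 (volume.restrict Ω) :=
      eLpNorm_congr_ae ((EventuallyEq.refl _ A).sub (hg.weakGrad_ae_eq hΩ))
    rw [e]
    exact ha.2 v hv

theorem HasPoincareOn.integral_inner_weakGrad_eq (hP : HasPoincareOn Ω Ω) (hΩ : IsOpen Ω)
    (hvol : volume Ω ≠ ⊤) (hA : MemLp A 2 (volume.restrict Ω)) {a v : Eucl d → ℝ}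
    (ha : IsGaugeMinimizer Ω A a) (hv : MemH1 Ω v) :
    ∫ x in Ω, ⟪weakGrad Ω a x, weakGrad Ω v x⟫_ℝ = ∫ x in Ω, ⟪A x, weakGrad Ω v x⟫_ℝ := by
  have h := ((hP.isGaugeMinimizer_iff hΩ hvol hA).1 ha).2 v hv
  have ha2 := ha.1.memLp_weakGrad hΩ
  have hv2 := hv.memLp_weakGrad hΩ
  simp only [inner_sub_left] at h
  rw [integral_sub] at h
  · linarith
  · exact integrable_inner_of_memLp_two hA hv2
  · exact integrable_inner_of_memLp_two ha2 hv2

theorem IsTestFunction.memLp {φ : Eucl d → ℝ} (hφ : IsTestFunction Ω φ) :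
    MemLp φ 2 (volume.restrict Ω) :=
  (hφ.continuous.memLp_of_hasCompactSupport hφ.2.1).restrict _

theorem IsTestFunction.memLp_gradient {φ : Eucl d → ℝ} (hφ : IsTestFunction Ω φ) :
    MemLp (∇ φ) 2 (volume.restrict Ω) :=
  (hφ.continuous_gradient.memLp_of_hasCompactSupport hφ.2.1.gradient).restrict _

theorem HasPoincareOn.hasWeakDivergence_zero (hP : HasPoincareOn Ω Ω) (hΩ : IsOpen Ω)
    (hvol : volume Ω ≠ ⊤) (hA : MemLp A 2 (volume.restrict Ω)) {a : Eucl d → ℝ}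
    (ha : IsGaugeMinimizer Ω A a) : HasWeakDivergence Ω (A - weakGrad Ω a) 0 := by
  refine ⟨(hA.sub (ha.1.memLp_weakGrad hΩ)).locallyIntegrableOn (by norm_num),
    locallyIntegrableOn_zero, fun φ hφ => ?_⟩
  have hg : IsWeakGradient Ω φ (∇ φ) := ContDiff.isWeakGradient (hφ.1.of_le (by simp))
  have hφ1 : MemH1 Ω φ := ⟨hφ.memLp, _, hg, hφ.memLp_gradient⟩
  have h := ((hP.isGaugeMinimizer_iff hΩ hvol hA).1 ha).2 φ hφ1
  simp only [Pi.zero_apply, zero_mul, integral_zero, neg_zero]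
  rw [← h]
  refine integral_congr_ae ?_
  filter_upwards [hg.weakGrad_ae_eq hΩ] with x hx
  rw [hx]; rfl

theorem MemH1.isGaugeEquivalent_sub (A : Eucl d → Eucl d) {a : Eucl d → ℝ} (ha : MemH1 Ω a) :
    IsGaugeEquivalent Ω A (A - weakGrad Ω a) :=
  ⟨a, by rw [sub_sub_cancel]; exact ha.isWeakGradient⟩

/-- A field `G` of infinite norm is no competitor. Otherwise `A - G` is an `L²` gradient, its
potential is in `H¹` by Poincaré, and minimality applies. Equality makes this potential another
minimizer, and minimizers share their gradient. -/
theorem HasPoincareOn.eLpNorm_le_of_isGaugeEquivalent (hP : HasPoincareOn Ω Ω) (hΩ : IsOpen Ω)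
    (hvol : volume Ω ≠ ⊤) (hA : MemLp A 2 (volume.restrict Ω)) {a : Eucl d → ℝ}
    (ha : IsGaugeMinimizer Ω A a) {G : Eucl d → Eucl d} (hG : IsGaugeEquivalent Ω A G) :
    eLpNorm (A - weakGrad Ω a) 2 (volume.restrict Ω) ≤ eLpNorm G 2 (volume.restrict Ω) ∧
      (eLpNorm G 2 (volume.restrict Ω) = eLpNorm (A - weakGrad Ω a) 2 (volume.restrict Ω) →
        G =ᵐ[volume.restrict Ω] A - weakGrad Ω a) := by
  have hF : MemLp (A - weakGrad Ω a) 2 (volume.restrict Ω) := hA.sub (ha.1.memLp_weakGrad hΩ)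
  by_cases htop : eLpNorm G 2 (volume.restrict Ω) = ⊤
  · exact ⟨htop ▸ le_top, fun h => absurd (h ▸ htop) hF.2.ne⟩
  obtain ⟨v, hv⟩ := hG
  -- Measurability of `G` is not part of gauge equivalence; it is recovered from that of `A` and `A
  -- - G`.
  have hGm : AEStronglyMeasurable G (volume.restrict Ω) := by
    have := hA.1.sub hv.2.1.aestronglyMeasurable
    rwa [sub_sub_cancel] at this
  have hG2 : MemLp G 2 (volume.restrict Ω) := ⟨hGm, lt_top_iff_ne_top.2 htop⟩
  have hv1 : MemH1 Ω v := hP.memH1 hvol hv (hA.sub hG2)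
  have he : A - weakGrad Ω v =ᵐ[volume.restrict Ω] G := by
    filter_upwards [hv.weakGrad_ae_eq hΩ] with x hx
    simp [hx]
  have hen := eLpNorm_congr_ae (p := 2) he
  refine ⟨hen ▸ ha.2 v hv1, fun h => ?_⟩
  have hmin : IsGaugeMinimizer Ω A v :=
    ⟨hv1, fun w hw => by rw [hen, h]; exact ha.2 w hw⟩
  refine he.symm.trans ?_
  exact (EventuallyEq.refl _ A).sub (hP.weakGrad_ae_eq_of_isGaugeMinimizer hΩ hvol hA hmin ha)

end Gauge

/-! ### The area formula for Lipschitz graphs -/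

section AreaFormula

/-- The hypothesis makes `F₁ x ↦ F₂ x` a well-defined `C`-Lipschitz map between the images. It is
used to compare a graph with the graph of a linear approximation, in both directions. -/
theorem euclideanHausdorffMeasure_image_le_of_dist_le {X Y Z : Type*} [Nonempty X]
    [MetricSpace Y] [MeasurableSpace Y] [BorelSpace Y] [MetricSpace Z] [MeasurableSpace Z]
    [BorelSpace Z] {F₁ : X → Y} {F₂ : X → Z} {s : Set X} {C : NNReal}
    (h : ∀ x ∈ s, ∀ y ∈ s, dist (F₂ x) (F₂ y) ≤ C * dist (F₁ x) (F₁ y)) (m : ℕ) :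
    μHE[m] (F₂ '' s) ≤ C ^ m * μHE[m] (F₁ '' s) := by
  set φ : Y → Z := fun z => F₂ (Function.invFunOn F₁ s z) with hφ
  have hmem : ∀ x ∈ s, Function.invFunOn F₁ s (F₁ x) ∈ s := fun x hx =>
    Function.invFunOn_mem ⟨x, hx, rfl⟩
  have heq : ∀ x ∈ s, F₁ (Function.invFunOn F₁ s (F₁ x)) = F₁ x := fun x hx =>
    Function.invFunOn_eq ⟨x, hx, rfl⟩
  have hφF : ∀ x ∈ s, φ (F₁ x) = F₂ x := fun x hx => by
    have := h _ (hmem x hx) x hx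
    rw [heq x hx, dist_self, mul_zero] at this
    exact dist_le_zero.1 this
  have him : F₂ '' s = φ '' (F₁ '' s) := by
    rw [image_image]
    exact image_congr fun x hx => (hφF x hx).symm
  have hL : LipschitzOnWith C φ (F₁ '' s) := by
    refine LipschitzOnWith.of_dist_le_mul ?_
    rintro _ ⟨x, hx, rfl⟩ _ ⟨y, hy, rfl⟩
    rw [hφF x hx, hφF y hy]
    exact h x hx y hy
  rw [him]
  have := hL.hausdorffMeasure_image_le (d := m) (by positivity)
  rw [ENNReal.rpow_natCast] at this
  simp_rw [Measure.euclideanHausdorffMeasure_def, Measure.smul_apply,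
    Measure.nnreal_smul_coe_apply]
  rw [mul_left_comm]
  gcongr

variable {V E : Type*} [NormedAddCommGroup V] [InnerProductSpace ℝ V] [NormedAddCommGroup E]
  [InnerProductSpace ℝ E]

/-- The parametrization `y ↦ y + g(y) ν` of the graph of `g` over a hyperplane. -/
noncomputable def graphMap (ι : V →ₗᵢ[ℝ] E) (ν : E) (g : V → ℝ) (y : V) : E := ι y + g y • ν

/-- The area density of the graph of a function with derivative `p`. -/
noncomputable def graphDensity (p : V →L[ℝ] ℝ) : ℝ := Real.sqrt (1 + ‖p‖ ^ 2)

variable {ι : V →ₗᵢ[ℝ] E} {ν : E} {g : V → ℝ} {K : NNReal}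

theorem norm_sq_add_smul (hν : ‖ν‖ = 1) (hι : ∀ y, ⟪ι y, ν⟫_ℝ = 0) (y : V) (s : ℝ) :
    ‖ι y + s • ν‖ ^ 2 = ‖y‖ ^ 2 + s ^ 2 := by
  rw [norm_add_sq_real, inner_smul_right, hι, norm_smul, hν, ι.norm_map]
  simp

theorem norm_le_norm_add_smul (hν : ‖ν‖ = 1) (hι : ∀ y, ⟪ι y, ν⟫_ℝ = 0) (y : V) (s : ℝ) :
    ‖y‖ ≤ ‖ι y + s • ν‖ := by
  refine (sq_le_sq₀ (norm_nonneg _) (norm_nonneg _)).1 ?_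
  rw [norm_sq_add_smul hν hι]
  nlinarith [sq_nonneg s]

theorem one_le_graphDensity (p : V →L[ℝ] ℝ) : 1 ≤ graphDensity p := by
  rw [graphDensity, Real.one_le_sqrt]
  nlinarith [sq_nonneg ‖p‖]

theorem graphDensity_pos (p : V →L[ℝ] ℝ) : 0 < graphDensity p :=
  zero_lt_one.trans_le (one_le_graphDensity p)

theorem continuous_graphDensity : Continuous (graphDensity (V := V)) := by
  unfold graphDensity; fun_prop

/-- The density is at least `1`, so the additive error `δ` can be absorbed into a multiplicative
one. -/
theorem graphDensity_le (p q : V →L[ℝ] ℝ) {δ : ℝ} (h : ‖p - q‖ ≤ δ) :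
    graphDensity p ≤ (1 + δ) * graphDensity q := by
  have hδ : 0 ≤ δ := (norm_nonneg _).trans h
  have h1 : ‖p‖ ≤ ‖q‖ + δ := by
    have := norm_le_norm_add_norm_sub' p q
    linarith
  have hq := one_le_graphDensity q
  have hq0 : 0 ≤ graphDensity q := by linarith
  have hqs : graphDensity q ^ 2 = 1 + ‖q‖ ^ 2 := Real.sq_sqrt (by positivity)
  have hqn : ‖q‖ ≤ graphDensity q := by
    refine (sq_le_sq₀ (norm_nonneg _) hq0).1 ?_
    linarith
  refine Real.sqrt_le_iff.2 ⟨by positivity, ?_⟩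
  have h2 : ‖p‖ ^ 2 ≤ (‖q‖ + δ) ^ 2 := by gcongr
  have h3 : δ * ‖q‖ ≤ δ * graphDensity q ^ 2 := by
    gcongr
    nlinarith
  nlinarith [mul_nonneg hδ hδ]

/-- The linear graph map. -/
noncomputable def graphLinear (ι : V →ₗᵢ[ℝ] E) (ν : E) (p : V →L[ℝ] ℝ) : V →L[ℝ] E :=
  ι.toContinuousLinearMap + p.smulRight ν

@[simp] theorem graphLinear_apply (p : V →L[ℝ] ℝ) (y : V) :
    graphLinear ι ν p y = ι y + p y • ν := rfl

theorem graphMap_sub_graphLinear (p : V →L[ℝ] ℝ) (x y : V) :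
    graphMap ι ν g x - graphMap ι ν g y - graphLinear ι ν p (x - y) =
      (g x - g y - p (x - y)) • ν := by
  simp only [graphMap, graphLinear_apply, map_sub]
  module

/-- The error lies along `ν` and is at most `δ ‖x - y‖`; by Pythagoras a displacement in the base is
no longer than its lift to the linear graph, so the error is relative. -/
theorem norm_graphMap_sub_le (hν : ‖ν‖ = 1) (hι : ∀ y, ⟪ι y, ν⟫_ℝ = 0) {p : V →L[ℝ] ℝ}
    {s : Set V} {δ : NNReal} (h : ApproximatesLinearOn g p s δ) {x y : V} (hx : x ∈ s)
    (hy : y ∈ s) : ‖graphMap ι ν g x - graphMap ι ν g y - graphLinear ι ν p (x - y)‖ ≤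
      δ * ‖graphLinear ι ν p (x - y)‖ := by
  rw [graphMap_sub_graphLinear, norm_smul, hν, mul_one]
  refine (h x hx y hy).trans ?_
  gcongr
  exact norm_le_norm_add_smul hν hι _ _

variable [FiniteDimensional ℝ V]

/-- With `L` the linear graph map, `L* L` is the identity plus the rank-one map `y ↦ p(y) p♯`, where
`p♯` represents `p`. Its determinant is `1 + p(p♯) = 1 + ‖p‖²`. -/
theorem normDet_graphLinear [FiniteDimensional ℝ E] (hν : ‖ν‖ = 1) (hι : ∀ y, ⟪ι y, ν⟫_ℝ = 0)
    (p : V →L[ℝ] ℝ) : (graphLinear ι ν p : V →ₗ[ℝ] E).normDet = graphDensity p := by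
  have h := (graphLinear ι ν p : V →ₗ[ℝ] E).normDet_sq
  have e : LinearMap.adjoint (graphLinear ι ν p : V →ₗ[ℝ] E) ∘ₗ (graphLinear ι ν p : V →ₗ[ℝ] E) =
      LinearMap.transvection (p : V →ₗ[ℝ] ℝ) ((InnerProductSpace.toDual ℝ V).symm p) := by
    ext y
    refine ext_inner_left ℝ fun z => ?_
    have hz : ⟪z, (InnerProductSpace.toDual ℝ V).symm p⟫_ℝ = p z := by
      rw [real_inner_comm, InnerProductSpace.toDual_symm_apply]
    rw [LinearMap.comp_apply, LinearMap.adjoint_inner_right, LinearMap.transvection.apply,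
      inner_add_right, inner_smul_right, hz]
    simp only [ContinuousLinearMap.coe_coe, graphLinear_apply, inner_add_left, inner_add_right,
      inner_smul_left, inner_smul_right, hι, real_inner_comm _ ν, real_inner_self_eq_norm_sq, hν,
      ι.inner_map_map]
    simp
  rw [e, LinearMap.transvection.det] at h
  have hp : (p : V →ₗ[ℝ] ℝ) ((InnerProductSpace.toDual ℝ V).symm p) = ‖p‖ ^ 2 := by
    rw [ContinuousLinearMap.coe_coe, ← InnerProductSpace.toDual_symm_apply,
      real_inner_self_eq_norm_sq, LinearIsometryEquiv.norm_map]
  rw [hp] at h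
  have h' : (graphLinear ι ν p : V →ₗ[ℝ] E).normDet ^ 2 = 1 + ‖p‖ ^ 2 := by simpa using h
  rw [graphDensity, ← h', Real.sqrt_sq (LinearMap.normDet_nonneg _)]

variable [MeasurableSpace V] [BorelSpace V] [MeasurableSpace E] [BorelSpace E]

theorem euclideanHausdorffMeasure_graphLinear_image [FiniteDimensional ℝ E] (hν : ‖ν‖ = 1)
    (hι : ∀ y, ⟪ι y, ν⟫_ℝ = 0) (p : V →L[ℝ] ℝ) (s : Set V) :
    μHE[Module.finrank ℝ V] (graphLinear ι ν p '' s) =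
      ENNReal.ofReal (graphDensity p) * volume s := by
  rw [← normDet_graphLinear hν hι p]
  exact (graphLinear ι ν p : V →ₗ[ℝ] E).euclideanHausdorffMeasure_image_eq_normDet_mul_volume s

theorem euclideanHausdorffMeasure_graphMap_image_le [FiniteDimensional ℝ E] (hν : ‖ν‖ = 1)
    (hι : ∀ y, ⟪ι y, ν⟫_ℝ = 0) {p : V →L[ℝ] ℝ} {s : Set V} {δ : NNReal}
    (h : ApproximatesLinearOn g p s δ) :
    μHE[Module.finrank ℝ V] (graphMap ι ν g '' s) ≤
      ((1 + δ : NNReal) : ENNReal) ^ Module.finrank ℝ V *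
        (ENNReal.ofReal (graphDensity p) * volume s) := by
  rw [← euclideanHausdorffMeasure_graphLinear_image hν hι]
  refine euclideanHausdorffMeasure_image_le_of_dist_le (fun x hx y hy => ?_) _
  rw [dist_eq_norm, dist_eq_norm, ← map_sub]
  have h1 := norm_graphMap_sub_le hν hι h hx hy
  have h2 := norm_le_norm_add_norm_sub' (graphMap ι ν g x - graphMap ι ν g y)
    (graphLinear ι ν p (x - y))
  push_cast
  linarith

theorem le_euclideanHausdorffMeasure_graphMap_image [FiniteDimensional ℝ E] (hν : ‖ν‖ = 1)
    (hι : ∀ y, ⟪ι y, ν⟫_ℝ = 0) {p : V →L[ℝ] ℝ} {s : Set V} {δ : NNReal} (hδ : δ < 1)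
    (h : ApproximatesLinearOn g p s δ) :
    ENNReal.ofReal (graphDensity p) * volume s ≤
      (((1 - δ)⁻¹ : NNReal) : ENNReal) ^ Module.finrank ℝ V *
        μHE[Module.finrank ℝ V] (graphMap ι ν g '' s) := by
  rw [← euclideanHausdorffMeasure_graphLinear_image hν hι]
  refine euclideanHausdorffMeasure_image_le_of_dist_le (fun x hx y hy => ?_) _
  rw [dist_eq_norm, dist_eq_norm, ← map_sub]
  have h1 := norm_graphMap_sub_le hν hι h hx hy
  have h2 := norm_le_norm_add_norm_sub (graphMap ι ν g x - graphMap ι ν g y)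
    (graphLinear ι ν p (x - y))
  have h3 : (0 : ℝ) < 1 - δ := by
    have : (δ : ℝ) < 1 := hδ
    linarith
  rw [NNReal.coe_inv, NNReal.coe_sub hδ.le, NNReal.coe_one, inv_mul_eq_div, le_div_iff₀ h3]
  linarith

theorem measurableEmbedding_graphMap (hν : ‖ν‖ = 1) (hι : ∀ y, ⟪ι y, ν⟫_ℝ = 0)
    (hg : LipschitzWith K g) : MeasurableEmbedding (graphMap ι ν g) := by
  have ha : AntilipschitzWith 1 (graphMap ι ν g) := by
    refine AntilipschitzWith.of_le_mul_dist fun x y => ?_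
    rw [dist_eq_norm, dist_eq_norm, NNReal.coe_one, one_mul]
    have e : graphMap ι ν g x - graphMap ι ν g y = ι (x - y) + (g x - g y) • ν := by
      simp only [graphMap, map_sub]; module
    rw [e]
    exact norm_le_norm_add_smul hν hι _ _
  have hu : UniformContinuous (graphMap ι ν g) :=
    ι.toContinuousLinearMap.uniformContinuous.add
      (((LinearMap.toSpanSingleton ℝ E ν).toContinuousLinearMap.uniformContinuous).comp
        hg.uniformContinuous)
  exact (ha.isClosedEmbedding hu).measurableEmbedding

end AreaFormula

section AreaFormulaMeasure

variable {V E : Type*} [NormedAddCommGroup V] [InnerProductSpace ℝ V] [NormedAddCommGroup E]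
  [InnerProductSpace ℝ E] [MeasurableSpace V] [BorelSpace V] [MeasurableSpace E] [BorelSpace E]
  {ι : V →ₗᵢ[ℝ] E} {ν : E} {g : V → ℝ} {K : NNReal}

theorem measurable_graphDensity_fderiv (g : V → ℝ) :
    Measurable fun x => ENNReal.ofReal (graphDensity (fderiv ℝ g x)) :=
  (continuous_graphDensity.measurable.comp (measurable_fderiv ℝ g)).ennreal_ofReal

variable [FiniteDimensional ℝ V]

/-- A function can be approximated to any accuracy by linear maps on the pieces of a countable
partition of the set where it is differentiable. -/
theorem exists_partition_approximatesLinearOn_fderiv (g : V → ℝ) {δ : NNReal} (hδ : 0 < δ) :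
    ∃ (P : ℕ × ℕ → Set V) (p : ℕ × ℕ → V →L[ℝ] ℝ), Pairwise (Function.onFun Disjoint P) ∧
      (∀ i, MeasurableSet (P i)) ∧ (⋃ i, P i) = {x | DifferentiableAt ℝ g x} ∧
      ∀ i, ApproximatesLinearOn g (p i) (P i) δ ∧ ∀ x ∈ P i, ‖fderiv ℝ g x - p i‖ ≤ 2 * δ := by
  set D := {x | DifferentiableAt ℝ g x} with hD
  have hDm : MeasurableSet D := measurableSet_of_differentiableAt ℝ g
  set q : ℕ → (V →L[ℝ] ℝ) := TopologicalSpace.denseSeq _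
  -- Linear approximation of `g` on a piece does not control `fderiv ℝ g` there. The domain is
  -- therefore first split by the value of the derivative up to `δ`; the approximating maps are
  -- derivatives at points of the same piece, whence the bound `2δ`.
  set Q : ℕ → Set (V →L[ℝ] ℝ) := disjointed fun k => Metric.ball (q k) δ with hQ
  have hQm : ∀ k, MeasurableSet (Q k) := fun k =>
    MeasurableSet.disjointed (fun _ => Metric.isOpen_ball.measurableSet) k
  have hQball : ∀ k, Q k ⊆ Metric.ball (q k) δ := fun k => disjointed_subset _ k
  have hQU : ⋃ k, Q k = univ := by
    rw [hQ, iUnion_disjointed, eq_univ_iff_forall]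
    intro r
    obtain ⟨k, hk⟩ := (TopologicalSpace.denseRange_denseSeq (V →L[ℝ] ℝ)).exists_dist_lt r
      (ε := δ) (by exact_mod_cast hδ)
    exact mem_iUnion.2 ⟨k, hk⟩
  set s : ℕ → Set V := fun k => D ∩ fderiv ℝ g ⁻¹' Q k with hs
  have hsm : ∀ k, MeasurableSet (s k) := fun k => hDm.inter (measurable_fderiv ℝ g (hQm k))
  have hpart := fun k => exists_partition_approximatesLinearOn_of_hasFDerivWithinAt g (s k)
    (fderiv ℝ g) (fun x hx => hx.1.hasFDerivAt.hasFDerivWithinAt) (fun _ => δ) (fun _ => hδ.ne')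
  choose t A htd htm hts hta htA using hpart
  refine ⟨fun i => s i.1 ∩ t i.1 i.2, fun i => A i.1 i.2, ?_, ?_, ?_, ?_⟩
  · rintro ⟨k, n⟩ ⟨k', n'⟩ hne
    by_cases hk : k = k'
    · subst hk
      have hn : n ≠ n' := fun h => hne (by rw [h])
      exact (htd k hn).mono inter_subset_right inter_subset_right
    · have h1 : Disjoint (Q k) (Q k') := disjoint_disjointed _ hk
      exact (h1.preimage (fderiv ℝ g)).mono (inter_subset_left.trans inter_subset_right)
        (inter_subset_left.trans inter_subset_right)
  · exact fun i => (hsm i.1).inter (htm i.1 i.2)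
  · refine (iUnion_subset fun i => inter_subset_left.trans inter_subset_left).antisymm ?_
    intro x hx
    obtain ⟨k, hk⟩ := mem_iUnion.1 (hQU ▸ mem_univ (fderiv ℝ g x) : fderiv ℝ g x ∈ ⋃ k, Q k)
    have hxs : x ∈ s k := ⟨hx, hk⟩
    obtain ⟨n, hn⟩ := mem_iUnion.1 (hts k hxs)
    exact mem_iUnion.2 ⟨(k, n), hxs, hn⟩
  · rintro ⟨k, n⟩
    refine ⟨hta k n, fun x hx => ?_⟩
    obtain ⟨y, hy, hAy⟩ := htA k ⟨x, hx.1⟩ n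
    have h1 := hQball k hx.1.2
    have h2 := hQball k hy.2
    rw [mem_ball_iff_norm] at h1 h2
    change ‖fderiv ℝ g x - A k n‖ ≤ 2 * δ
    rw [hAy]
    have := norm_sub_le (fderiv ℝ g x - q k) (fderiv ℝ g y - q k)
    rw [sub_sub_sub_cancel_right] at this
    linarith

theorem euclideanHausdorffMeasure_graphMap_image_eq_zero (hν : ‖ν‖ = 1)
    (hg : LipschitzWith K g) {s : Set V} (hs : volume s = 0) :
    μHE[Module.finrank ℝ V] (graphMap ι ν g '' s) = 0 := by
  have h := euclideanHausdorffMeasure_image_le_of_dist_le (F₁ := (id : V → V))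
    (F₂ := graphMap ι ν g) (s := s) (C := 1 + K) (fun x _ y _ => ?_) (Module.finrank ℝ V)
  · rw [image_id, InnerProductSpace.euclideanHausdorffMeasure_eq_volume, hs, mul_zero] at h
    exact le_antisymm h (zero_le)
  · rw [dist_eq_norm]
    have e : graphMap ι ν g x - graphMap ι ν g y = ι (x - y) + (g x - g y) • ν := by
      simp only [graphMap, map_sub]; module
    rw [e]
    refine (norm_add_le _ _).trans ?_
    rw [norm_smul, hν, mul_one, ι.norm_map, ← dist_eq_norm, ← dist_eq_norm]
    have := hg.dist_le_mul x y
    push_cast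
    simp only [id]
    linarith

theorem lintegral_graphDensity_le_of_norm_sub_le {p : V →L[ℝ] ℝ} {S : Set V}
    {δ : NNReal} (h : ∀ x ∈ S, ‖fderiv ℝ g x - p‖ ≤ 2 * δ) :
    ∫⁻ x in S, ENNReal.ofReal (graphDensity (fderiv ℝ g x)) ≤
      ENNReal.ofReal (1 + 2 * δ) * (ENNReal.ofReal (graphDensity p) * volume S) := by
  rw [← mul_assoc, ← setLIntegral_const]
  refine setLIntegral_mono measurable_const fun x hx => ?_
  rw [← ENNReal.ofReal_mul (by positivity)]
  exact ENNReal.ofReal_le_ofReal (graphDensity_le _ _ (h x hx))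

theorem le_lintegral_graphDensity_of_norm_sub_le {p : V →L[ℝ] ℝ} {S : Set V}
    {δ : NNReal} (h : ∀ x ∈ S, ‖fderiv ℝ g x - p‖ ≤ 2 * δ) :
    ENNReal.ofReal (graphDensity p) * volume S ≤ ENNReal.ofReal (1 + 2 * δ) *
      ∫⁻ x in S, ENNReal.ofReal (graphDensity (fderiv ℝ g x)) := by
  rw [← lintegral_const_mul _ (measurable_graphDensity_fderiv g), ← setLIntegral_const]
  refine setLIntegral_mono ((measurable_graphDensity_fderiv g).const_mul _) fun x hx => ?_
  rw [← ENNReal.ofReal_mul (by positivity)]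
  refine ENNReal.ofReal_le_ofReal (graphDensity_le _ _ ?_)
  rw [norm_sub_rev]
  exact h x hx

theorem Measure.le_smul_of_partition {α : Type*} [MeasurableSpace α] {μ₁ μ₂ : Measure α}
    {P : ℕ × ℕ → Set α} (hPd : Pairwise (Function.onFun Disjoint P))
    (hPm : ∀ i, MeasurableSet (P i)) (h0 : μ₁ (⋃ i, P i)ᶜ = 0) {c : ENNReal}
    (h : ∀ i, ∀ S ⊆ P i, MeasurableSet S → μ₁ S ≤ c * μ₂ S) {S : Set α} (hS : MeasurableSet S) :
    μ₁ S ≤ c * μ₂ S := by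
  have hd : Pairwise (Function.onFun Disjoint fun i => S ∩ P i) := fun i j hij =>
    (hPd hij).mono inter_subset_right inter_subset_right
  have hm : ∀ i, MeasurableSet (S ∩ P i) := fun i => hS.inter (hPm i)
  calc μ₁ S ≤ μ₁ (S ∩ ⋃ i, P i) + μ₁ (⋃ i, P i)ᶜ := by
        refine (measure_mono fun x hx => ?_).trans (measure_union_le _ _)
        by_cases h : x ∈ ⋃ i, P i
        · exact Or.inl ⟨hx, h⟩
        · exact Or.inr h
    _ = ∑' i, μ₁ (S ∩ P i) := by rw [h0, add_zero, inter_iUnion, measure_iUnion hd hm]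
    _ ≤ ∑' i, c * μ₂ (S ∩ P i) := ENNReal.tsum_le_tsum fun i => h i _ inter_subset_right (hm i)
    _ = c * μ₂ (S ∩ ⋃ i, P i) := by
        rw [ENNReal.tsum_mul_left, inter_iUnion, measure_iUnion hd hm]
    _ ≤ c * μ₂ S := by gcongr; exact inter_subset_left

variable [FiniteDimensional ℝ E]

/-- On each piece of a partition where `g` is `δ`-close to linear, both measures agree with the
linear area up to factors tending to `1` with `δ`. Summing over the pieces and letting `δ → 0` gives
equality. The exceptional set is null by Rademacher's theorem, and so is its image, since the graph
map is Lipschitz. -/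
theorem comap_graphMap_euclideanHausdorffMeasure (hν : ‖ν‖ = 1) (hι : ∀ y, ⟪ι y, ν⟫_ℝ = 0)
    (hg : LipschitzWith K g) :
    Measure.comap (graphMap ι ν g) (μHE[Module.finrank ℝ V]) =
      volume.withDensity fun x => ENNReal.ofReal (graphDensity (fderiv ℝ g x)) := by
  set m := Module.finrank ℝ V with hm
  have hemb := measurableEmbedding_graphMap hν hι hg
  set μ₁ := Measure.comap (graphMap ι ν g) (μHE[m]) with hμ₁
  set μ₂ := volume.withDensity fun x => ENNReal.ofReal (graphDensity (fderiv ℝ g x)) with hμ₂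
  have hnull : volume {x | DifferentiableAt ℝ g x}ᶜ = 0 := hg.ae_differentiableAt
  have h1null : μ₁ {x | DifferentiableAt ℝ g x}ᶜ = 0 := by
    rw [hμ₁, hemb.comap_apply]
    exact euclideanHausdorffMeasure_graphMap_image_eq_zero hν hg hnull
  have h2null : μ₂ {x | DifferentiableAt ℝ g x}ᶜ = 0 :=
    withDensity_absolutelyContinuous _ _ hnull
  have h12 : ∀ S, MeasurableSet S → ∀ δ : NNReal, 0 < δ → δ < 1 →
      μ₁ S ≤ ((1 + δ : NNReal) : ENNReal) ^ m * ENNReal.ofReal (1 + 2 * δ) * μ₂ S ∧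
      μ₂ S ≤ (((1 - δ)⁻¹ : NNReal) : ENNReal) ^ m * ENNReal.ofReal (1 + 2 * δ) * μ₁ S := by
    intro S hS δ hδ hδ1
    obtain ⟨P, p, hPd, hPm, hPU, hP⟩ := exists_partition_approximatesLinearOn_fderiv g hδ
    constructor
    · refine Measure.le_smul_of_partition hPd hPm (hPU ▸ h1null) (fun i T hT hTm => ?_) hS
      rw [hμ₁, hemb.comap_apply, hμ₂, withDensity_apply _ hTm, mul_assoc]
      refine (euclideanHausdorffMeasure_graphMap_image_le hν hι ((hP i).1.mono_set hT)).trans ?_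
      refine mul_le_mul' le_rfl ?_
      exact le_lintegral_graphDensity_of_norm_sub_le fun x hx => (hP i).2 x (hT hx)
    · refine Measure.le_smul_of_partition hPd hPm (hPU ▸ h2null) (fun i T hT hTm => ?_) hS
      rw [hμ₁, hemb.comap_apply, hμ₂, withDensity_apply _ hTm,
        mul_comm (_ ^ m), mul_assoc]
      refine (lintegral_graphDensity_le_of_norm_sub_le
        fun x hx => (hP i).2 x (hT hx)).trans ?_
      refine mul_le_mul' le_rfl ?_
      exact le_euclideanHausdorffMeasure_graphMap_image hν hι hδ1 ((hP i).1.mono_set hT)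
  have hev : ∀ᶠ δ : NNReal in 𝓝[>] 0, 0 < δ ∧ δ < 1 :=
    (eventually_mem_nhdsWithin).and
      (nhdsWithin_le_nhds (Iio_mem_nhds zero_lt_one))
  have hlim1 : Tendsto (fun δ : NNReal => ((1 + δ : NNReal) : ENNReal) ^ m *
      ENNReal.ofReal (1 + 2 * δ)) (𝓝[>] 0) (𝓝 1) := by
    have : ContinuousAt (fun δ : NNReal => (((1 + δ) ^ m * Real.toNNReal (1 + 2 * δ) : NNReal) :
      ENNReal)) 0 := by
      refine ENNReal.continuous_coe.continuousAt.comp ?_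
      fun_prop
    have h := this.tendsto.mono_left (nhdsWithin_le_nhds (s := Ioi 0))
    simpa [ENNReal.ofReal] using h
  have hlim2 : Tendsto (fun δ : NNReal => (((1 - δ)⁻¹ : NNReal) : ENNReal) ^ m *
      ENNReal.ofReal (1 + 2 * δ)) (𝓝[>] 0) (𝓝 1) := by
    have : ContinuousAt (fun δ : NNReal => (((1 - δ)⁻¹ ^ m * Real.toNNReal (1 + 2 * δ) : NNReal) :
      ENNReal)) 0 := by
      refine ENNReal.continuous_coe.continuousAt.comp ?_
      have h1 : ContinuousAt (fun δ : NNReal => (1 - δ)⁻¹) 0 :=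
        (continuousAt_const.sub continuousAt_id).inv₀ (by simp)
      exact (h1.pow m).mul (by fun_prop)
    have h := this.tendsto.mono_left (nhdsWithin_le_nhds (s := Ioi 0))
    simpa [ENNReal.ofReal, -inv_pow] using h
  ext S hS
  refine le_antisymm ?_ ?_
  · have h := ENNReal.Tendsto.mul_const (b := μ₂ S) hlim1 (Or.inl one_ne_zero)
    rw [one_mul] at h
    exact ge_of_tendsto h (hev.mono fun δ hδ => (h12 S hS δ hδ.1 hδ.2).1)
  · have h := ENNReal.Tendsto.mul_const (b := μ₁ S) hlim2 (Or.inl one_ne_zero)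
    rw [one_mul] at h
    exact ge_of_tendsto h (hev.mono fun δ hδ => (h12 S hS δ hδ.1 hδ.2).2)

theorem restrict_range_graphMap (hν : ‖ν‖ = 1) (hι : ∀ y, ⟪ι y, ν⟫_ℝ = 0)
    (hg : LipschitzWith K g) :
    (μHE[Module.finrank ℝ V] : Measure E).restrict (range (graphMap ι ν g)) =
      (volume.withDensity fun x => ENNReal.ofReal (graphDensity (fderiv ℝ g x))).map
        (graphMap ι ν g) := by
  rw [← comap_graphMap_euclideanHausdorffMeasure hν hι hg,
    (measurableEmbedding_graphMap hν hι hg).map_comap]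

theorem setIntegral_range_graphMap (hν : ‖ν‖ = 1) (hι : ∀ y, ⟪ι y, ν⟫_ℝ = 0)
    (hg : LipschitzWith K g) (F : E → ℝ) :
    ∫ x in range (graphMap ι ν g), F x ∂(μHE[Module.finrank ℝ V]) =
      ∫ y, graphDensity (fderiv ℝ g y) * F (graphMap ι ν g y) := by
  rw [restrict_range_graphMap hν hι hg, (measurableEmbedding_graphMap hν hι hg).integral_map,
    integral_withDensity_eq_integral_toReal_smul (measurable_graphDensity_fderiv g)
      (ae_of_all _ fun _ => ENNReal.ofReal_lt_top)]
  simp [ENNReal.toReal_ofReal, (graphDensity_pos _).le]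

end AreaFormulaMeasure

/-! ### The divergence theorem above a Lipschitz graph -/

section Epigraph

variable {V E : Type*} [NormedAddCommGroup V] [InnerProductSpace ℝ V] [NormedAddCommGroup E]
  [InnerProductSpace ℝ E] {ι : V →ₗᵢ[ℝ] E} {ν : E} {g : V → ℝ} {K : NNReal}

/-- Coordinates `(y, t) ↦ y + (g(y) + t) ν` in which the graph of `g` becomes a hyperplane. -/
def graphShear (ι : V →ₗᵢ[ℝ] E) (ν : E) (g : V → ℝ) (p : V × ℝ) : E := ι p.1 + (g p.1 + p.2) • ν

/-- The set of points above the graph of `g`. -/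
def openEpigraph (ι : V →ₗᵢ[ℝ] E) (ν : E) (g : V → ℝ) : Set E :=
  graphShear ι ν g '' (univ ×ˢ Ioi 0)

theorem add_smul_injective (hν : ‖ν‖ = 1) (hι : ∀ y, ⟪ι y, ν⟫_ℝ = 0) {y z : V} {s t : ℝ}
    (h : ι y + s • ν = ι z + t • ν) : y = z ∧ s = t := by
  have h0 : ι (y - z) + (s - t) • ν = 0 := by
    have : ι (y - z) + (s - t) • ν = (ι y + s • ν) - (ι z + t • ν) := by rw [map_sub]; module
    rw [this, h, sub_self]
  have h1 := norm_sq_add_smul hν hι (y - z) (s - t)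
  rw [h0, norm_zero] at h1
  have h2 : ‖y - z‖ ^ 2 = 0 := by nlinarith [sq_nonneg ‖y - z‖, sq_nonneg (s - t)]
  have h3 : (s - t) ^ 2 = 0 := by nlinarith [sq_nonneg ‖y - z‖, sq_nonneg (s - t)]
  exact ⟨sub_eq_zero.1 (norm_eq_zero.1 (by simpa using h2)), sub_eq_zero.1 (by simpa using h3)⟩

theorem graphShear_injective (hν : ‖ν‖ = 1) (hι : ∀ y, ⟪ι y, ν⟫_ℝ = 0) :
    Function.Injective (graphShear ι ν g) := by
  rintro ⟨y, s⟩ ⟨z, t⟩ h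
  obtain ⟨h1, h2⟩ := add_smul_injective hν hι h
  simp only at h1 h2
  subst h1
  simpa using h2

theorem continuous_graphShear (hg : Continuous g) : Continuous (graphShear ι ν g) := by
  unfold graphShear
  have := ι.continuous
  fun_prop

theorem graphShear_zero (y : V) : graphShear ι ν g (y, 0) = graphMap ι ν g y := by
  simp [graphShear, graphMap]

theorem preimage_openEpigraph (hν : ‖ν‖ = 1) (hι : ∀ y, ⟪ι y, ν⟫_ℝ = 0) :
    graphShear ι ν g ⁻¹' openEpigraph ι ν g = univ ×ˢ Ioi 0 :=
  preimage_image_eq _ (graphShear_injective hν hι)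

theorem add_smul_mem_openEpigraph {y : V} {s : ℝ} (h : g y < s) :
    ι y + s • ν ∈ openEpigraph ι ν g :=
  ⟨(y, s - g y), ⟨mem_univ _, sub_pos.2 h⟩, by simp [graphShear]⟩

theorem norm_le_norm_graphShear (hν : ‖ν‖ = 1) (hι : ∀ y, ⟪ι y, ν⟫_ℝ = 0) (p : V × ℝ) :
    ‖p.1‖ ≤ ‖graphShear ι ν g p‖ :=
  norm_le_norm_add_smul hν hι _ _

/-- A function with bounded derivative above a Lipschitz graph is Lipschitz on translates of the
graph. -/
theorem abs_sub_le_of_norm_fderiv_le {f : E → ℝ} {M : ℝ}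
    (hν : ‖ν‖ = 1) (hg : LipschitzWith K g) (hd : ∀ x ∈ openEpigraph ι ν g, DifferentiableAt ℝ f x)
    (hM : ∀ x ∈ openEpigraph ι ν g, ‖fderiv ℝ f x‖ ≤ M) {t : ℝ} (ht : 0 < t) (y z : V) :
    |f (graphShear ι ν g (y, t)) - f (graphShear ι ν g (z, t))| ≤ M * (3 * K + 1) * ‖y - z‖ := by
  have hM0 : 0 ≤ M := (norm_nonneg _).trans (hM _ ⟨(y, t), ⟨mem_univ _, ht⟩, rfl⟩)
  -- The mean value inequality along a segment that stays above the graph.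
  have seg : ∀ (y z : V) (s t : ℝ),
      (∀ θ ∈ Icc (0 : ℝ) 1, g (y + θ • (z - y)) < s + θ * (t - s)) →
      |f (ι z + t • ν) - f (ι y + s • ν)| ≤ M * (‖z - y‖ + |t - s|) := by
    intro y z s t h
    have hsub : segment ℝ (ι y + s • ν) (ι z + t • ν) ⊆ openEpigraph ι ν g := by
      rw [segment_eq_image']
      rintro _ ⟨θ, hθ, rfl⟩
      have e : ι y + s • ν + θ • (ι z + t • ν - (ι y + s • ν)) =
          ι (y + θ • (z - y)) + (s + θ * (t - s)) • ν := by
        simp only [map_add, map_smul, map_sub]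
        module
      simp only [e]
      exact add_smul_mem_openEpigraph (h θ hθ)
    have := Convex.norm_image_sub_le_of_norm_fderiv_le (𝕜 := ℝ) (fun x hx => hd x (hsub hx))
      (fun x hx => hM x (hsub hx)) (convex_segment _ _) (left_mem_segment ℝ _ _)
      (right_mem_segment ℝ _ _)
    rw [Real.norm_eq_abs] at this
    refine this.trans ?_
    gcongr
    have e : ι z + t • ν - (ι y + s • ν) = ι (z - y) + (t - s) • ν := by
      simp only [map_sub]; module
    rw [e]
    refine (norm_add_le _ _).trans ?_
    rw [ι.norm_map, norm_smul, hν, mul_one, Real.norm_eq_abs]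
  have hgK : ∀ a b : V, g a ≤ g b + K * ‖a - b‖ := fun a b => by
    have := hg.dist_le_mul a b
    rw [Real.dist_eq, dist_eq_norm] at this
    linarith [le_abs_self (g a - g b)]
  set r := ‖y - z‖ with hr
  have hr0 : 0 ≤ r := norm_nonneg _
  have hK0 : (0 : ℝ) ≤ K := K.2
  have hKr : 0 ≤ K * r := by positivity
  -- The straight segment between the two points may leave the epigraph. The detour goes up from `y`
  -- to the height `H`, horizontally to `z`, and down; the level `H` is above the graph along the
  -- whole horizontal leg. The lengths are at most `K r`, `r` and `2 K r`, which gives `(3K + 1) r`.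
  set H := g y + t + K * r with hH
  have hyz := hgK y z
  have hzy := hgK z y
  rw [norm_sub_rev, ← hr] at hzy
  rw [← hr] at hyz
  have s1 := seg y y (g y + t) H fun θ hθ => by
    have : 0 ≤ θ * (H - (g y + t)) := mul_nonneg hθ.1 (by rw [hH]; linarith)
    simp only [sub_self, smul_zero, add_zero]
    linarith
  have s2 := seg y z H H fun θ hθ => by
    have h1 := hgK (y + θ • (z - y)) y
    rw [add_sub_cancel_left, norm_smul, norm_sub_rev, ← hr, Real.norm_of_nonneg hθ.1] at h1
    have : θ * r ≤ 1 * r := by gcongr; exact hθ.2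
    have h2 : (K : ℝ) * (θ * r) ≤ K * (1 * r) := by gcongr
    simp only [sub_self, mul_zero, add_zero]
    linarith
  have s3 := seg z z (g z + t) H fun θ hθ => by
    have : 0 ≤ θ * (H - (g z + t)) := mul_nonneg hθ.1 (by rw [hH]; linarith)
    simp only [sub_self, smul_zero, add_zero]
    linarith
  rw [sub_self, norm_zero, zero_add] at s1 s3
  rw [sub_self, abs_zero, add_zero, norm_sub_rev, ← hr] at s2
  have a1 : |H - (g y + t)| ≤ K * r := by rw [hH, abs_le]; constructor <;> linarith
  have a3 : |H - (g z + t)| ≤ 2 * (K * r) := by rw [hH, abs_le]; constructor <;> linarith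
  have m1 := mul_le_mul_of_nonneg_left a1 hM0
  have m3 := mul_le_mul_of_nonneg_left a3 hM0
  have e : f (graphShear ι ν g (y, t)) - f (graphShear ι ν g (z, t)) =
      -(f (ι y + H • ν) - f (ι y + (g y + t) • ν)) - (f (ι z + H • ν) - f (ι y + H • ν)) +
      (f (ι z + H • ν) - f (ι z + (g z + t) • ν)) := by
    simp only [graphShear]; ring
  rw [e, abs_le]
  rw [abs_le] at s1 s2 s3
  constructor <;> nlinarith

theorem integral_Ioi_fderiv_graphShear {f : E → ℝ} {R : ℝ}
    (hν : ‖ν‖ = 1) (hι : ∀ y, ⟪ι y, ν⟫_ℝ = 0)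
    (hd : ∀ x ∈ openEpigraph ι ν g, DifferentiableAt ℝ f x) (hR : ∀ x, R < ‖x‖ → f x = 0) (y : V)
    (hc : ContinuousWithinAt (fun t => f (graphShear ι ν g (y, t))) (Ici 0) 0)
    (hi : IntegrableOn (fun t => fderiv ℝ f (graphShear ι ν g (y, t)) ν) (Ioi 0)) :
    ∫ t in Ioi (0 : ℝ), fderiv ℝ f (graphShear ι ν g (y, t)) ν = -f (graphMap ι ν g y) := by
  have h := integral_Ioi_of_hasDerivAt_of_tendsto (m := 0) hc (fun t ht => ?_) hi ?_
  · rw [h, graphShear_zero, zero_sub]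
  · have h1 : HasDerivAt (fun t : ℝ => graphShear ι ν g (y, t)) ν t := by
      have := (((hasDerivAt_id t).const_add (g y)).smul_const ν).const_add (ι y)
      simpa [graphShear] using this
    exact (hd _ ⟨(y, t), ⟨mem_univ _, ht⟩, rfl⟩).hasFDerivAt.comp_hasDerivAt t h1
  · refine tendsto_const_nhds.congr' ?_
    filter_upwards [eventually_gt_atTop (|R| + |g y|)] with t ht
    refine (hR _ ?_).symm
    have h1 := norm_sq_add_smul hν hι y (g y + t)
    have h2 : |g y + t| ≤ ‖graphShear ι ν g (y, t)‖ := by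
      refine abs_le_of_sq_le_sq ?_ (norm_nonneg _)
      change _ ≤ ‖ι y + (g y + t) • ν‖ ^ 2
      rw [h1]
      nlinarith [sq_nonneg ‖y‖]
    have h3 := le_abs_self (g y + t)
    have h4 := neg_abs_le (g y)
    have h5 := le_abs_self R
    linarith

theorem integrableOn_fderiv_openEpigraph [MeasurableSpace E] [BorelSpace E]
    [FiniteDimensional ℝ E] {f : E → ℝ} {M R : ℝ}
    (hU : MeasurableSet (openEpigraph ι ν g))
    (hM : ∀ x ∈ openEpigraph ι ν g, ‖fderiv ℝ f x‖ ≤ M) (hR : ∀ x, R < ‖x‖ → f x = 0) (e : E) :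
    IntegrableOn (fun x => fderiv ℝ f x e) (openEpigraph ι ν g) := by
  have h0 : ∀ x, R < ‖x‖ → fderiv ℝ f x e = 0 := fun x hx => by
    have : f =ᶠ[𝓝 x] fun _ => 0 :=
      eventually_of_mem ((isOpen_lt continuous_const continuous_norm).mem_nhds hx) hR
    rw [this.fderiv_eq]; simp
  have h1 : IntegrableOn (fun x => fderiv ℝ f x e)
      (openEpigraph ι ν g ∩ Metric.closedBall 0 R) := by
    refine Measure.integrableOn_of_bounded (M := M * ‖e‖) ?_
      (measurable_fderiv_apply_const ℝ f e).aestronglyMeasurable ?_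
    · exact measure_ne_top_of_subset inter_subset_right Metric.isBounded_closedBall.measure_lt_top.ne
    · refine (ae_restrict_iff' (hU.inter Metric.isClosed_closedBall.measurableSet)).2
        (ae_of_all _ fun x hx => ?_)
      exact (ContinuousLinearMap.le_opNorm _ _).trans (by gcongr; exact hM x hx.1)
  refine h1.of_forall_sdiff_eq_zero hU fun x hx => h0 x ?_
  by_contra hle
  exact hx.2 ⟨hx.1, by simpa using hle⟩

variable [MeasurableSpace V] [BorelSpace V] [FiniteDimensional ℝ V]

/-- By the chain rule and Rademacher's theorem the integrand is almost everywhere the derivative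
along `v` of the slice `y ↦ f (y + (g(y) + t) ν)`. This slice is Lipschitz with compact support, so
its derivative integrates to zero. Taking `t > 0` keeps it where `f` is differentiable. -/
theorem integral_fderiv_graphShear_horizontal {f : E → ℝ} {M R : ℝ}
    (hν : ‖ν‖ = 1) (hι : ∀ y, ⟪ι y, ν⟫_ℝ = 0) (hg : LipschitzWith K g)
    (hd : ∀ x ∈ openEpigraph ι ν g, DifferentiableAt ℝ f x)
    (hM : ∀ x ∈ openEpigraph ι ν g, ‖fderiv ℝ f x‖ ≤ M) (hR : ∀ x, R < ‖x‖ → f x = 0)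
    {t : ℝ} (ht : 0 < t) (v : V) :
    ∫ y, (fderiv ℝ f (graphShear ι ν g (y, t)) (ι v) +
      fderiv ℝ f (graphShear ι ν g (y, t)) ν * fderiv ℝ g y v) = 0 := by
  set F : V → ℝ := fun y => f (graphShear ι ν g (y, t)) with hF
  have hM0 : 0 ≤ M := (norm_nonneg _).trans (hM _ ⟨(0, t), ⟨mem_univ _, ht⟩, rfl⟩)
  have hFL : LipschitzWith (M * (3 * K + 1)).toNNReal F := by
    refine LipschitzWith.of_dist_le_mul fun y z => ?_
    rw [Real.coe_toNNReal _ (by positivity), Real.dist_eq, dist_eq_norm]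
    exact abs_sub_le_of_norm_fderiv_le hν hg hd hM ht y z
  have hFc : HasCompactSupport F := by
    refine HasCompactSupport.intro (isCompact_closedBall (0 : V) R) fun y hy => hR _ ?_
    rw [mem_closedBall_zero_iff, not_le] at hy
    exact hy.trans_le (norm_le_norm_graphShear hν hι (y, t))
  -- Integration by parts against the constant function `1`.
  have h := LipschitzWith.integral_lineDeriv_mul_eq (μ := volume)
    (LipschitzWith.const (α := V) (1 : ℝ)) hFL hFc (-v)
  have h0 : ∀ x w, lineDeriv ℝ (fun _ : V => (1 : ℝ)) x w = 0 := fun x w => by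
    simp [lineDeriv]
  simp only [h0, zero_mul, integral_zero, neg_neg, mul_one] at h
  rw [h]
  refine integral_congr_ae ?_
  filter_upwards [hg.ae_differentiableAt] with y hy
  have h1 : HasFDerivAt (fun z : V => graphShear ι ν g (z, t))
      (ι.toContinuousLinearMap + (fderiv ℝ g y).smulRight ν) y :=
    ι.toContinuousLinearMap.hasFDerivAt.add ((hy.hasFDerivAt.add_const t).smul_const ν)
  have h2 := (hd _ ⟨(y, t), ⟨mem_univ _, ht⟩, rfl⟩).hasFDerivAt.comp y h1
  have h3 := (h2.hasLineDerivAt v).lineDeriv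
  change _ = lineDeriv ℝ (f ∘ fun z : V => graphShear ι ν g (z, t)) y v
  rw [h3]
  simp [mul_comm]

variable [MeasurableSpace E] [BorelSpace E]

theorem measurableEmbedding_graphShear (hν : ‖ν‖ = 1) (hι : ∀ y, ⟪ι y, ν⟫_ℝ = 0)
    (hg : Continuous g) : MeasurableEmbedding (graphShear ι ν g) :=
  (continuous_graphShear hg).measurableEmbedding (graphShear_injective hν hι)

theorem measurableSet_openEpigraph (hν : ‖ν‖ = 1) (hι : ∀ y, ⟪ι y, ν⟫_ℝ = 0)
    (hg : Continuous g) : MeasurableSet (openEpigraph ι ν g) :=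
  (measurableEmbedding_graphShear hν hι hg).measurableSet_image.2
    (MeasurableSet.univ.prod measurableSet_Ioi)

variable [FiniteDimensional ℝ E]

theorem measurePreserving_add_smul (hν : ‖ν‖ = 1) (hι : ∀ y, ⟪ι y, ν⟫_ℝ = 0)
    (hdim : Module.finrank ℝ E = Module.finrank ℝ V + 1) :
    MeasurePreserving (fun p : V × ℝ => ι p.1 + p.2 • ν) (volume.prod volume) volume := by
  set L : WithLp 2 (V × ℝ) →ₗᵢ[ℝ] E :=
    { toFun := fun p => ι p.fst + p.snd • ν
      map_add' := fun p q => by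
        simp only [WithLp.add_fst, WithLp.add_snd, map_add]; module
      map_smul' := fun c p => by
        simp only [WithLp.smul_fst, WithLp.smul_snd, map_smul, RingHom.id_apply, smul_eq_mul]
        module
      norm_map' := fun p => by
        refine (sq_eq_sq₀ (norm_nonneg _) (norm_nonneg _)).1 ?_
        change ‖ι p.fst + p.snd • ν‖ ^ 2 = _
        rw [norm_sq_add_smul hν hι, WithLp.prod_norm_sq_eq_of_L2, Real.norm_eq_abs, sq_abs] } with hL
  have hfr : Module.finrank ℝ (WithLp 2 (V × ℝ)) = Module.finrank ℝ E := by
    rw [(WithLp.linearEquiv 2 ℝ (V × ℝ)).finrank_eq, Module.finrank_prod, Module.finrank_self, hdim]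
  have h1 := (L.toLinearIsometryEquiv hfr).measurePreserving
  exact h1.comp (WithLp.volume_preserving_toLp V ℝ)

theorem measurePreserving_graphShear (hν : ‖ν‖ = 1) (hι : ∀ y, ⟪ι y, ν⟫_ℝ = 0)
    (hdim : Module.finrank ℝ E = Module.finrank ℝ V + 1) (hg : Continuous g) :
    MeasurePreserving (graphShear ι ν g) (volume.prod volume) volume := by
  have h1 : MeasurePreserving (fun p : V × ℝ => (p.1, g p.1 + p.2)) (volume.prod volume)
      (volume.prod volume) := by
    refine (MeasurePreserving.id _).skew_product (g := fun y t => g y + t) ?_ ?_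
    · have := hg.measurable
      unfold Function.uncurry; fun_prop
    · exact ae_of_all _ fun y => (measurePreserving_add_left volume (g y)).map_eq
  exact (measurePreserving_add_smul hν hι hdim).comp h1

/-- In sheared coordinates, which preserve volume, `∂_ν f` integrates along vertical lines to `-f`
on the graph. The derivative along `ι v` is a slice derivative, of integral zero, minus `∂_ν f · ∂_v
g`, and the latter is again computed by vertical integration. The weight `∂_v g - s` is the area
density times the component of the normal along `ι v + s ν` (`graphDensity_mul_inner_graphNormal`).
-/
theorem setIntegral_fderiv_openEpigraph {f : E → ℝ} {M R : ℝ}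
    (hν : ‖ν‖ = 1) (hι : ∀ y, ⟪ι y, ν⟫_ℝ = 0)
    (hdim : Module.finrank ℝ E = Module.finrank ℝ V + 1) (hg : LipschitzWith K g)
    (hd : ∀ x ∈ openEpigraph ι ν g, DifferentiableAt ℝ f x)
    (hM : ∀ x ∈ openEpigraph ι ν g, ‖fderiv ℝ f x‖ ≤ M) (hR : ∀ x, R < ‖x‖ → f x = 0)
    (hc : ∀ y, ContinuousWithinAt (fun t => f (graphShear ι ν g (y, t))) (Ici 0) 0)
    (v : V) (s : ℝ) :
    ∫ x in openEpigraph ι ν g, fderiv ℝ f x (ι v + s • ν) =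
      ∫ y, (fderiv ℝ g y v - s) * f (graphMap ι ν g y) := by
  set Ψ := graphShear ι ν g with hΨ
  have hgc := hg.continuous
  have hU := measurableSet_openEpigraph hν hι hgc
  have hemb := measurableEmbedding_graphShear hν hι hgc
  have hmp := measurePreserving_graphShear hν hι hdim hgc
  set τ : Measure ℝ := volume.restrict (Ioi (0 : ℝ)) with hτ
  have hprod : (volume.prod volume).restrict (Ψ ⁻¹' openEpigraph ι ν g) =
      (volume : Measure V).prod τ := by
    rw [hΨ, preimage_openEpigraph hν hι, ← Measure.prod_restrict, Measure.restrict_univ]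
  have hint : ∀ e : E, Integrable (fun p : V × ℝ => fderiv ℝ f (Ψ p) e) (volume.prod τ) := by
    intro e
    have := (hmp.integrableOn_comp_preimage hemb).2
      (integrableOn_fderiv_openEpigraph hU hM hR e)
    rwa [IntegrableOn, hprod] at this
  have hchange : ∀ e : E, ∫ x in openEpigraph ι ν g, fderiv ℝ f x e =
      ∫ p, fderiv ℝ f (Ψ p) e ∂((volume : Measure V).prod τ) := by
    intro e
    rw [← hmp.setIntegral_preimage_emb hemb, hprod]
  have hgb : ∀ y : V, ‖fderiv ℝ g y v‖ ≤ K * ‖v‖ := fun y =>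
    (ContinuousLinearMap.le_opNorm _ _).trans (by gcongr; exact norm_fderiv_le_of_lipschitz ℝ hg)
  have hint2 : Integrable (fun p : V × ℝ => fderiv ℝ f (Ψ p) ν * fderiv ℝ g p.1 v)
      (volume.prod τ) :=
    (hint ν).mul_bdd (c := K * ‖v‖)
      ((measurable_fderiv_apply_const ℝ g v).comp measurable_fst).aestronglyMeasurable
      (ae_of_all _ fun p => hgb p.1)
  have hvert : ∀ᵐ y : V, ∫ t, fderiv ℝ f (Ψ (y, t)) ν ∂τ = -f (graphMap ι ν g y) := by
    filter_upwards [(hint ν).prod_right_ae] with y hy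
    exact integral_Ioi_fderiv_graphShear hν hι hd hR y (hc y) hy
  have hI1 : ∫ p, fderiv ℝ f (Ψ p) ν ∂((volume : Measure V).prod τ) =
      ∫ y, -f (graphMap ι ν g y) := by
    rw [integral_prod _ (hint ν)]
    exact integral_congr_ae hvert
  have hI2 : ∫ p : V × ℝ, fderiv ℝ f (Ψ p) ν * fderiv ℝ g p.1 v ∂(volume.prod τ) =
      ∫ y, -f (graphMap ι ν g y) * fderiv ℝ g y v := by
    rw [integral_prod _ hint2]
    refine integral_congr_ae ?_
    filter_upwards [hvert] with y hy
    rw [integral_mul_const, hy]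
  have hint3 : Integrable (fun p => fderiv ℝ f (Ψ p) (ι v) + fderiv ℝ f (Ψ p) ν * fderiv ℝ g p.1 v)
      (volume.prod τ) := (hint _).add hint2
  have hI3 : ∫ p, fderiv ℝ f (Ψ p) (ι v) ∂((volume : Measure V).prod τ) =
      -∫ p : V × ℝ, fderiv ℝ f (Ψ p) ν * fderiv ℝ g p.1 v ∂(volume.prod τ) := by
    rw [← add_eq_zero_iff_eq_neg, ← integral_add (hint _) hint2,
      integral_prod_symm _ hint3]
    refine integral_eq_zero_of_ae ?_
    filter_upwards [ae_restrict_mem measurableSet_Ioi] with t ht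
    exact integral_fderiv_graphShear_horizontal hν hι hg hd hM hR ht v
  have hf1 : Integrable fun y => -f (graphMap ι ν g y) :=
    (hint ν).integral_prod_left.congr hvert
  have hf2 : Integrable fun y => -f (graphMap ι ν g y) * fderiv ℝ g y v :=
    hf1.mul_bdd (c := K * ‖v‖) (measurable_fderiv_apply_const ℝ g v).aestronglyMeasurable
      (ae_of_all _ hgb)
  have hf3 : Integrable fun y => -(-f (graphMap ι ν g y) * fderiv ℝ g y v) := hf2.neg
  rw [hchange]
  simp only [map_add, map_smul, smul_eq_mul]
  rw [integral_add (hint _) ((hint ν).const_mul s), integral_const_mul, hI3, hI2, hI1,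
    ← integral_const_mul, ← integral_neg, ← integral_add hf3 (hf1.const_mul s)]
  congr 1 with y
  ring

end Epigraph

/-! ### Graph patches and the outward unit normal -/

section GraphHeight

variable {V E : Type*} [NormedAddCommGroup V] [InnerProductSpace ℝ V] [NormedAddCommGroup E]
  [InnerProductSpace ℝ E] [FiniteDimensional ℝ V] {ι : V →ₗᵢ[ℝ] E} {ν : E} {g : V → ℝ} {K : NNReal}

/-- The downward unit normal to the graph of `g`. -/
noncomputable def graphNormal (ι : V →ₗᵢ[ℝ] E) (ν : E) (g : V → ℝ) (v : V) : E :=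
  (graphDensity (fderiv ℝ g v))⁻¹ • (ι (∇ g v) - ν)

theorem norm_graphNormal (hν : ‖ν‖ = 1) (hι : ∀ y, ⟪ι y, ν⟫_ℝ = 0) (v : V) :
    ‖graphNormal ι ν g v‖ = 1 := by
  have h1 : ‖ι (∇ g v) - ν‖ = graphDensity (fderiv ℝ g v) := by
    have h2 := norm_sq_add_smul hν hι (∇ g v) (-1)
    rw [neg_one_smul, ← sub_eq_add_neg] at h2
    have h3 : ‖∇ g v‖ = ‖fderiv ℝ g v‖ := by simp [gradient]
    rw [graphDensity, ← h3, ← Real.sqrt_sq (norm_nonneg (ι (∇ g v) - ν)), h2]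
    congr 1; ring
  rw [graphNormal, norm_smul, h1, norm_inv, Real.norm_of_nonneg (graphDensity_pos _).le]
  exact inv_mul_cancel₀ (graphDensity_pos _).ne'

theorem graphDensity_mul_inner_graphNormal (hν : ‖ν‖ = 1) (hι : ∀ y, ⟪ι y, ν⟫_ℝ = 0)
    (v w : V) (s : ℝ) :
    graphDensity (fderiv ℝ g v) * ⟪graphNormal ι ν g v, ι w + s • ν⟫_ℝ = fderiv ℝ g v w - s := by
  rw [graphNormal, inner_smul_left, RCLike.conj_to_real,
    mul_inv_cancel_left₀ (graphDensity_pos _).ne', inner_sub_left, inner_add_right, inner_add_right,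
    ι.inner_map_map, inner_smul_right, inner_smul_right, hι, real_inner_comm (ι w), hι,
    real_inner_self_eq_norm_sq, hν, inner_gradient_left]
  ring

variable [FiniteDimensional ℝ E]

theorem exists_eq_add_smul (hν : ‖ν‖ = 1) (hι : ∀ y, ⟪ι y, ν⟫_ℝ = 0)
    (hdim : Module.finrank ℝ E = Module.finrank ℝ V + 1) (e : E) :
    ∃ (v : V) (s : ℝ), e = ι v + s • ν := by
  set L : V × ℝ →ₗ[ℝ] E := ι.toLinearMap.coprod (LinearMap.toSpanSingleton ℝ E ν) with hL
  have hinj : Function.Injective L := by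
    rintro ⟨v, s⟩ ⟨w, t⟩ h
    obtain ⟨h1, h2⟩ := add_smul_injective hν hι (y := v) (z := w) (s := s) (t := t)
      (by simpa [hL] using h)
    rw [h1, h2]
  have hfr : Module.finrank ℝ (V × ℝ) = Module.finrank ℝ E := by
    rw [Module.finrank_prod, Module.finrank_self, hdim]
  obtain ⟨⟨v, s⟩, h⟩ := (LinearMap.injective_iff_surjective_of_finrank_eq_finrank hfr).1 hinj e
  exact ⟨v, s, by simpa [hL] using h.symm⟩

/-- The signed height of a point above the graph of `g`. -/
noncomputable def graphHeight (ι : V →ₗᵢ[ℝ] E) (ν : E) (g : V → ℝ) (y : E) : ℝ :=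
  ⟪ν, y⟫_ℝ - g (ContinuousLinearMap.adjoint ι.toContinuousLinearMap y)

theorem adjoint_add_smul (hι : ∀ y, ⟪ι y, ν⟫_ℝ = 0) (v : V) (s : ℝ) :
    ContinuousLinearMap.adjoint ι.toContinuousLinearMap (ι v + s • ν) = v := by
  refine ext_inner_right ℝ fun w => ?_
  rw [ContinuousLinearMap.adjoint_inner_left]
  change ⟪ι v + s • ν, ι w⟫_ℝ = _
  rw [inner_add_left, inner_smul_left, ι.inner_map_map, real_inner_comm (ι w) ν, hι, mul_zero,
    add_zero]

theorem graphHeight_add_smul (hν : ‖ν‖ = 1) (hι : ∀ y, ⟪ι y, ν⟫_ℝ = 0) (v : V) (s : ℝ) :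
    graphHeight ι ν g (ι v + s • ν) = s - g v := by
  rw [graphHeight, adjoint_add_smul hι, inner_add_right, inner_smul_right, real_inner_comm, hι,
    real_inner_self_eq_norm_sq, hν]
  ring

theorem continuous_graphHeight (hg : Continuous g) : Continuous (graphHeight ι ν g) := by
  unfold graphHeight
  fun_prop

theorem mem_openEpigraph_iff (hν : ‖ν‖ = 1) (hι : ∀ y, ⟪ι y, ν⟫_ℝ = 0)
    (hdim : Module.finrank ℝ E = Module.finrank ℝ V + 1) {y : E} :
    y ∈ openEpigraph ι ν g ↔ 0 < graphHeight ι ν g y := by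
  constructor
  · rintro ⟨⟨v, t⟩, ⟨-, ht⟩, rfl⟩
    have ht' : 0 < t := ht
    rw [graphShear, graphHeight_add_smul hν hι]
    simpa using ht'
  · obtain ⟨v, s, rfl⟩ := exists_eq_add_smul hν hι hdim y
    rw [graphHeight_add_smul hν hι, sub_pos]
    exact add_smul_mem_openEpigraph

theorem mem_range_graphMap_iff (hν : ‖ν‖ = 1) (hι : ∀ y, ⟪ι y, ν⟫_ℝ = 0)
    (hdim : Module.finrank ℝ E = Module.finrank ℝ V + 1) {y : E} :
    y ∈ range (graphMap ι ν g) ↔ graphHeight ι ν g y = 0 := by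
  constructor
  · rintro ⟨v, rfl⟩
    rw [graphMap, graphHeight_add_smul hν hι, sub_self]
  · obtain ⟨v, s, rfl⟩ := exists_eq_add_smul hν hι hdim y
    rw [graphHeight_add_smul hν hι, sub_eq_zero]
    rintro rfl
    exact ⟨v, rfl⟩

theorem measurable_graphNormal [MeasurableSpace V] [BorelSpace V] [MeasurableSpace E]
    [BorelSpace E] : Measurable (graphNormal ι ν g) := by
  have h1 : Measurable (∇ g) := by
    unfold gradient
    exact (LinearIsometryEquiv.continuous _).measurable.comp (measurable_fderiv ℝ g)
  have h2 : Measurable fun v => graphDensity (fderiv ℝ g v) :=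
    continuous_graphDensity.measurable.comp (measurable_fderiv ℝ g)
  exact h2.inv.smul ((ι.continuous.measurable.comp h1).sub_const ν)

end GraphHeight

/-! ### The outward normal and surface measure in graph coordinates. -/

section Normal

variable {d : ℕ} {Ω : Set (Eucl d)}

/-- Along the ray `x + s (n₂ - n₁)` the `n₂` component grows and the `n₁` component decreases, both
at rate `‖w‖²/2`. So for small `s` the normal `n₂` excludes points in `Ω` and `n₁` excludes points
outside; `ε = ‖w‖/4` is half of the available margin. -/
theorem IsOutwardUnitNormal.unique {x n₁ n₂ : Eucl d} (h₁ : IsOutwardUnitNormal Ω x n₁)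
    (h₂ : IsOutwardUnitNormal Ω x n₂) : n₁ = n₂ := by
  by_contra hne
  set w := n₂ - n₁ with hw
  have hw0 : 0 < ‖w‖ := norm_pos_iff.2 (sub_ne_zero.2 (Ne.symm hne))
  have hww : ‖w‖ ^ 2 = 2 - 2 * ⟪n₁, n₂⟫_ℝ := by
    rw [hw, norm_sub_sq_real, h₁.1, h₂.1, real_inner_comm]; ring
  have e2 : ⟪n₂, w⟫_ℝ = ‖w‖ ^ 2 / 2 := by
    rw [hww, hw, inner_sub_right, real_inner_self_eq_norm_sq, h₂.1, real_inner_comm]; ring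
  have e1 : ⟪n₁, w⟫_ℝ = -(‖w‖ ^ 2 / 2) := by
    rw [hww, hw, inner_sub_right, real_inner_self_eq_norm_sq, h₁.1]; ring
  have ht : Tendsto (fun s : ℝ => x + s • w) (𝓝[>] 0) (𝓝 x) := by
    have : Continuous fun s : ℝ => x + s • w := by fun_prop
    simpa using (this.tendsto 0).mono_left nhdsWithin_le_nhds
  obtain ⟨s, ⟨q1, q2⟩, hs⟩ := (((ht.eventually (h₁.2 (‖w‖ / 4) (by positivity))).and
    (ht.eventually (h₂.2 (‖w‖ / 4) (by positivity)))).and self_mem_nhdsWithin).exists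
  have hs' : 0 < s := hs
  rw [add_sub_cancel_left, inner_smul_right, norm_smul, Real.norm_of_nonneg hs'.le, e1] at q1
  rw [add_sub_cancel_left, inner_smul_right, norm_smul, Real.norm_of_nonneg hs'.le, e2] at q2
  have hp : 0 < s * ‖w‖ ^ 2 := by positivity
  by_cases hx : x + s • w ∈ Ω
  · have := q2.1 hx
    nlinarith
  · have := q1.2 hx
    nlinarith

theorem IsOutwardUnitNormal.outwardNormal_eq {x n : Eucl d} (h : IsOutwardUnitNormal Ω x n) :
    outwardNormal Ω x = n := by
  have h' : ∃ n, IsOutwardUnitNormal Ω x n := ⟨n, h⟩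
  rw [outwardNormal, dif_pos h']
  exact h'.choose_spec.unique h

theorem norm_outwardNormal_le (x : Eucl d) : ‖outwardNormal Ω x‖ ≤ 1 := by
  rw [outwardNormal]
  split_ifs with h
  · exact h.choose_spec.1.le
  · simp

/-- Inside the ball of radius `r` about `x`, the set `Ω` is the epigraph of `g`. -/
structure IsGraphPatch (Ω : Set (Eucl d)) (x : Eucl d) (r : ℝ) (ι : Eucl (d - 1) →ₗᵢ[ℝ] Eucl d)
    (ν : Eucl d) (g : Eucl (d - 1) → ℝ) (K : NNReal) : Prop where
  pos : 0 < d
  norm_eq_one : ‖ν‖ = 1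
  inner_eq_zero : ∀ y, ⟪ι y, ν⟫_ℝ = 0
  lipschitzWith : LipschitzWith K g
  isOpen : IsOpen Ω
  mem_iff : ∀ y ∈ Metric.ball x r, (y ∈ Ω ↔ 0 < graphHeight ι ν g y)

/-- An orthonormal basis of `ν^⊥` identifies the hyperplane with `ℝ^(d-1)` and turns `γ` into a
function of `d - 1` variables; `0 < d` ensures that the truncated subtraction is the true dimension.
-/
theorem IsBoundedLipschitzDomain.exists_isGraphPatch (hd : 0 < d)
    (hΩ : IsBoundedLipschitzDomain Ω) {x : Eucl d} (hx : x ∈ frontier Ω) :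
    ∃ r > 0, ∃ ι ν g K, IsGraphPatch Ω x r ι ν g K := by
  obtain ⟨ν, γ, K, r, hν, hγ, hr, h⟩ := hΩ.locally_epigraph x hx
  have hν0 : ν ≠ 0 := fun h0 => by simp [h0] at hν
  have : Fact (Module.finrank ℝ (Eucl d) = (d - 1) + 1) := ⟨by simp; omega⟩
  set ι : Eucl (d - 1) →ₗᵢ[ℝ] Eucl d := (ℝ ∙ ν)ᗮ.subtypeₗᵢ.comp
    (OrthonormalBasis.fromOrthogonalSpanSingleton (𝕜 := ℝ) (d - 1)
      hν0).repr.symm.toLinearIsometry with hι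
  have hι0 : ∀ y, ⟪ι y, ν⟫_ℝ = 0 := fun y => by
    rw [real_inner_comm]
    exact Submodule.mem_orthogonal_singleton_iff_inner_right.1 (Subtype.coe_prop _)
  refine ⟨r, hr, ι, ν, γ ∘ ι, K * 1, hd, hν, hι0, hγ.comp ι.lipschitz, hΩ.isOpen, fun y hy => ?_⟩
  obtain ⟨v, s, rfl⟩ := exists_eq_add_smul (ι := ι) hν hι0 (by simp; omega) y
  have hs : ⟪ν, ι v + s • ν⟫_ℝ = s := by
    rw [inner_add_right, inner_smul_right, real_inner_comm, hι0, real_inner_self_eq_norm_sq, hν]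
    ring
  rw [h _ hy, graphHeight_add_smul hν hι0, hs, add_sub_cancel_right, sub_pos]
  rfl

namespace IsGraphPatch

variable {x : Eucl d} {r : ℝ} {ι : Eucl (d - 1) →ₗᵢ[ℝ] Eucl d} {ν : Eucl d}
  {g : Eucl (d - 1) → ℝ} {K : NNReal}

theorem finrank_eq (h : IsGraphPatch Ω x r ι ν g K) :
    Module.finrank ℝ (Eucl d) = Module.finrank ℝ (Eucl (d - 1)) + 1 := by
  have := h.pos
  simp; omega

theorem mem_iff_mem_openEpigraph (h : IsGraphPatch Ω x r ι ν g K) {y : Eucl d}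
    (hy : y ∈ Metric.ball x r) : y ∈ Ω ↔ y ∈ openEpigraph ι ν g := by
  rw [mem_openEpigraph_iff h.norm_eq_one h.inner_eq_zero h.finrank_eq, h.mem_iff y hy]

theorem mem_frontier_iff (h : IsGraphPatch Ω x r ι ν g K) {y : Eucl d}
    (hy : y ∈ Metric.ball x r) : y ∈ frontier Ω ↔ y ∈ range (graphMap ι ν g) := by
  have hball : Metric.ball x r ∈ 𝓝 y := Metric.isOpen_ball.mem_nhds hy
  have hc := continuous_graphHeight (ι := ι) (ν := ν) h.lipschitzWith.continuous
  rw [mem_range_graphMap_iff h.norm_eq_one h.inner_eq_zero h.finrank_eq, h.isOpen.frontier_eq,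
    Set.mem_sdiff, h.mem_iff y hy, not_lt]
  constructor
  · rintro ⟨h1, h2⟩
    refine le_antisymm h2 (le_of_not_gt fun h3 => ?_)
    obtain ⟨z, ⟨hz1, hz2⟩, hz⟩ := mem_closure_iff_nhds.1 h1 _
      (inter_mem hball ((isOpen_gt' (0 : ℝ)).preimage hc |>.mem_nhds h3))
    exact (((h.mem_iff z hz1).1 hz).trans hz2).false
  · intro h0
    refine ⟨?_, h0.le⟩
    obtain ⟨v, s, rfl⟩ := exists_eq_add_smul (ι := ι) h.norm_eq_one h.inner_eq_zero h.finrank_eq y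
    have ht : Tendsto (fun t : ℝ => ι v + (s + t) • ν) (𝓝[>] 0) (𝓝 (ι v + s • ν)) := by
      have : Continuous fun t : ℝ => ι v + (s + t) • ν := by fun_prop
      simpa using (this.tendsto 0).mono_left nhdsWithin_le_nhds
    refine mem_closure_of_tendsto ht ?_
    filter_upwards [ht.eventually hball, self_mem_nhdsWithin] with t ht1 ht2
    have ht2' : 0 < t := ht2
    rw [graphHeight_add_smul h.norm_eq_one h.inner_eq_zero] at h0
    rw [h.mem_iff _ ht1, graphHeight_add_smul h.norm_eq_one h.inner_eq_zero]
    linarith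

/-- For a nearby point with base `w` and height `s`, the density times its normal component is
`∂_{w-v} g - (s - g v)`. Differentiability replaces the first term by `g w - g v` up to `ε ‖w - v‖`,
leaving `g w - s`, whose sign tells the two sides apart. Dividing by the density, which is at least
`1`, preserves the error bound. -/
theorem isOutwardUnitNormal (h : IsGraphPatch Ω x r ι ν g K) {v : Eucl (d - 1)}
    (hv : graphMap ι ν g v ∈ Metric.ball x r) (hg : DifferentiableAt ℝ g v) :
    IsOutwardUnitNormal Ω (graphMap ι ν g v) (graphNormal ι ν g v) := by
  refine ⟨norm_graphNormal h.norm_eq_one h.inner_eq_zero v, fun ε hε => ?_⟩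
  have hball : Metric.ball x r ∈ 𝓝 (graphMap ι ν g v) := Metric.isOpen_ball.mem_nhds hv
  set P := ContinuousLinearMap.adjoint ι.toContinuousLinearMap with hP
  have hPι : ∀ w s, P (ι w + s • ν) = w := adjoint_add_smul h.inner_eq_zero
  have ho := (hasFDerivAt_iff_isLittleO.1 hg.hasFDerivAt).def hε
  have hPt : Tendsto P (𝓝 (graphMap ι ν g v)) (𝓝 v) := by
    have := P.continuous.tendsto (graphMap ι ν g v)
    rwa [graphMap, hPι] at this
  filter_upwards [hPt.eventually ho, hball] with z hz hzb
  obtain ⟨w, s, rfl⟩ := exists_eq_add_smul (ι := ι) h.norm_eq_one h.inner_eq_zero h.finrank_eq z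
  rw [hPι] at hz
  have e : ι w + s • ν - graphMap ι ν g v = ι (w - v) + (s - g v) • ν := by
    rw [graphMap, map_sub]; module
  have hD := one_le_graphDensity (fderiv ℝ g v)
  have hN := graphDensity_mul_inner_graphNormal (g := g) h.norm_eq_one h.inner_eq_zero v (w - v)
    (s - g v)
  have hle : ‖w - v‖ ≤ ‖ι (w - v) + (s - g v) • ν‖ :=
    norm_le_norm_add_smul h.norm_eq_one h.inner_eq_zero _ _
  rw [h.mem_iff _ hzb, graphHeight_add_smul h.norm_eq_one h.inner_eq_zero, e, sub_pos, not_lt]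
  rw [Real.norm_eq_abs, abs_le] at hz
  set D := graphDensity (fderiv ℝ g v)
  set m := ⟪graphNormal ι ν g v, ι (w - v) + (s - g v) • ν⟫_ℝ
  set ρ := ‖ι (w - v) + (s - g v) • ν‖
  have hρ : 0 ≤ ε * ρ := by positivity
  have hερ : ε * ‖w - v‖ ≤ ε * ρ := by gcongr
  have hDρ : ε * ρ ≤ D * (ε * ρ) := le_mul_of_one_le_left hρ hD
  have hD0 : 0 < D := graphDensity_pos _
  constructor
  · intro hs
    refine le_of_mul_le_mul_left (a := D) ?_ hD0
    linarith
  · intro hs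
    refine le_of_mul_le_mul_left (a := D) ?_ hD0
    linarith

theorem ae_outwardNormal_eq (h : IsGraphPatch Ω x r ι ν g K) :
    ∀ᵐ v, graphMap ι ν g v ∈ Metric.ball x r →
      outwardNormal Ω (graphMap ι ν g v) = graphNormal ι ν g v := by
  filter_upwards [h.lipschitzWith.ae_differentiableAt] with v hv hb
  exact (h.isOutwardUnitNormal hb hv).outwardNormal_eq

theorem restrict_range (h : IsGraphPatch Ω x r ι ν g K) :
    (Measure.euclideanHausdorffMeasure (d - 1)).restrict (range (graphMap ι ν g)) =
      (volume.withDensity fun v => ENNReal.ofReal (graphDensity (fderiv ℝ g v))).map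
        (graphMap ι ν g) := by
  have := restrict_range_graphMap h.norm_eq_one h.inner_eq_zero h.lipschitzWith
  rwa [finrank_euclideanSpace_fin] at this

theorem surfaceMeasure_restrict (h : IsGraphPatch Ω x r ι ν g K) :
    (surfaceMeasure Ω).restrict (Metric.ball x r) =
      ((volume.withDensity fun v => ENNReal.ofReal (graphDensity (fderiv ℝ g v))).map
        (graphMap ι ν g)).restrict (Metric.ball x r) := by
  rw [← h.restrict_range, surfaceMeasure, Measure.restrict_restrict measurableSet_ball,
    Measure.restrict_restrict measurableSet_ball]
  congr 1
  ext y
  simp only [mem_inter_iff]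
  exact and_congr_right fun hy => h.mem_frontier_iff hy

theorem surfaceMeasure_ball_lt_top (h : IsGraphPatch Ω x r ι ν g K) :
    surfaceMeasure Ω (Metric.ball x r) < ⊤ := by
  have hemb := measurableEmbedding_graphMap h.norm_eq_one h.inner_eq_zero h.lipschitzWith
  have hpre : MeasurableSet (graphMap ι ν g ⁻¹' Metric.ball x r) :=
    hemb.measurable measurableSet_ball
  rw [← Measure.restrict_apply_self, h.surfaceMeasure_restrict, Measure.restrict_apply_self,
    hemb.map_apply, withDensity_apply _ hpre]
  refine (setLIntegral_mono (g := fun _ => ENNReal.ofReal (Real.sqrt (1 + (K : ℝ) ^ 2)))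
    measurable_const fun v _ => ?_).trans_lt ?_
  · refine ENNReal.ofReal_le_ofReal (Real.sqrt_le_sqrt ?_)
    gcongr
    exact norm_fderiv_le_of_lipschitz ℝ h.lipschitzWith
  · rw [setLIntegral_const]
    refine ENNReal.mul_lt_top ENNReal.ofReal_lt_top ?_
    refine (measure_mono (t := Metric.closedBall 0 (‖x‖ + r)) fun v hv => ?_).trans_lt
      measure_closedBall_lt_top
    rw [mem_closedBall_zero_iff]
    have h1 : ‖graphMap ι ν g v - x‖ < r := mem_ball_iff_norm.1 hv
    have h2 : ‖v‖ ≤ ‖graphMap ι ν g v‖ :=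
      norm_le_norm_add_smul h.norm_eq_one h.inner_eq_zero v (g v)
    have h3 := norm_le_norm_add_norm_sub' (graphMap ι ν g v) x
    linarith

theorem aestronglyMeasurable_outwardNormal (h : IsGraphPatch Ω x r ι ν g K) :
    AEStronglyMeasurable (outwardNormal Ω) ((surfaceMeasure Ω).restrict (Metric.ball x r)) := by
  have hemb := measurableEmbedding_graphMap h.norm_eq_one h.inner_eq_zero h.lipschitzWith
  rw [h.surfaceMeasure_restrict, hemb.restrict_map, hemb.aestronglyMeasurable_map_iff]
  refine (measurable_graphNormal (ι := ι) (ν := ν) (g := g)).aestronglyMeasurable.congr ?_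
  refine (ae_restrict_iff' (hemb.measurable measurableSet_ball)).2 ?_
  filter_upwards [(withDensity_absolutelyContinuous _ _).ae_le h.ae_outwardNormal_eq] with v hv hb
  exact (hv hb).symm

end IsGraphPatch

theorem IsBoundedLipschitzDomain.isCompact_closure (hΩ : IsBoundedLipschitzDomain Ω) :
    IsCompact (closure Ω) := hΩ.isBounded.isCompact_closure

theorem IsBoundedLipschitzDomain.isCompact_frontier (hΩ : IsBoundedLipschitzDomain Ω) :
    IsCompact (frontier Ω) :=
  hΩ.isCompact_closure.of_isClosed_subset isClosed_frontier frontier_subset_closure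

theorem IsBoundedLipschitzDomain.isFiniteMeasure_surfaceMeasure (hd : 0 < d)
    (hΩ : IsBoundedLipschitzDomain Ω) : IsFiniteMeasure (surfaceMeasure Ω) := by
  have h : surfaceMeasure Ω (frontier Ω) < ⊤ := by
    refine hΩ.isCompact_frontier.measure_lt_top_of_nhdsWithin fun x hx => ?_
    obtain ⟨r, hr, ι, ν, g, K, hp⟩ := hΩ.exists_isGraphPatch hd hx
    exact ⟨_, mem_nhdsWithin_of_mem_nhds (Metric.ball_mem_nhds x hr), hp.surfaceMeasure_ball_lt_top⟩
  rw [surfaceMeasure, Measure.restrict_apply_self] at h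
  exact ⟨by rwa [surfaceMeasure, Measure.restrict_apply_univ]⟩

theorem IsBoundedLipschitzDomain.aestronglyMeasurable_outwardNormal (hd : 0 < d)
    (hΩ : IsBoundedLipschitzDomain Ω) :
    AEStronglyMeasurable (outwardNormal Ω) (surfaceMeasure Ω) := by
  choose! r hr ι ν g K hp using fun x (hx : x ∈ frontier Ω) => hΩ.exists_isGraphPatch hd hx
  obtain ⟨t, ht, htc⟩ := hΩ.isCompact_frontier.elim_nhds_subcover (fun x => Metric.ball x (r x))
    fun x hx => Metric.ball_mem_nhds x (hr x hx)
  have h1 : AEStronglyMeasurable (outwardNormal Ω)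
      ((surfaceMeasure Ω).restrict (⋃ x : t, Metric.ball (x : Eucl d) (r x))) :=
    aestronglyMeasurable_iUnion_iff.2 fun x =>
      (hp x (ht x x.2)).aestronglyMeasurable_outwardNormal
  have h2 := h1.mono_set (s := frontier Ω) (by simpa [iUnion_subtype] using htc)
  rwa [surfaceMeasure, Measure.restrict_restrict isClosed_frontier.measurableSet, inter_self] at h2

end Normal

/-! ### The divergence theorem on bounded Lipschitz domains -/

section GaussGreen

variable {d : ℕ} {Ω : Set (Eucl d)} {ψ F : Eucl d → ℝ} {M : ℝ}

theorem eventuallyEq_zero_mul_of_notMem_tsupport {y : Eucl d} (hy : y ∉ tsupport ψ) :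
    (fun z => ψ z * F z) =ᶠ[𝓝 y] fun _ => 0 := by
  filter_upwards [notMem_tsupport_iff_eventuallyEq.1 hy] with z hz
  simp [hz]

theorem fderiv_mul_eq_zero_of_notMem_tsupport {y : Eucl d} (hy : y ∉ tsupport ψ) :
    fderiv ℝ (fun z => ψ z * F z) y = 0 := by
  rw [(eventuallyEq_zero_mul_of_notMem_tsupport hy).fderiv_eq]
  simp

theorem differentiableAt_mul_of_notMem_tsupport {y : Eucl d} (hy : y ∉ tsupport ψ) :
    DifferentiableAt ℝ (fun z => ψ z * F z) y :=
  (differentiableAt_const (0 : ℝ)).congr_of_eventuallyEq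
    (eventuallyEq_zero_mul_of_notMem_tsupport hy)

theorem differentiableAt_mul_of_mem (hΩ : IsOpen Ω) (hψ : ContDiff ℝ 1 ψ)
    (hF : DifferentiableOn ℝ F Ω) {y : Eucl d} (hy : y ∈ Ω) :
    DifferentiableAt ℝ (fun z => ψ z * F z) y :=
  (hψ.differentiable one_ne_zero y).mul (hF.differentiableAt (hΩ.mem_nhds hy))

theorem norm_fderiv_mul_le {y : Eucl d} {B C C' : ℝ} (hψ : DifferentiableAt ℝ ψ y)
    (hF : DifferentiableAt ℝ F y) (hM : ‖fderiv ℝ F y‖ ≤ M) (hB : ‖F y‖ ≤ B) (hC : ‖ψ y‖ ≤ C)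
    (hC' : ‖fderiv ℝ ψ y‖ ≤ C') : ‖fderiv ℝ (fun z => ψ z * F z) y‖ ≤ C * M + B * C' := by
  rw [(hψ.hasFDerivAt.fun_mul hF.hasFDerivAt).fderiv]
  refine (norm_add_le _ _).trans ?_
  rw [norm_smul, norm_smul]
  have hC0 : 0 ≤ C := (norm_nonneg _).trans hC
  have hB0 : 0 ≤ B := (norm_nonneg _).trans hB
  gcongr

theorem exists_norm_fderiv_mul_le (hΩ : IsOpen Ω) (hψ : ContDiff ℝ 1 ψ) (hψc : HasCompactSupport ψ)
    (hF : DifferentiableOn ℝ F Ω) (hM : ∀ y ∈ Ω, ‖fderiv ℝ F y‖ ≤ M) {B : ℝ}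
    (hB : ∀ y ∈ Ω, ‖F y‖ ≤ B) :
    ∃ M', 0 ≤ M' ∧ ∀ y ∈ Ω, ‖fderiv ℝ (fun z => ψ z * F z) y‖ ≤ M' := by
  obtain ⟨C₁, hC₁⟩ := hψ.continuous.bounded_above_of_compact_support hψc
  obtain ⟨C₂, hC₂⟩ := (hψ.continuous_fderiv one_ne_zero).bounded_above_of_compact_support
    (hψc.fderiv ℝ)
  exact ⟨|C₁ * M + B * C₂|, abs_nonneg _, fun y hy =>
    (norm_fderiv_mul_le (hψ.differentiable one_ne_zero y) (hF.differentiableAt (hΩ.mem_nhds hy))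
      (hM y hy) (hB y hy) (hC₁ y) (hC₂ y)).trans (le_abs_self _)⟩

/-- The product is differentiable on the whole space, because it vanishes off the support of `ψ`,
and it is Lipschitz with compact support. Its derivatives therefore have integral zero. -/
theorem setIntegral_fderiv_mul_eq_zero (hΩ : IsOpen Ω) (hψ : ContDiff ℝ 1 ψ)
    (hψc : HasCompactSupport ψ) (hs : tsupport ψ ⊆ Ω)
    (hF : DifferentiableOn ℝ F Ω) (hM : ∀ y ∈ Ω, ‖fderiv ℝ F y‖ ≤ M) {B : ℝ}
    (hB : ∀ y ∈ Ω, ‖F y‖ ≤ B) (e : Eucl d) :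
    ∫ y in Ω, fderiv ℝ (fun z => ψ z * F z) y e = 0 := by
  set f : Eucl d → ℝ := fun z => ψ z * F z with hf
  obtain ⟨M', hM'0, hM'⟩ := exists_norm_fderiv_mul_le hΩ hψ hψc hF hM hB
  have hd : Differentiable ℝ f := fun y => by
    by_cases hy : y ∈ tsupport ψ
    · exact differentiableAt_mul_of_mem hΩ hψ hF (hs hy)
    · exact differentiableAt_mul_of_notMem_tsupport hy
  have hfL : LipschitzWith M'.toNNReal f := by
    refine lipschitzWith_of_nnnorm_fderiv_le hd fun y => ?_
    rw [← NNReal.coe_le_coe, Real.coe_toNNReal _ hM'0, coe_nnnorm]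
    by_cases hy : y ∈ tsupport ψ
    · exact hM' y (hs hy)
    · rw [fderiv_mul_eq_zero_of_notMem_tsupport hy, norm_zero]
      exact hM'0
  have hfc : HasCompactSupport f := hψc.mul_right
  rw [setIntegral_eq_integral_of_forall_compl_eq_zero fun y hy => by
    rw [fderiv_mul_eq_zero_of_notMem_tsupport fun h => hy (hs h)]; rfl]
  have h := LipschitzWith.integral_lineDeriv_mul_eq (μ := volume)
    (LipschitzWith.const (α := Eucl d) (1 : ℝ)) hfL hfc (-e)
  have h0 : ∀ x w, lineDeriv ℝ (fun _ : Eucl d => (1 : ℝ)) x w = 0 := fun x w => by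
    simp [lineDeriv]
  simp only [h0, zero_mul, integral_zero, neg_neg, mul_one] at h
  rw [h]
  exact integral_congr_ae (ae_of_all _ fun y => ((hd y).lineDeriv_eq_fderiv).symm)

/-- Since `ψ` is supported in the ball, `Ω` may be replaced by the full epigraph and `∂Ω` by the
full graph. The divergence theorem above a graph and the area formula then express both sides as the
same integral over the base. -/
theorem IsGraphPatch.setIntegral_fderiv_mul {x : Eucl d} {r : ℝ} {ι : Eucl (d - 1) →ₗᵢ[ℝ] Eucl d}
    {ν : Eucl d} {g : Eucl (d - 1) → ℝ} {K : NNReal} (h : IsGraphPatch Ω x r ι ν g K)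
    (hψ : ContDiff ℝ 1 ψ) (hs : tsupport ψ ⊆ Metric.ball x r) (hFc : ContinuousOn F (closure Ω))
    (hF : DifferentiableOn ℝ F Ω) (hM : ∀ y ∈ Ω, ‖fderiv ℝ F y‖ ≤ M) {B : ℝ}
    (hB : ∀ y ∈ Ω, ‖F y‖ ≤ B) (e : Eucl d) :
    ∫ y in Ω, fderiv ℝ (fun z => ψ z * F z) y e =
      ∫ y, ψ y * F y * ⟪outwardNormal Ω y, e⟫_ℝ ∂(surfaceMeasure Ω) := by
  set f : Eucl d → ℝ := fun z => ψ z * F z with hf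
  have hψc : HasCompactSupport ψ :=
    (isCompact_closedBall x r).of_isClosed_subset (isClosed_tsupport _)
      (hs.trans Metric.ball_subset_closedBall)
  obtain ⟨M', hM'0, hM'⟩ := exists_norm_fderiv_mul_le h.isOpen hψ hψc hF hM hB
  have hmem : ∀ y ∈ tsupport ψ, y ∈ openEpigraph ι ν g → y ∈ Ω := fun y hy hU =>
    (h.mem_iff_mem_openEpigraph (hs hy)).2 hU
  have hz : ∀ y, y ∉ Metric.ball x r → f y = 0 := fun y hy => by
    simp [hf, image_eq_zero_of_notMem_tsupport fun h' => hy (hs h')]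
  have hdz : ∀ y, y ∉ Metric.ball x r → fderiv ℝ f y e = 0 := fun y hy => by
    rw [fderiv_mul_eq_zero_of_notMem_tsupport fun h' => hy (hs h')]; rfl
  obtain ⟨v, s, he⟩ := exists_eq_add_smul (ι := ι) h.norm_eq_one h.inner_eq_zero h.finrank_eq e
  have key := setIntegral_fderiv_openEpigraph (f := f) (M := M') (R := ‖x‖ + r) h.norm_eq_one
    h.inner_eq_zero h.finrank_eq h.lipschitzWith
    (fun y hy => by
      by_cases hys : y ∈ tsupport ψ
      · exact differentiableAt_mul_of_mem h.isOpen hψ hF (hmem y hys hy)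
      · exact differentiableAt_mul_of_notMem_tsupport hys)
    (fun y hy => by
      by_cases hys : y ∈ tsupport ψ
      · exact hM' y (hmem y hys hy)
      · rw [fderiv_mul_eq_zero_of_notMem_tsupport hys, norm_zero]
        exact hM'0)
    (fun y hy => hz y fun hb => by
      have h1 := mem_ball_iff_norm.1 hb
      have h2 := norm_le_norm_add_norm_sub' y x
      linarith)
    -- `F` is continuous only on the closure of `Ω`, so one-sided continuity at the graph is needed:
    -- inside the ball, vertical lines approach it through that closure, and off the support of `ψ`
    -- the product vanishes.
    (fun y => by
      have hΨ : Continuous fun t : ℝ => graphShear ι ν g (y, t) :=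
        (continuous_graphShear h.lipschitzWith.continuous).comp (by fun_prop)
      by_cases hy : graphShear ι ν g (y, 0) ∈ Metric.ball x r
      · have hfc : ContinuousWithinAt f (closure Ω) (graphShear ι ν g (y, 0)) := by
          refine hψ.continuous.continuousWithinAt.mul (hFc _ (frontier_subset_closure ?_))
          rw [h.mem_frontier_iff hy, graphShear_zero]
          exact mem_range_self y
        have hev : ∀ᶠ t in 𝓝[≥] (0 : ℝ), graphShear ι ν g (y, t) ∈ closure Ω := by
          filter_upwards [hΨ.continuousAt.continuousWithinAt.eventually
            (Metric.isOpen_ball.mem_nhds hy), self_mem_nhdsWithin] with t ht1 ht2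
          rcases eq_or_lt_of_le (mem_Ici.1 ht2) with h0 | h0
          · subst h0
            refine frontier_subset_closure ?_
            rw [h.mem_frontier_iff hy, graphShear_zero]
            exact mem_range_self y
          · exact subset_closure ((h.mem_iff_mem_openEpigraph ht1).2
              ⟨(y, t), ⟨mem_univ _, h0⟩, rfl⟩)
        exact hfc.tendsto.comp (tendsto_nhdsWithin_iff.2
          ⟨hΨ.continuousAt.continuousWithinAt.tendsto, hev⟩)
      · have h0 := eventuallyEq_zero_mul_of_notMem_tsupport (F := F) fun h' => hy (hs h')
        have h1 : ContinuousAt f (graphShear ι ν g (y, 0)) :=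
          (continuousAt_const (y := (0 : ℝ))).congr h0.symm
        exact (h1.comp (f := fun t : ℝ => graphShear ι ν g (y, t))
          hΨ.continuousAt).continuousWithinAt)
    v s
  rw [← he] at key
  have e1 : ∫ y in Ω, fderiv ℝ f y e = ∫ y in openEpigraph ι ν g, fderiv ℝ f y e := by
    rw [setIntegral_eq_of_subset_of_forall_sdiff_eq_zero h.isOpen.measurableSet
        (inter_subset_left (t := Metric.ball x r)) fun y hy => hdz y fun hb => hy.2 ⟨hy.1, hb⟩,
      setIntegral_eq_of_subset_of_forall_sdiff_eq_zero
        (measurableSet_openEpigraph h.norm_eq_one h.inner_eq_zero h.lipschitzWith.continuous)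
        (inter_subset_left (t := Metric.ball x r)) fun y hy => hdz y fun hb => hy.2 ⟨hy.1, hb⟩]
    congr 2
    ext y
    simp only [mem_inter_iff, and_congr_left_iff]
    exact fun hy => h.mem_iff_mem_openEpigraph hy
  have e2 : ∫ y, f y * ⟪outwardNormal Ω y, e⟫_ℝ ∂(surfaceMeasure Ω) =
      ∫ y in range (graphMap ι ν g), f y * ⟪outwardNormal Ω y, e⟫_ℝ
        ∂(Measure.euclideanHausdorffMeasure (d - 1)) := by
    have hr : ∀ S : Set (Eucl d), ∀ y ∈ S \ (S ∩ Metric.ball x r),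
        f y * ⟪outwardNormal Ω y, e⟫_ℝ = 0 := fun S y hy => by
      rw [hz y fun hb => hy.2 ⟨hy.1, hb⟩, zero_mul]
    rw [surfaceMeasure, setIntegral_eq_of_subset_of_forall_sdiff_eq_zero
        isClosed_frontier.measurableSet inter_subset_left (hr _),
      setIntegral_eq_of_subset_of_forall_sdiff_eq_zero (measurableEmbedding_graphMap h.norm_eq_one
        h.inner_eq_zero h.lipschitzWith).measurableSet_range inter_subset_left (hr _)]
    congr 2
    ext y
    simp only [mem_inter_iff, and_congr_left_iff]
    exact fun hy => h.mem_frontier_iff hy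
  have e3 := setIntegral_range_graphMap h.norm_eq_one h.inner_eq_zero h.lipschitzWith
    fun y => f y * ⟪outwardNormal Ω y, e⟫_ℝ
  rw [finrank_euclideanSpace_fin] at e3
  rw [e1, key]
  refine Eq.trans ?_ (e2.trans e3).symm
  refine integral_congr_ae ?_
  filter_upwards [h.ae_outwardNormal_eq] with y hy
  by_cases hb : graphMap ι ν g y ∈ Metric.ball x r
  · rw [hy hb, he, ← graphDensity_mul_inner_graphNormal h.norm_eq_one h.inner_eq_zero]
    ring
  · rw [hz _ hb]; ring

theorem integrableOn_fderiv_apply_of_norm_le {f : Eucl d → ℝ} (hΩ : IsOpen Ω)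
    (hvol : volume Ω ≠ ⊤) (hM : ∀ y ∈ Ω, ‖fderiv ℝ f y‖ ≤ M) (e : Eucl d) :
    IntegrableOn (fun y => fderiv ℝ f y e) Ω := by
  refine Measure.integrableOn_of_bounded (M := M * ‖e‖) hvol
    (measurable_fderiv_apply_const ℝ f e).aestronglyMeasurable
    ((ae_restrict_iff' hΩ.measurableSet).2 (ae_of_all _ fun y hy => ?_))
  exact (ContinuousLinearMap.le_opNorm _ _).trans (by gcongr; exact hM y hy)

theorem IsBoundedLipschitzDomain.integrable_mul_inner_outwardNormal (hd : 0 < d)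
    (hΩ : IsBoundedLipschitzDomain Ω) (hFc : ContinuousOn F (closure Ω)) (e : Eucl d) :
    Integrable (fun y => F y * ⟪outwardNormal Ω y, e⟫_ℝ) (surfaceMeasure Ω) := by
  have := hΩ.isFiniteMeasure_surfaceMeasure hd
  have hFf : ContinuousOn F (frontier Ω) := hFc.mono frontier_subset_closure
  obtain ⟨B, hB⟩ := hΩ.isCompact_frontier.exists_bound_of_continuousOn hFf
  have hm : MeasurableSet (frontier Ω) := isClosed_frontier.measurableSet
  refine Integrable.of_bound ((hFf.aestronglyMeasurable hm).mul
    ((hΩ.aestronglyMeasurable_outwardNormal hd).inner aestronglyMeasurable_const)) (B * ‖e‖) ?_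
  refine (ae_restrict_iff' hm).2 (ae_of_all _ fun y hy => ?_)
  have hB0 : 0 ≤ B := (norm_nonneg _).trans (hB y hy)
  rw [norm_mul]
  gcongr
  · exact hB y hy
  · refine (norm_inner_le_norm _ _).trans ?_
    exact mul_le_of_le_one_left (norm_nonneg _) (norm_outwardNormal_le y)

/-- The divergence theorem for functions with a bounded derivative on a bounded Lipschitz domain. -/
theorem IsBoundedLipschitzDomain.setIntegral_fderiv_eq (hd : 0 < d)
    (hΩ : IsBoundedLipschitzDomain Ω) (hFc : ContinuousOn F (closure Ω))
    (hF : DifferentiableOn ℝ F Ω) (hM : ∀ y ∈ Ω, ‖fderiv ℝ F y‖ ≤ M) (e : Eucl d) :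
    ∫ y in Ω, fderiv ℝ F y e = ∫ y, F y * ⟪outwardNormal Ω y, e⟫_ℝ ∂(surfaceMeasure Ω) := by
  obtain ⟨B, hB'⟩ := hΩ.isCompact_closure.exists_bound_of_continuousOn hFc
  have hB : ∀ y ∈ Ω, ‖F y‖ ≤ B := fun y hy => hB' y (subset_closure hy)
  have hvol : volume Ω ≠ ⊤ := hΩ.isBounded.measure_lt_top.ne
  have hloc : ∀ x ∈ closure Ω, ∃ r > 0, ∀ ψ : Eucl d → ℝ, ContDiff ℝ 1 ψ →
      tsupport ψ ⊆ Metric.ball x r → ∫ y in Ω, fderiv ℝ (fun z => ψ z * F z) y e =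
        ∫ y, ψ y * F y * ⟪outwardNormal Ω y, e⟫_ℝ ∂(surfaceMeasure Ω) := by
    intro x hx
    by_cases hxΩ : x ∈ Ω
    · obtain ⟨r, hr, hrΩ⟩ := Metric.isOpen_iff.1 hΩ.isOpen x hxΩ
      refine ⟨r, hr, fun ψ hψ hs => ?_⟩
      have hψc : HasCompactSupport ψ :=
        (isCompact_closedBall x r).of_isClosed_subset (isClosed_tsupport _)
          (hs.trans Metric.ball_subset_closedBall)
      rw [setIntegral_fderiv_mul_eq_zero hΩ.isOpen hψ hψc (hs.trans hrΩ) hF hM hB, surfaceMeasure,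
        setIntegral_eq_zero_of_forall_eq_zero]
      intro y hy
      rw [hΩ.isOpen.frontier_eq] at hy
      rw [image_eq_zero_of_notMem_tsupport fun h' => hy.2 (hrΩ (hs h'))]
      ring
    · obtain ⟨r, hr, ι, ν, g, K, hp⟩ := hΩ.exists_isGraphPatch hd (x := x)
        (by rw [hΩ.isOpen.frontier_eq]; exact ⟨hx, hxΩ⟩)
      exact ⟨r, hr, fun ψ hψ hs => hp.setIntegral_fderiv_mul hψ hs hFc hF hM hB e⟩
  choose! r hr hψ using hloc
  obtain ⟨t, ht, htc⟩ := hΩ.isCompact_closure.elim_nhds_subcover (fun x => Metric.ball x (r x))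
    fun x hx => Metric.ball_mem_nhds x (hr x hx)
  obtain ⟨ρ, hρ⟩ := SmoothPartitionOfUnity.exists_isSubordinate (modelWithCornersSelf ℝ (Eucl d))
    (isClosed_closure (s := Ω)) (fun x : t => Metric.ball (x : Eucl d) (r x))
    (fun _ => Metric.isOpen_ball) (by simpa [iUnion_subtype] using htc)
  have hρs : ∀ i, ContDiff ℝ 1 (ρ i) := fun i =>
    ((ρ i).contMDiff.contDiff).of_le (by exact_mod_cast le_top)
  have hρc : ∀ i, HasCompactSupport (ρ i) := fun i =>
    (isCompact_closedBall (i : Eucl d) (r i)).of_isClosed_subset (isClosed_tsupport _)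
      ((hρ i).trans Metric.ball_subset_closedBall)
  have hsum : ∀ y ∈ closure Ω, ∑ i, ρ i y = 1 := fun y hy => by
    rw [← finsum_eq_sum_of_fintype]
    exact ρ.sum_eq_one hy
  -- The partition sums to `1` on the closure of `Ω`, hence near each point of the open set `Ω`, so
  -- the identity may be differentiated there.
  have hL : ∀ y ∈ Ω, fderiv ℝ F y e = ∑ i, fderiv ℝ (fun z => ρ i z * F z) y e := by
    intro y hy
    have h1 : HasFDerivAt (fun z => ∑ i, ρ i z * F z) (∑ i, fderiv ℝ (fun z => ρ i z * F z) y) y :=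
      HasFDerivAt.fun_sum fun i _ =>
        (differentiableAt_mul_of_mem hΩ.isOpen (hρs i) hF hy).hasFDerivAt
    have h2 : F =ᶠ[𝓝 y] fun z => ∑ i, ρ i z * F z := by
      filter_upwards [hΩ.isOpen.mem_nhds hy] with z hz
      rw [← Finset.sum_mul, hsum z (subset_closure hz), one_mul]
    rw [h2.fderiv_eq, h1.fderiv, sum_apply]
  rw [setIntegral_congr_fun hΩ.isOpen.measurableSet hL, integral_finsetSum]
  · rw [Finset.sum_congr rfl fun (i : t) _ => hψ i (ht i i.2) (ρ i) (hρs i) (hρ i),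
      ← integral_finsetSum]
    · refine setIntegral_congr_fun isClosed_frontier.measurableSet fun y hy => ?_
      rw [← Finset.sum_mul, ← Finset.sum_mul, hsum y (frontier_subset_closure hy), one_mul]
    · exact fun i _ => hΩ.integrable_mul_inner_outwardNormal hd
        ((hρs i).continuous.continuousOn.mul hFc) e
  · intro i _
    obtain ⟨M', -, hM'⟩ := exists_norm_fderiv_mul_le hΩ.isOpen (hρs i) (hρc i) hF hM hB
    exact integrableOn_fderiv_apply_of_norm_le hΩ.isOpen hvol hM' e

end GaussGreen

/-! ### The Neumann problem -/

section Neumann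

theorem MeasureTheory.MemLp.tendsto_integral_inner {α E : Type*} [MeasurableSpace α]
    [NormedAddCommGroup E] [InnerProductSpace ℝ E] {μ : Measure α} {g u : α → E}
    {f : ℕ → α → E} (hg : MemLp g 2 μ) (hf : ∀ k, MemLp (f k) 2 μ) (hu : MemLp u 2 μ)
    (h : Tendsto (fun k => eLpNorm (f k - u) 2 μ) atTop (𝓝 0)) :
    Tendsto (fun k => ∫ x, ⟪g x, f k x⟫_ℝ ∂μ) atTop (𝓝 (∫ x, ⟪g x, u x⟫_ℝ ∂μ)) := by
  have hin : ∀ {w : α → E} (hw : MemLp w 2 μ),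
      ∫ x, ⟪g x, w x⟫_ℝ ∂μ = ⟪hg.toLp g, hw.toLp w⟫_ℝ := fun {w} hw => by
    rw [L2.inner_def]
    refine integral_congr_ae ?_
    filter_upwards [hg.coeFn_toLp, hw.coeFn_toLp] with x h1 h2
    rw [h1, h2]
  simp only [hin (hf _), hin hu]
  exact tendsto_const_nhds.inner ((Lp.tendsto_Lp_iff_tendsto_eLpNorm'' _ hf _ hu).2 h)

theorem ContinuousOn.memLp_two_restrict {α E : Type*} [TopologicalSpace α] [MeasurableSpace α]
    [OpensMeasurableSpace α] [NormedAddCommGroup E] {μ : Measure α}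
    {f : α → E} {S T : Set α} (hf : ContinuousOn f S) (hS : IsCompact S) (hT : MeasurableSet T)
    (hTS : T ⊆ S) (hμ : μ T ≠ ⊤) : MemLp f 2 (μ.restrict T) := by
  obtain ⟨C, hC⟩ := hS.exists_bound_of_continuousOn hf
  have : IsFiniteMeasure (μ.restrict T) := isFiniteMeasure_restrict.2 hμ
  exact MemLp.of_bound (hf.aestronglyMeasurable_of_subset_isCompact hS hT hTS) C
    ((ae_restrict_iff' hT).2 (ae_of_all _ fun x hx => hC x (hTS hx)))

variable {d : ℕ} {Ω : Set (Eucl d)} {A : Eucl d → Eucl d}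

theorem IsC1UpToBoundary.exists_norm_fderiv_le (hA : IsC1UpToBoundary Ω A)
    (hΩ : IsCompact (closure Ω)) : ∃ M, ∀ y ∈ Ω, ‖fderiv ℝ A y‖ ≤ M := by
  obtain ⟨A', hA', he⟩ := hA.2.2
  obtain ⟨M, hM⟩ := hΩ.exists_bound_of_continuousOn hA'
  exact ⟨M, fun y hy => by rw [he hy]; exact hM y (subset_closure hy)⟩

theorem IsC1UpToBoundary.memLp_divergence (hA : IsC1UpToBoundary Ω A) (hΩ : IsOpen Ω)
    (hΩc : IsCompact (closure Ω)) : MemLp (divergence A) 2 (volume.restrict Ω) := by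
  obtain ⟨A', hA', he⟩ := hA.2.2
  have h : ContinuousOn (fun x => ∑ i : Fin d, (A' x (EuclideanSpace.single i (1 : ℝ))) i)
      (closure Ω) :=
    continuousOn_finsetSum _ fun i _ => by fun_prop
  refine (h.memLp_two_restrict hΩc hΩ.measurableSet subset_closure
    ((measure_mono subset_closure).trans_lt hΩc.measure_lt_top).ne).ae_eq ?_
  refine (ae_restrict_iff' hΩ.measurableSet).2 (ae_of_all _ fun x hx => ?_)
  simp only [divergence, he hx]

theorem hasFDerivAt_coord {x : Eucl d} (hA : DifferentiableAt ℝ A x) (i : Fin d) :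
    HasFDerivAt (fun y => A y i) ((EuclideanSpace.proj i).comp (fderiv ℝ A x)) x :=
  (EuclideanSpace.proj (𝕜 := ℝ) i).hasFDerivAt.comp x hA.hasFDerivAt

/-- Integration by parts on a bounded Lipschitz domain for smooth test functions. -/
theorem IsBoundedLipschitzDomain.setIntegral_inner_gradient (hd : 0 < d)
    (hΩ : IsBoundedLipschitzDomain Ω) (hA : IsC1UpToBoundary Ω A) {φ : Eucl d → ℝ}
    (hφ : ContDiff ℝ 1 φ) :
    ∫ x in Ω, ⟪A x, ∇ φ x⟫_ℝ = ∫ x, ⟪A x, outwardNormal Ω x⟫_ℝ * φ x ∂(surfaceMeasure Ω) -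
      ∫ x in Ω, divergence A x * φ x := by
  have hc := hΩ.isCompact_closure
  have hvol : volume Ω ≠ ⊤ := hΩ.isBounded.measure_lt_top.ne
  have hgrad : Continuous (∇ φ) := hφ.continuous_gradient one_ne_zero
  obtain ⟨M, hM⟩ := hA.exists_norm_fderiv_le hc
  obtain ⟨B, hB⟩ := hc.exists_bound_of_continuousOn hA.1
  obtain ⟨C, hC⟩ := hc.exists_bound_of_continuousOn hφ.continuous.continuousOn
  obtain ⟨C', hC'⟩ := hc.exists_bound_of_continuousOn
    (hφ.continuous_fderiv one_ne_zero).continuousOn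
  have hAd : ∀ x ∈ Ω, DifferentiableAt ℝ A x := fun x hx =>
    hA.2.1.differentiableAt (hΩ.isOpen.mem_nhds hx)
  have hAi : ∀ i, ContinuousOn (fun y => A y i) (closure Ω) := fun i =>
    (EuclideanSpace.proj (𝕜 := ℝ) i).continuous.comp_continuousOn hA.1
  have hAid : ∀ i, DifferentiableOn ℝ (fun y => A y i) Ω := fun i x hx =>
    (hasFDerivAt_coord (hAd x hx) i).differentiableAt.differentiableWithinAt
  have hproj : ∀ (i : Fin d) (z : Eucl d), ‖z i‖ ≤ ‖z‖ := fun i z => PiLp.norm_apply_le z i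
  have hFM : ∀ i, ∀ x ∈ Ω, ‖fderiv ℝ (fun y => φ y * A y i) x‖ ≤ C * M + B * C' := by
    intro i x hx
    refine norm_fderiv_mul_le (hφ.differentiable one_ne_zero x)
      (hasFDerivAt_coord (hAd x hx) i).differentiableAt ?_
      ((hproj i _).trans (hB x (subset_closure hx))) (hC x (subset_closure hx))
      (hC' x (subset_closure hx))
    rw [(hasFDerivAt_coord (hAd x hx) i).fderiv]
    refine ContinuousLinearMap.opNorm_le_bound _ ((norm_nonneg _).trans (hM x hx)) fun z => ?_
    exact (hproj i _).trans ((ContinuousLinearMap.le_opNorm _ _).trans (by gcongr; exact hM x hx))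
  have hFc : ∀ i, ContinuousOn (fun y => φ y * A y i) (closure Ω) := fun i =>
    hφ.continuous.continuousOn.mul (hAi i)
  -- The divergence theorem for `φ A`, one component at a time.
  have hgg : ∀ i : Fin d, ∫ x in Ω, fderiv ℝ (fun y => φ y * A y i) x
      (EuclideanSpace.single i (1 : ℝ)) = ∫ x, φ x * A x i *
        ⟪outwardNormal Ω x, EuclideanSpace.single i (1 : ℝ)⟫_ℝ ∂(surfaceMeasure Ω) := fun i => hΩ.setIntegral_fderiv_eq hd (hFc i)
    (hφ.differentiable one_ne_zero |>.differentiableOn.mul (hAid i)) (hFM i)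
    (EuclideanSpace.single i (1 : ℝ))
  have hsum := Finset.sum_congr (rfl : (Finset.univ : Finset (Fin d)) = _) fun i _ => hgg i
  rw [← integral_finsetSum _ fun i _ =>
      integrableOn_fderiv_apply_of_norm_le hΩ.isOpen hvol (hFM i) _,
    ← integral_finsetSum _ fun i _ => hΩ.integrable_mul_inner_outwardNormal hd (hFc i) _] at hsum
  have hL : ∀ x ∈ Ω, ∑ i : Fin d, fderiv ℝ (fun y => φ y * A y i) x
      (EuclideanSpace.single i (1 : ℝ)) = divergence A x * φ x + ⟪A x, ∇ φ x⟫_ℝ := by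
    intro x hx
    rw [divergence, PiLp.inner_apply, Finset.sum_mul, ← Finset.sum_add_distrib]
    refine Finset.sum_congr rfl fun i _ => ?_
    have h1 := (hφ.differentiable one_ne_zero x).hasFDerivAt.fun_mul
      (hasFDerivAt_coord (hAd x hx) i)
    have h2 := inner_gradient_left (𝕜 := ℝ) (f := φ) (x := x)
      (y := EuclideanSpace.single i (1 : ℝ))
    rw [EuclideanSpace.inner_single_right, one_mul, RCLike.conj_to_real] at h2
    rw [h1.fderiv, h2]
    simp
    ring
  have hR : ∀ x, ∑ i : Fin d, φ x * A x i *
      ⟪outwardNormal Ω x, EuclideanSpace.single i (1 : ℝ)⟫_ℝ =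
        ⟪A x, outwardNormal Ω x⟫_ℝ * φ x := by
    intro x
    rw [PiLp.inner_apply, Finset.sum_mul]
    refine Finset.sum_congr rfl fun i _ => ?_
    rw [EuclideanSpace.inner_single_right]
    simp
    ring
  have hA2 : MemLp A 2 (volume.restrict Ω) :=
    hA.1.memLp_two_restrict hc hΩ.isOpen.measurableSet subset_closure hvol
  have hg2 : MemLp (∇ φ) 2 (volume.restrict Ω) :=
    hgrad.continuousOn.memLp_two_restrict hc hΩ.isOpen.measurableSet subset_closure hvol
  have hφ2 : MemLp φ 2 (volume.restrict Ω) :=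
    hφ.continuous.continuousOn.memLp_two_restrict hc hΩ.isOpen.measurableSet subset_closure hvol
  have hdiv : Integrable (fun x => divergence A x * φ x) (volume.restrict Ω) :=
    (hA.memLp_divergence hΩ.isOpen hc).integrable_mul hφ2
  rw [setIntegral_congr_fun hΩ.isOpen.measurableSet hL,
    integral_add hdiv (integrable_inner_of_memLp_two hA2 hg2)] at hsum
  simp only [hR] at hsum
  linarith

/-- The smooth functions that define the trace satisfy integration by parts against `A`. Each of the
three integrals is an `L²` pairing with a fixed function, on `Ω` or on `∂Ω`, so it passes to the
limit; no trace theorem is needed. -/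
theorem IsBoundedLipschitzDomain.isWeakNeumannSolution (hd : 0 < d)
    (hΩ : IsBoundedLipschitzDomain Ω) (hA : IsC1UpToBoundary Ω A) {a : Eucl d → ℝ}
    (ha : MemH1 Ω a) (h : ∀ v, MemH1 Ω v → ∫ x in Ω, ⟪weakGrad Ω a x, weakGrad Ω v x⟫_ℝ =
      ∫ x in Ω, ⟪A x, weakGrad Ω v x⟫_ℝ) :
    IsWeakNeumannSolution Ω (divergence A) (fun x => ⟪A x, outwardNormal Ω x⟫_ℝ) a := by
  refine ⟨ha, fun v w hv hw => ?_⟩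
  obtain ⟨-, hw2, φ, hφ, hφv, hφg, hφw⟩ := hw
  have hc := hΩ.isCompact_closure
  have hm := hΩ.isOpen.measurableSet
  have hvol : volume Ω ≠ ⊤ := hΩ.isBounded.measure_lt_top.ne
  have hfin := hΩ.isFiniteMeasure_surfaceMeasure hd
  have hfm : MeasurableSet (frontier Ω) := isClosed_frontier.measurableSet
  have hsv : Measure.euclideanHausdorffMeasure (d - 1) (frontier Ω) ≠ ⊤ :=
    isFiniteMeasure_restrict.1 hfin
  have hA2 : MemLp A 2 (volume.restrict Ω) := hA.1.memLp_two_restrict hc hm subset_closure hvol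
  have hAs : MemLp A 2 (surfaceMeasure Ω) :=
    hA.1.memLp_two_restrict hc hfm frontier_subset_closure hsv
  have hn : MemLp (fun x => ⟪A x, outwardNormal Ω x⟫_ℝ) 2 (surfaceMeasure Ω) := by
    refine hAs.mono (hAs.1.inner (hΩ.aestronglyMeasurable_outwardNormal hd))
      (ae_of_all _ fun x => (norm_inner_le_norm _ _).trans ?_)
    exact mul_le_of_le_one_right (norm_nonneg _) (norm_outwardNormal_le x)
  have hφ1 : ∀ k, ContDiff ℝ 1 (φ k) := fun k => (hφ k).of_le (by exact_mod_cast le_top)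
  have t1 := hA2.tendsto_integral_inner (fun k => ((hφ1 k).continuous_gradient
    one_ne_zero).continuousOn.memLp_two_restrict hc hm subset_closure hvol)
    (hv.memLp_weakGrad hΩ.isOpen) hφg
  have t2 := (hA.memLp_divergence hΩ.isOpen hc).tendsto_integral_inner
    (fun k => (hφ1 k).continuous.continuousOn.memLp_two_restrict hc hm subset_closure hvol)
    hv.1 hφv
  have t3 := hn.tendsto_integral_inner (fun k => (hφ1 k).continuous.continuousOn.memLp_two_restrict
    hc hfm frontier_subset_closure hsv) hw2 hφw
  have hmul : ∀ s t : ℝ, ⟪s, t⟫_ℝ = s * t := fun s t => by simp [mul_comm]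
  simp only [hmul] at t2 t3
  rw [h v hv]
  refine tendsto_nhds_unique t1 ((t3.sub t2).congr fun k => ?_)
  exact (hΩ.setIntegral_inner_gradient hd hA (hφ1 k)).symm

end Neumann

/-! ### The canonical gauge theorem. -/

theorem theorem2p2 {d : ℕ} (hd : 0 < d) {Ω : Set (Eucl d)} (hΩ : IsBoundedLipschitzDomain Ω)
    {A : Eucl d → Eucl d} (hA : IsC1UpToBoundary Ω A) :
    -- a minimizer exists
    (∃ a, IsGaugeMinimizer Ω A a) ∧
    ∀ a, IsGaugeMinimizer Ω A a →
      -- the minimizers are exactly the functions that differ from `a` by an additive constant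
      (∀ b, IsGaugeMinimizer Ω A b ↔ ∃ c : ℝ, b =ᵐ[volume.restrict Ω] fun x => a x + c) ∧
      -- `a` is a weak solution of `Δa = ∇ · A` in `Ω`, `∇a · n = A · n` on `∂Ω`
      IsWeakNeumannSolution Ω (divergence A) (fun x => ⟪A x, outwardNormal Ω x⟫_ℝ) a ∧
      (∀ v, MemH1 Ω v → ∫ x in Ω, ⟪weakGrad Ω a x, weakGrad Ω v x⟫_ℝ =
        ∫ x in Ω, ⟪A x, weakGrad Ω v x⟫_ℝ) ∧
      -- `F = A - ∇a` is divergence-free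
      HasWeakDivergence Ω (A - weakGrad Ω a) 0 ∧
      -- `F` is the gauge equivalent to `A` of minimal `L²` norm
      IsGaugeEquivalent Ω A (A - weakGrad Ω a) ∧
      ∀ G, IsGaugeEquivalent Ω A G →
        eLpNorm (A - weakGrad Ω a) 2 (volume.restrict Ω) ≤ eLpNorm G 2 (volume.restrict Ω) ∧
        (eLpNorm G 2 (volume.restrict Ω) = eLpNorm (A - weakGrad Ω a) 2 (volume.restrict Ω) →
          G =ᵐ[volume.restrict Ω] A - weakGrad Ω a) := by
  have hP := hΩ.hasPoincareOn
  have ho := hΩ.isOpen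
  have hvol : volume Ω ≠ ⊤ := hΩ.isBounded.measure_lt_top.ne
  have hvol0 : volume Ω ≠ 0 := (ho.measure_pos volume hΩ.isConnected.nonempty).ne'
  have hA2 : MemLp A 2 (volume.restrict Ω) :=
    hA.1.memLp_two_restrict hΩ.isCompact_closure ho.measurableSet subset_closure hvol
  refine ⟨hP.exists_isGaugeMinimizer ho hvol hvol0 hA2, fun a ha => ?_⟩
  have h := fun v (hv : MemH1 Ω v) => hP.integral_inner_weakGrad_eq ho hvol hA2 ha hv
  exact ⟨hP.isGaugeMinimizer_iff_add_const ho hvol hA2 ha,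
    hΩ.isWeakNeumannSolution hd hA ha.1 h, h, hP.hasWeakDivergence_zero ho hvol hA2 ha,
    ha.1.isGaugeEquivalent_sub A, fun G hG => hP.eLpNorm_le_of_isGaugeEquivalent ho hvol hA2 ha hG⟩
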